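/- Fix $d$ and constants $\gamma,L,T>0$. There are constants $C_1,C_2$ and a function $C_3:\mathbb{R}\to\mathbb{R}$, depending only on $(d,\gamma,L,T)$, such that the following holds. Let $b:\mathbb{R}^d\times L^2(\mathbb{R}^d)\to\mathbb{R}^d$, $\sigma:\mathbb{R}^d\times L^2(\mathbb{R}^d)\to\mathbb{R}^{d\times d}$, $a=\frac12\sigma\sigma^*$, and assume: (H1) $\sum_{i,j}a_{ij}(x,m)\xi_i\xi_j\ge\gamma|\xi|^2$ for all $\xi,x\in\mathbb{R}^d$, $m\in L^2(\mathbb{R}^d)$. (H2) For every $m$, $b(\cdot,m)$ is differentiable and $\sigma(\cdot,m)$ is twice differentiable. Each functional $F\in\{b_i,\ \partial_{x_j}b_i,\ \sigma_{ij},\ \partial_{x_k}\sigma_{ij},\ \partial_{x_k}\partial_{x_l}\sigma_{ij}\}$ has a derivative $\frac{\partial F}{\partial m}(x,m)\in W^{1,2}(\mathbb{R}^d)$, that is, $\frac{d}{d\theta}F(x,m+\theta\tilde m)|_{\theta=0}=\int\frac{\partial F}{\partial m}(x,m)(\xi)\tilde m(\xi)\,d\xi$ for all $\tilde m\in L^2(\mathbb{R}^d)$,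 with $|F(x,m)|+\|\frac{\partial F}{\partial m}(x,m)\|_{W^{1,2}}\le L$ and $$|F(x',m')-F(x,m)|+\Big\|\frac{\partial F}{\partial m}(x',m')-\frac{\partial F}{\partial m}(x,m)\Big\|_{L^2}\le L(|x'-x|+\|m'-m\|_{L^2}).$$ Assume also that $b$ and $\sigma$ do not depend on $x$. Then for all $t\in[0,T]$ and $\mu\in W^{1,2}(\mathbb{R}^d)$ the Fokker-Planck equation $$\partial_s m=\sum_{i,j}\partial_{x_i}\partial_{x_j}[a_{ij}(x,m(s))\,m]-\sum_i\partial_{x_i}[b_i(x,m(s))\,m]\ \text{ on }(t,T]\times\mathbb{R}^d,\qquad m(t)=\mu,$$ has a unique weak solution $m^{t,\mu}\in L^2([t,T];W^{1,2}(\mathbb{R}^d))\cap L^\infty([t,T];L^2(\mathbb{R}^d))$ (the weakly continuous representative in time is taken), and assumption (H3) holds, as follows. The linear equation $$\partial_s f=\sum_{i,j}\partial_{x_i}\partial_{x_j}[a_{ij}(x,m^{t,\mu}(s))f]-\sum_i\partial_{x_i}[b_i(x,m^{t,\mu}(s))f]\ \text{ on }(t,T]\times\mathbb{R}^d\times\mathbb{R}^d,\qquad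 f(t,x,y)=\delta(x-y),$$ has a weak solution $f^{t,\mu}(s,x,y)$, of the form $h^{t,\mu}(s,x-y)$ where $h^{t,\mu}$ is a weak solution of $\partial_s h=\sum_{i,j}a_{ij}(m^{t,\mu}(s))\partial_{z_i}\partial_{z_j}h-\sum_i b_i(m^{t,\mu}(s))\partial_{z_i}h$, $h(t,z)=\delta(z)$. For every $\varphi\in L^2(\mathbb{R}^d)$ the function $\phi^{t,\mu}(s,y)=\int f^{t,\mu}(s,x,y)\varphi(x)\,dx$ for $s\in(t,T]$, $\phi^{t,\mu}(t,\cdot)=\varphi$, is well defined for almost every $y$ and satisfies $$\sup_{t\le s\le T}\|\phi^{t,\mu}(s,\cdot)\|_{L^2}+\|\phi^{t,\mu}\|_{L^2([t,T];W^{1,2})}\le C_1\|\varphi\|_{L^2}.$$ If moreover $\varphi\in W^{1,2}(\mathbb{R}^d)$, then $\phi^{t,\mu}$ has a time derivative $\phi^{t,\mu}_s\in L^2([t,T];L^2(\mathbb{R}^d))$ with $$\|\phi_s^{t,\mu}\|_{L^2([t,T];L^2)}\le C_2\|\varphi\|_{W^{1,2}},$$ and for all $\mu,\mu'\in W^{1,2}(\mathbb{R}^d)$,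 $$\sup_{t\le s\le T}\|\phi^{t,\mu'}(s,\cdot)-\phi^{t,\mu}(s,\cdot)\|_{L^2}\le C_3(\|\mu\|_{W^{1,2}})\,\|\varphi\|_{W^{1,2}}\,\|\mu'-\mu\|_{L^2}.$$ -/

import Mathlib

open MeasureTheory Set
open scoped ContDiff ENNReal Matrix

noncomputable section

namespace FokkerPlanck

/-- The state space `ℝ^d` with its Euclidean norm. -/
abbrev E (d : ℕ) : Type := EuclideanSpace ℝ (Fin d)

/-- The Hilbert space `L²(ℝ^d)` of real square-integrable functions (Lebesgue measure). -/
abbrev L2 (d : ℕ) : Type := Lp ℝ 2 (volume : Measure (E d))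

/-- Classical partial derivative `∂ψ/∂x_i`. -/
def partialDeriv {d : ℕ} (i : Fin d) (ψ : E d → ℝ) (x : E d) : ℝ :=
  fderiv ℝ ψ x (EuclideanSpace.single i 1)

/-- Test functions `C_c^∞(ℝ^d)`. -/
def IsTest {d : ℕ} (ψ : E d → ℝ) : Prop :=
  ContDiff ℝ ∞ ψ ∧ HasCompactSupport ψ

/-- `v` is the generalized partial derivative `∂u/∂x_i` of `u`. -/
def IsWeakPartial {d : ℕ} (i : Fin d) (u v : L2 d) : Prop :=
  ∀ ψ : E d → ℝ, IsTest ψ →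
    ∫ x, u x * partialDeriv i ψ x = - ∫ x, v x * ψ x

/-- `u ∈ W^{1,2}(ℝ^d)`. -/
def MemW12 {d : ℕ} (u : L2 d) : Prop :=
  ∃ g : Fin d → L2 d, ∀ i, IsWeakPartial i u (g i)

/-- The extended norm of `W^{1,2}(ℝ^d)`. The generalized gradient `g` is unique when it exists, so
the infimum is its value there; it is `∞` when `u` is not in `W^{1,2}(ℝ^d)`. -/
def enormW12 {d : ℕ} (u : L2 d) : ℝ≥0∞ :=
  ⨅ (g : Fin d → L2 d) (_ : ∀ i, IsWeakPartial i u (g i)),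
    (‖u‖ₑ ^ 2 + ∑ i, ‖g i‖ₑ ^ 2) ^ (1 / 2 : ℝ)

/-- `u ∈ L²([t,T]; W^{1,2}(ℝ^d))`. -/
def MemL2W12 {d : ℕ} (t T : ℝ) (u : ℝ → L2 d) : Prop :=
  MemLp u 2 (volume.restrict (Icc t T)) ∧
    ∃ g : Fin d → ℝ → L2 d,
      (∀ i, MemLp (g i) 2 (volume.restrict (Icc t T))) ∧
      ∀ᵐ s ∂(volume.restrict (Icc t T)), ∀ i, IsWeakPartial i (u s) (g i s)

/-- The norm of `L²([t,T]; W^{1,2}(ℝ^d))`. -/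
def enormL2W12 {d : ℕ} (t T : ℝ) (u : ℝ → L2 d) : ℝ≥0∞ :=
  (∫⁻ s in Icc t T, enormW12 (u s) ^ 2) ^ (1 / 2 : ℝ)

/-- The supremum over `[t,T]` of the `L²(ℝ^d)` norm. -/
def esupL2 {d : ℕ} (t T : ℝ) (u : ℝ → L2 d) : ℝ≥0∞ :=
  ⨆ s ∈ Icc t T, ‖u s‖ₑ

/-- `v ∈ L²([t,T]; L²(ℝ^d))` is the time derivative `u_s` of `u` on `[t,T]`: `u` is absolutely
continuous in `L²(ℝ^d)` on `[t,T]`, being the Bochner integral of `v`. -/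
def IsTimeDeriv {d : ℕ} (t T : ℝ) (u v : ℝ → L2 d) : Prop :=
  MemLp v 2 (volume.restrict (Icc t T)) ∧
    ∀ s ∈ Icc t T, u s = u t + ∫ r in t..s, v r

/-- The diffusion matrix `a = σ σ^* / 2`. -/
def diffusion {d : ℕ} (σ : E d → L2 d → Matrix (Fin d) (Fin d) ℝ) (x : E d) (m : L2 d)
    (i j : Fin d) : ℝ :=
  (1 / 2 : ℝ) * (σ x m * (σ x m)ᵀ) i j

/-- Uniform ellipticity of `a` with constant `γ`. -/
def UniformlyElliptic {d : ℕ} (γ : ℝ) (σ : E d → L2 d → Matrix (Fin d) (Fin d) ℝ) : Prop :=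
  ∀ (x : E d) (m : L2 d) (ξ : E d),
    γ * ‖ξ‖ ^ 2 ≤ ∑ i, ∑ j, diffusion σ x m i j * ξ i * ξ j

/-- The functional `F(x, ·)` has a derivative `∂F/∂m (x, m) ∈ W^{1,2}(ℝ^d)` for all `(x, m)`, `F`
and its derivative are bounded by `L`, and both are `L`-Lipschitz in `(x, m)`. -/
def RegularFunctional {d : ℕ} (L : ℝ) (F : E d → L2 d → ℝ) : Prop :=
  ∃ DF : E d → L2 d → L2 d,
    (∀ (x : E d) (m n : L2 d),
      HasDerivAt (fun θ : ℝ => F x (m + θ • n)) (∫ ξ, DF x m ξ * n ξ) 0) ∧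
    (∀ (x : E d) (m : L2 d),
      ENNReal.ofReal |F x m| + enormW12 (DF x m) ≤ ENNReal.ofReal L) ∧
    (∀ (x x' : E d) (m m' : L2 d),
      |F x' m' - F x m| + ‖DF x' m' - DF x m‖ ≤ L * (‖x' - x‖ + ‖m' - m‖))

/-- The regularity assumption on the coefficients `(b, σ)` with constant `L`. -/
structure RegularCoefficients {d : ℕ} (L : ℝ) (b : E d → L2 d → E d)
    (σ : E d → L2 d → Matrix (Fin d) (Fin d) ℝ) : Prop where
  differentiable_b : ∀ m, Differentiable ℝ (fun x => b x m)
  differentiable_σ : ∀ m i j, Differentiable ℝ (fun x => σ x m i j)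
  differentiable_fderiv_σ : ∀ m i j, Differentiable ℝ (fderiv ℝ (fun x => σ x m i j))
  b_reg : ∀ i, RegularFunctional L (fun x m => b x m i)
  partial_b_reg : ∀ i j, RegularFunctional L (fun x m => partialDeriv j (fun z => b z m i) x)
  σ_reg : ∀ i j, RegularFunctional L (fun x m => σ x m i j)
  partial_σ_reg : ∀ i j k,
    RegularFunctional L (fun x m => partialDeriv k (fun z => σ z m i j) x)
  partial_partial_σ_reg : ∀ i j k l,
    RegularFunctional L
      (fun x m => partialDeriv k (partialDeriv l (fun z => σ z m i j)) x)

/-- The operator `∑ a_ij(x, ν) ∂_i ∂_j ψ + ∑ b_i(x, ν) ∂_i ψ` acting on test functions: the formal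
adjoint of `u ↦ ∑ ∂_i ∂_j [a_ij(·, ν) u] - ∑ ∂_i [b_i(·, ν) u]`. -/
def dualOp {d : ℕ} (b : E d → L2 d → E d) (σ : E d → L2 d → Matrix (Fin d) (Fin d) ℝ)
    (ν : L2 d) (ψ : E d → ℝ) (x : E d) : ℝ :=
  (∑ i, ∑ j, diffusion σ x ν i j * partialDeriv i (partialDeriv j ψ) x) +
    ∑ i, b x ν i * partialDeriv i ψ x

/-- `m` is a solution, in `L²([t,T]; W^{1,2}) ∩ L^∞([t,T]; L²)`, of the nonlinear Fokker-Planck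
equation `∂_s m = ∑ ∂_i ∂_j [a_ij(x, m(s)) m] - ∑ ∂_i [b_i(x, m(s)) m]` on `(t,T]` with
`m(t) = μ`. As usual `m` is the weakly continuous representative, so that the weak form holds at
every time `s ∈ [t,T]`. -/
structure IsFPSolution {d : ℕ} (b : E d → L2 d → E d)
    (σ : E d → L2 d → Matrix (Fin d) (Fin d) ℝ) (t T : ℝ) (μ : L2 d) (m : ℝ → L2 d) : Prop where
  memL2W12 : MemL2W12 t T m
  memLinfty : MemLp m ∞ (volume.restrict (Icc t T))
  initial : m t = μ
  weak : ∀ ψ : E d → ℝ, IsTest ψ → ∀ s ∈ Icc t T,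
    ∫ x, m s x * ψ x = (∫ x, μ x * ψ x) +
      ∫ r in t..s, ∫ x, m r x * dualOp b σ (m r) ψ x

/-- `u`, a function on `(t,T] × ℝ^d`, is a weak solution of the linear equation
`∂_s u = ∑ ∂_i ∂_j [a_ij(x, m(s)) u] - ∑ ∂_i [b_i(x, m(s)) u]` with initial value `u(t) = δ_y`;
here the curve `m` is given. -/
structure IsDiracSolution {d : ℕ} (b : E d → L2 d → E d)
    (σ : E d → L2 d → Matrix (Fin d) (Fin d) ℝ) (t T : ℝ) (m : ℝ → L2 d) (y : E d)
    (u : ℝ → E d → ℝ) : Prop where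
  locallyIntegrable : ∀ s ∈ Ioc t T, LocallyIntegrable (u s)
  integrableOn : ∀ K : Set (E d), IsCompact K →
    IntegrableOn (fun p : ℝ × E d => u p.1 p.2) (Ioc t T ×ˢ K)
  weak : ∀ ψ : E d → ℝ, IsTest ψ → ∀ s ∈ Ioc t T,
    ∫ x, u s x * ψ x = ψ y + ∫ r in t..s, ∫ x, u r x * dualOp b σ (m r) ψ x

/-- `f`, a function of `(s, x, y) ∈ (t,T] × ℝ^d × ℝ^d`, is a weak solution of the same linear
equation in `(s, x)` with `f(t, x, y) = δ(x - y)`. -/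
structure IsFundamentalSolution {d : ℕ} (b : E d → L2 d → E d)
    (σ : E d → L2 d → Matrix (Fin d) (Fin d) ℝ) (t T : ℝ) (m : ℝ → L2 d)
    (f : ℝ → E d → E d → ℝ) : Prop where
  integrableOn : ∀ K : Set (E d), IsCompact K →
    IntegrableOn (fun p : ℝ × E d × E d => f p.1 p.2.1 p.2.2) (Ioc t T ×ˢ K ×ˢ K)
  dirac : ∀ y : E d, IsDiracSolution b σ t T m y (fun s x => f s x y)

/-- `φ^{t,μ}(s, y) = ∫ f(s, x, y) φ(x) dx`; at `s = t`, where `f(t, x, y) = δ(x - y)`, this is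
`φ(y)`. -/
def pairing {d : ℕ} (t : ℝ) (f : ℝ → E d → E d → ℝ) (φ : L2 d) (s : ℝ) (y : E d) : ℝ :=
  if s = t then φ y else ∫ x, f s x y * φ x

open Classical in
/-- The curve `s ↦ φ^{t,μ}(s, ·)` in `L²(ℝ^d)` (used only where `φ^{t,μ}(s, ·)` is in `L²`). -/
def pairingL2 {d : ℕ} (t : ℝ) (f : ℝ → E d → E d → ℝ) (φ : L2 d) (s : ℝ) : L2 d :=
  if h : MemLp (pairing t f φ s) 2 (volume : Measure (E d)) then h.toLp else 0

/-- The assumption on the fundamental solutions `f t μ` of the linear equations with coefficients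
taken along the curves `m t μ`, with the constants `C₁`, `C₂` and `C₃ ‖μ‖_{W^{1,2}}` in its three
estimates. -/
structure FundamentalSolutionEstimates {d : ℕ} (b : E d → L2 d → E d)
    (σ : E d → L2 d → Matrix (Fin d) (Fin d) ℝ) (T C₁ C₂ : ℝ) (C₃ : ℝ → ℝ)
    (m : ℝ → L2 d → ℝ → L2 d) (f : ℝ → L2 d → ℝ → E d → E d → ℝ) : Prop where
  isFundamentalSolution : ∀ t ∈ Icc 0 T, ∀ μ, MemW12 μ →
    IsFundamentalSolution b σ t T (m t μ) (f t μ)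
  integrable : ∀ t ∈ Icc 0 T, ∀ μ, MemW12 μ → ∀ φ : L2 d, ∀ s ∈ Ioc t T,
    ∀ᵐ y : E d, Integrable (fun x => f t μ s x y * φ x)
  memLp : ∀ t ∈ Icc 0 T, ∀ μ, MemW12 μ → ∀ φ : L2 d, ∀ s ∈ Icc t T,
    MemLp (pairing t (f t μ) φ s) 2 volume
  memL2W12 : ∀ t ∈ Icc 0 T, ∀ μ, MemW12 μ → ∀ φ : L2 d,
    MemL2W12 t T (pairingL2 t (f t μ) φ)
  energy : ∀ t ∈ Icc 0 T, ∀ μ, MemW12 μ → ∀ φ : L2 d,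
    esupL2 t T (pairingL2 t (f t μ) φ) + enormL2W12 t T (pairingL2 t (f t μ) φ) ≤
      ENNReal.ofReal C₁ * ‖φ‖ₑ
  timeDeriv : ∀ t ∈ Icc 0 T, ∀ μ, MemW12 μ → ∀ φ : L2 d, MemW12 φ →
    ∃ v : ℝ → L2 d, IsTimeDeriv t T (pairingL2 t (f t μ) φ) v ∧
      eLpNorm v 2 (volume.restrict (Icc t T)) ≤ ENNReal.ofReal C₂ * enormW12 φ
  stability : ∀ t ∈ Icc 0 T, ∀ μ μ', MemW12 μ → MemW12 μ' → ∀ φ : L2 d, MemW12 φ →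
    esupL2 t T (fun s => pairingL2 t (f t μ') φ s - pairingL2 t (f t μ) φ s) ≤
      ENNReal.ofReal (C₃ (enormW12 μ).toReal) * enormW12 φ * ‖μ' - μ‖ₑ

end FokkerPlanck

end

open FokkerPlanck

/-! Along a given curve `m` the coefficients depend on time alone, so the Fourier transform turns
the linear equation into a scalar linear equation at each frequency. Its solution started from `φ`
at time `t` is `evol`, the Fourier multiplier `mult` = exp(-∫_t^s `sym`) with `sym` = 4π² Σ a_ij ξ_i
ξ_j + 2πi Σ b_i ξ_i. Ellipticity gives |`mult`| ≤ exp(-4π²γ(s-t)|ξ|²), and the quantitative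
estimates rest on this bound.

Energy: |`mult`| ≤ 1 bounds the supremum in time, and ∫ |ξ|² exp(-2c(s-t)|ξ|²) ds ≤ 1/(2c) bounds
the gradient (`lintegral_evolGrad_le`). Time derivative: the symbol grows like |ξ|²; one factor |ξ|
is paid by the W^{1,2} norm of `φ`, the other by the same time integral (`lintegral_evolDot_le`).
Dependence on the coefficients: for two curves the multipliers differ by at most exp(-c(s-t)|ξ|²)
times the difference of the integrated symbols. Again one factor |ξ| goes to `φ`, and the other is
absorbed by the Gaussian at the cost of (s-t)^{-1/2}. Hence the two evolutions of `φ` differ by at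
most C ‖φ‖_{W^{1,2}} (s-t)^{-1/2} ∫_t^s ‖m - m'‖ (`IsStateCoef.norm_evol_sub_le`).

For the nonlinear equation, this last bound makes the map sending a curve to the evolution of `μ`
along it a contraction of C([t,T]; L²) in an exponentially weighted norm (`contracting_picard`).
Conversely, a weak solution solves the linear equation with its own coefficients frozen. Bounded
solutions of that equation are unique (`eq_evol_of_weak`): on a ball of frequencies the operator is
bounded, so Grönwall applies. Thus every weak solution is a fixed point. A Grönwall inequality with
the kernel (s-t)^{-1/2} (`gronwall_sqrt`) gives uniqueness and Lipschitz dependence on `μ`, with a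
constant governed by the W^{1,2} norm of only one of the two initial states.

The fundamental solution is the inverse Fourier transform of `mult`. Diagonalizing the integrated
diffusion matrix shows that it is a Gaussian (`exists_fourierInv_mult_eq`), hence nonnegative and of
mass one. Pairing it with `φ` in the variable x conjugates the multiplier, that is, reverses the
drift (`integral_kern_mul_ae`). So the functions φ^{t,μ} are evolutions with coefficients (a, -b),
and the estimates above apply to them. -/

noncomputable section

namespace FokkerPlanck

/-! ### Fourier transform of real L² functions, test functions and symbols. -/

section

open FourierTransform Filter Topology
open scoped SchwartzMap LineDeriv

/-- The Hilbert space of complex square-integrable functions on `ℝ^d`. -/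
abbrev CL2 (d : ℕ) : Type := Lp ℂ 2 (volume : Measure (E d))

/-- Complexification of real square-integrable functions. -/
def cplx (d : ℕ) : L2 d →L[ℝ] CL2 d := Complex.ofRealCLM.compLpL 2 volume

/-- Real part of complex square-integrable functions. -/
def rePart (d : ℕ) : CL2 d →L[ℝ] L2 d := Complex.reCLM.compLpL 2 volume

variable {d : ℕ}

lemma coeFn_cplx (u : L2 d) : ⇑(cplx d u) =ᵐ[volume] fun x => (u x : ℂ) :=
  ContinuousLinearMap.coeFn_compLpL _ _

lemma coeFn_rePart (v : CL2 d) : ⇑(rePart d v) =ᵐ[volume] fun x => (v x).re :=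
  ContinuousLinearMap.coeFn_compLpL _ _

lemma norm_cplx (u : L2 d) : ‖cplx d u‖ = ‖u‖ := by
  rw [Lp.norm_def, Lp.norm_def]
  congr 1
  apply eLpNorm_congr_norm_ae
  filter_upwards [coeFn_cplx u] with x hx
  simp [hx]

lemma enorm_rePart_le (v : CL2 d) : ‖rePart d v‖ₑ ≤ ‖v‖ₑ := by
  rw [Lp.enorm_def, Lp.enorm_def]
  apply eLpNorm_mono_ae
  filter_upwards [coeFn_rePart v] with x hx
  rw [hx]
  exact Complex.abs_re_le_norm _

lemma rePart_cplx (u : L2 d) : rePart d (cplx d u) = u := by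
  apply Lp.ext
  filter_upwards [coeFn_rePart (cplx d u), coeFn_cplx u] with x h1 h2
  simp [h1, h2]

/-- The Fourier transform of a real square-integrable function. -/
def ft (u : L2 d) : CL2 d := Lp.fourierTransformₗᵢ (E d) ℂ (cplx d u)

/-- The real part of the inverse Fourier transform, as a continuous real-linear map. -/
def ift (d : ℕ) : CL2 d →L[ℝ] L2 d :=
  (rePart d).comp
    ((Lp.fourierTransformₗᵢ (E d) ℂ).symm.toContinuousLinearEquiv.toContinuousLinearMap.restrictScalars ℝ)

lemma ift_apply (v : CL2 d) : ift d v = rePart d (𝓕⁻ v) := rfl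

lemma ft_eq (u : L2 d) : ft u = 𝓕 (cplx d u) := rfl

lemma norm_ft (u : L2 d) : ‖ft u‖ = ‖u‖ := by
  rw [ft, LinearIsometryEquiv.norm_map, norm_cplx]

lemma ft_sub (u v : L2 d) : ft (u - v) = ft u - ft v := by
  simp [ft, map_sub]

lemma ift_ft (u : L2 d) : ift d (ft u) = u := by
  rw [ift_apply, ft_eq, FourierTransform.fourierInv_fourier_eq, rePart_cplx]

lemma enorm_ift_le (v : CL2 d) : ‖ift d v‖ₑ ≤ ‖v‖ₑ := by
  rw [ift_apply]
  refine (enorm_rePart_le _).trans_eq ?_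
  rw [← ofReal_norm, ← ofReal_norm]
  congr 1
  exact (Lp.fourierTransformₗᵢ (E d) ℂ).symm.norm_map v

/-- The L² transform agrees with the transform of tempered distributions, which is defined by moving
it to the Schwartz function. The pairing is bilinear, without conjugation. -/
lemma integral_mul_fourier (w : CL2 d) (Ψ : 𝓢(E d, ℂ)) :
    ∫ x, w x * (𝓕 Ψ) x = ∫ ξ, (𝓕 w : CL2 d) ξ * Ψ ξ := by
  have h := congrArg (fun D => D Ψ) (Lp.fourier_toTemperedDistribution_eq w)
  simp only [TemperedDistribution.fourier_apply, Lp.toTemperedDistribution_apply, smul_eq_mul] at h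
  simpa only [mul_comm] using h

lemma integral_ofReal_mul (u : L2 d) (ψ : E d → ℂ) :
    ∫ x, (u x : ℂ) * ψ x = ∫ x, cplx d u x * ψ x := by
  apply integral_congr_ae
  filter_upwards [coeFn_cplx u] with x hx
  rw [hx]

/-- The Schwartz function given by a real test function. -/
def testSchwartz (ψ : E d → ℝ) (h : IsTest ψ) : 𝓢(E d, ℂ) :=
  HasCompactSupport.toSchwartzMap (f := fun x => (ψ x : ℂ))
    (h.2.comp_left Complex.ofReal_zero) (Complex.ofRealCLM.contDiff.comp h.1)

@[simp] lemma testSchwartz_apply (ψ : E d → ℝ) (h : IsTest ψ) (x : E d) :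
    testSchwartz ψ h x = (ψ x : ℂ) := rfl

/-- The inverse Fourier transform of a real test function. -/
def chk (ψ : E d → ℝ) (h : IsTest ψ) : 𝓢(E d, ℂ) := 𝓕⁻ (testSchwartz ψ h)

lemma fourier_chk (ψ : E d → ℝ) (h : IsTest ψ) : 𝓕 (chk ψ h) = testSchwartz ψ h := by
  rw [chk, FourierTransform.fourier_fourierInv_eq]

lemma integral_mul_test (w : CL2 d) (ψ : E d → ℝ) (h : IsTest ψ) :
    ∫ x, w x * (ψ x : ℂ) = ∫ ξ, (𝓕 w : CL2 d) ξ * chk ψ h ξ := by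
  rw [← integral_mul_fourier, fourier_chk]
  rfl

lemma memLp_testSchwartz (ψ : E d → ℝ) (h : IsTest ψ) : MemLp ψ 2 (volume : Measure (E d)) :=
  h.1.continuous.memLp_of_hasCompactSupport h.2

lemma integrable_mul_of_memLp (w : CL2 d) {g : E d → ℂ} (hg : MemLp g 2 volume) :
    Integrable (fun x => w x * g x) := (Lp.memLp w).integrable_mul hg

lemma integrable_mul_of_memLp_real (w : L2 d) {g : E d → ℝ} (hg : MemLp g 2 volume) :
    Integrable (fun x => w x * g x) := (Lp.memLp w).integrable_mul hg

lemma integral_rePart_mul (w : CL2 d) {ψ : E d → ℝ} (h : MemLp ψ 2 (volume : Measure (E d))) :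
    ∫ x, rePart d w x * ψ x = (∫ x, w x * (ψ x : ℂ)).re := by
  have hi : Integrable (fun x => w x * (ψ x : ℂ)) := integrable_mul_of_memLp w h.ofReal
  have := integral_re hi
  simp only [RCLike.re_to_complex] at this
  rw [← this]
  apply integral_congr_ae
  filter_upwards [coeFn_rePart w] with x hx
  rw [hx]; simp

/-- Pairing of `ift v` with a real test function on the Fourier side. -/
lemma integral_ift_mul (v : CL2 d) (ψ : E d → ℝ) (h : IsTest ψ) :
    ∫ x, ift d v x * ψ x = (∫ ξ, v ξ * chk ψ h ξ).re := by
  rw [ift_apply, integral_rePart_mul _ (memLp_testSchwartz ψ h), integral_mul_test _ _ h,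
    FourierTransform.fourier_fourierInv_eq]

lemma IsTest.partialDeriv {ψ : E d → ℝ} (h : IsTest ψ) (i : Fin d) :
    IsTest (partialDeriv i ψ) := by
  refine ⟨?_, ?_⟩
  · have : ContDiff ℝ ∞ (fderiv ℝ ψ) := h.1.fderiv_right (by simp)
    exact this.clm_apply contDiff_const
  · exact (h.2.fderiv (𝕜 := ℝ)).comp_left (g := fun L : E d →L[ℝ] ℝ => L (EuclideanSpace.single i 1)) (by simp)

lemma IsTest.const_mul {ψ : E d → ℝ} (h : IsTest ψ) (c : ℝ) : IsTest (fun x => c * ψ x) :=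
  ⟨contDiff_const.mul h.1, h.2.mul_left (f := fun _ => c)⟩

lemma IsTest.sum {ι : Type*} (s : Finset ι) {ψ : ι → E d → ℝ} (h : ∀ i, IsTest (ψ i)) :
    IsTest (fun x => ∑ i ∈ s, ψ i x) := by
  refine ⟨ContDiff.sum fun i _ => (h i).1, ?_⟩
  classical
  induction s using Finset.induction_on with
  | empty => exact HasCompactSupport.zero
  | insert a s ha ih =>
    simp only [Finset.sum_insert ha]
    exact (h a).2.add ih

lemma IsTest.add {ψ φ : E d → ℝ} (h : IsTest ψ) (h' : IsTest φ) :
    IsTest (fun x => ψ x + φ x) := ⟨h.1.add h'.1, h.2.add h'.2⟩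

lemma partialDeriv_ofReal {ψ : E d → ℝ} (h : Differentiable ℝ ψ) (i : Fin d) (x : E d) :
    fderiv ℝ (fun x => (ψ x : ℂ)) x (EuclideanSpace.single i 1) = (partialDeriv i ψ x : ℂ) := by
  have := (Complex.ofRealCLM.hasFDerivAt (x := ψ x)).comp x (h x).hasFDerivAt
  rw [show (fun x => (ψ x : ℂ)) = Complex.ofRealCLM ∘ ψ from rfl, this.fderiv]
  rfl

lemma chk_partialDeriv {ψ : E d → ℝ} (h : IsTest ψ) (i : Fin d) (ξ : E d) :
    chk (partialDeriv i ψ) (h.partialDeriv i) ξ = -(2 * Real.pi * Complex.I * ξ i) * chk ψ h ξ := by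
  have e : testSchwartz (partialDeriv i ψ) (h.partialDeriv i)
      = ∂_{EuclideanSpace.single i (1 : ℝ)} (testSchwartz ψ h) := by
    ext x
    rw [SchwartzMap.lineDerivOp_apply_eq_fderiv, testSchwartz_apply]
    exact (partialDeriv_ofReal (h.1.differentiable (by simp)) i x).symm
  rw [chk, e, SchwartzMap.fourierInv_lineDerivOp_eq]
  have : (inner ℝ · (EuclideanSpace.single i (1 : ℝ)) : E d → ℝ).HasTemperateGrowth := by fun_prop
  rw [smul_apply, SchwartzMap.smulLeftCLM_apply_apply this]
  simp [chk, EuclideanSpace.inner_single_right]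
  ring

lemma chk_add {ψ φ : E d → ℝ} (h : IsTest ψ) (h' : IsTest φ) (ξ : E d) :
    chk _ (h.add h') ξ = chk ψ h ξ + chk φ h' ξ := by
  have : testSchwartz _ (h.add h') = testSchwartz ψ h + testSchwartz φ h' := by
    ext x; simp
  rw [chk, this, FourierTransform.fourierInv_add]; rfl

lemma chk_const_mul {ψ : E d → ℝ} (h : IsTest ψ) (c : ℝ) (ξ : E d) :
    chk _ (h.const_mul c) ξ = c * chk ψ h ξ := by
  have : testSchwartz _ (h.const_mul c) = (c : ℂ) • testSchwartz ψ h := by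
    ext x; simp
  rw [chk, this, FourierTransform.fourierInv_smul]; rfl

lemma chk_sum {ι : Type*} (s : Finset ι) {ψ : ι → E d → ℝ} (h : ∀ i, IsTest (ψ i)) (ξ : E d) :
    chk _ (IsTest.sum s h) ξ = ∑ i ∈ s, chk (ψ i) (h i) ξ := by
  have : testSchwartz _ (IsTest.sum s h) = ∑ i ∈ s, testSchwartz (ψ i) (h i) := by
    ext x; simp
  rw [chk, this, FourierTransform.fourierInv_sum, sum_apply]; rfl

/-- The symbol of `-∑ A_ij ∂_i ∂_j + ∑ B_i ∂_i`. -/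
def sym (A : Fin d → Fin d → ℝ) (B : Fin d → ℝ) (ξ : E d) : ℂ :=
  4 * Real.pi ^ 2 * ((∑ i, ∑ j, A i j * ξ i * ξ j : ℝ) : ℂ)
    + 2 * Real.pi * Complex.I * ((∑ i, B i * ξ i : ℝ) : ℂ)

/-- The constant coefficient operator `∑ A_ij ∂_i ∂_j + ∑ B_i ∂_i`. -/
def ellOp (A : Fin d → Fin d → ℝ) (B : Fin d → ℝ) (ψ : E d → ℝ) (x : E d) : ℝ :=
  (∑ i, ∑ j, A i j * partialDeriv i (partialDeriv j ψ) x) + ∑ i, B i * partialDeriv i ψ x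

lemma IsTest.ellOp {ψ : E d → ℝ} (h : IsTest ψ) (A : Fin d → Fin d → ℝ) (B : Fin d → ℝ) :
    IsTest (ellOp A B ψ) :=
  (IsTest.sum _ fun i => IsTest.sum _ fun j =>
    ((h.partialDeriv j).partialDeriv i).const_mul (A i j)).add
    (IsTest.sum _ fun i => (h.partialDeriv i).const_mul (B i))

/-- The dual operator acts on the test function. After transposing the Fourier transform onto the
test function it becomes multiplication by minus the symbol, which is how weak forms become scalar
equations in ξ. -/
lemma chk_ellOp {ψ : E d → ℝ} (h : IsTest ψ) (A : Fin d → Fin d → ℝ) (B : Fin d → ℝ) (ξ : E d) :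
    chk _ (h.ellOp A B) ξ = -sym A B ξ * chk ψ h ξ := by
  have e := chk_add
    (IsTest.sum Finset.univ fun i => IsTest.sum Finset.univ fun j =>
    ((h.partialDeriv j).partialDeriv i).const_mul (A i j))
    (IsTest.sum Finset.univ fun i => (h.partialDeriv i).const_mul (B i)) ξ
  rw [show chk _ (h.ellOp A B) ξ = _ from e]
  have e1 := fun i => chk_sum Finset.univ
    (fun j => ((h.partialDeriv j).partialDeriv i).const_mul (A i j)) ξ
  have e2 := chk_sum Finset.univ (fun i => IsTest.sum Finset.univ fun j =>
    ((h.partialDeriv j).partialDeriv i).const_mul (A i j)) ξ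
  have e3 := chk_sum Finset.univ (fun i => (h.partialDeriv i).const_mul (B i)) ξ
  rw [e2, e3]
  simp only [e1]
  have e4 : ∀ i j, chk _ (((h.partialDeriv j).partialDeriv i).const_mul (A i j)) ξ =
      A i j * (-(2 * Real.pi * Complex.I * ξ i) * (-(2 * Real.pi * Complex.I * ξ j) * chk ψ h ξ)) := by
    intro i j
    rw [chk_const_mul ((h.partialDeriv j).partialDeriv i), chk_partialDeriv (h.partialDeriv j),
      chk_partialDeriv h]
  have e5 : ∀ i, chk _ ((h.partialDeriv i).const_mul (B i)) ξ =
      B i * (-(2 * Real.pi * Complex.I * ξ i) * chk ψ h ξ) := by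
    intro i
    rw [chk_const_mul (h.partialDeriv i), chk_partialDeriv h]
  simp only [e4, e5, sym, neg_add, add_mul]
  push_cast
  simp only [Finset.mul_sum, Finset.sum_mul, ← Finset.sum_neg_distrib]
  congr 1
  · refine Finset.sum_congr rfl fun i _ => Finset.sum_congr rfl fun j _ => ?_
    linear_combination (4 * Real.pi ^ 2 * A i j * ξ i * ξ j * chk ψ h ξ) * Complex.I_sq
  · refine Finset.sum_congr rfl fun i _ => ?_
    ring

end

/-! ### From test functions to Schwartz functions; generalized derivatives on the Fourier side. -/

section

open FourierTransform Filter Topology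
open scoped SchwartzMap LineDeriv

variable {d : ℕ}

lemma partialDeriv_mul {f g : E d → ℝ} (hf : Differentiable ℝ f) (hg : Differentiable ℝ g)
    (i : Fin d) :
    partialDeriv i (fun x => f x * g x)
      = fun x => partialDeriv i f x * g x + f x * partialDeriv i g x := by
  ext x
  have := (hf x).hasFDerivAt.mul (hg x).hasFDerivAt
  simp only [partialDeriv]
  rw [show (fun x => f x * g x) = f * g from rfl, this.fderiv]
  simp; ring

lemma partialDeriv_add {f g : E d → ℝ} (hf : Differentiable ℝ f) (hg : Differentiable ℝ g)
    (i : Fin d) :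
    partialDeriv i (fun x => f x + g x) = fun x => partialDeriv i f x + partialDeriv i g x := by
  ext x
  simp only [partialDeriv]
  rw [fderiv_fun_add (hf x) (hg x)]
  rfl

lemma partialDeriv_comp_smul {f : E d → ℝ} (hf : Differentiable ℝ f) (c : ℝ) (i : Fin d) :
    partialDeriv i (fun x => f (c • x)) = fun x => c * partialDeriv i f (c • x) := by
  ext x
  have h1 : HasFDerivAt (fun x : E d => c • x) (c • ContinuousLinearMap.id ℝ (E d)) x :=
    (hasFDerivAt_id x).const_smul c
  have := (hf (c • x)).hasFDerivAt.comp x h1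
  simp only [partialDeriv]
  rw [show (fun x => f (c • x)) = f ∘ (fun x => c • x) from rfl, this.fderiv]
  simp

lemma partialDeriv_const_mul {f : E d → ℝ} (hf : Differentiable ℝ f) (c : ℝ) (i : Fin d) :
    partialDeriv i (fun x => c * f x) = fun x => c * partialDeriv i f x := by
  ext x
  simp only [partialDeriv]
  rw [fderiv_const_mul (hf x)]
  rfl

lemma partialDeriv_congr_nhds {f g : E d → ℝ} {x : E d} (h : f =ᶠ[𝓝 x] g) (i : Fin d) :
    partialDeriv i f =ᶠ[𝓝 x] partialDeriv i g := by
  filter_upwards [h.fderiv (𝕜 := ℝ)] with y hy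
  rw [partialDeriv, hy, partialDeriv]

lemma contDiff_partialDeriv {f : E d → ℝ} (hf : ContDiff ℝ ∞ f) (i : Fin d) :
    ContDiff ℝ ∞ (partialDeriv i f) :=
  (hf.fderiv_right (by simp)).clm_apply contDiff_const

lemma IsTest.bounded {ψ : E d → ℝ} (h : IsTest ψ) : ∃ C, ∀ x, |ψ x| ≤ C := by
  obtain ⟨C, hC⟩ := h.1.continuous.bounded_above_of_compact_support h.2
  exact ⟨C, hC⟩

lemma IsTest.differentiable {ψ : E d → ℝ} (h : IsTest ψ) : Differentiable ℝ ψ :=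
  h.1.differentiable (by simp)

/-- A test function equal to one near the origin. -/
lemma exists_isTest_eq_one : ∃ χ : E d → ℝ, IsTest χ ∧ ∀ x ∈ Metric.ball (0 : E d) 1, χ x = 1 := by
  let χ : ContDiffBump (0 : E d) := ⟨1, 2, by norm_num, by norm_num⟩
  exact ⟨χ, ⟨χ.contDiff, χ.hasCompactSupport⟩,
    fun x hx => χ.one_of_mem_closedBall (Metric.ball_subset_closedBall hx)⟩

lemma IsTest.comp_smul {ψ : E d → ℝ} (h : IsTest ψ) {c : ℝ} (hc : c ≠ 0) :
    IsTest (fun x => ψ (c • x)) :=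
  ⟨h.1.comp (contDiff_const_smul c),
    h.2.comp_homeomorph (Homeomorph.smulOfNeZero c hc)⟩

/-- A bound for a function with its derivatives up to order two. -/
def jetNorm (f : E d → ℝ) (x : E d) : ℝ :=
  |f x| + ∑ i, |partialDeriv i f x| + ∑ i, ∑ j, |partialDeriv i (partialDeriv j f) x|

lemma abs_le_jetNorm (f : E d → ℝ) (x : E d) : |f x| ≤ jetNorm f x := by
  have h1 : 0 ≤ ∑ i, |partialDeriv i f x| := Finset.sum_nonneg fun _ _ => abs_nonneg _
  have h2 : 0 ≤ ∑ i, ∑ j, |partialDeriv i (partialDeriv j f) x| :=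
    Finset.sum_nonneg fun _ _ => Finset.sum_nonneg fun _ _ => abs_nonneg _
  unfold jetNorm; linarith

lemma abs_partialDeriv_le_jetNorm (f : E d → ℝ) (i : Fin d) (x : E d) :
    |partialDeriv i f x| ≤ jetNorm f x := by
  have h1 : |partialDeriv i f x| ≤ ∑ i, |partialDeriv i f x| :=
    Finset.single_le_sum (f := fun i => |partialDeriv i f x|) (fun _ _ => abs_nonneg _)
      (Finset.mem_univ i)
  have h2 : 0 ≤ ∑ i, ∑ j, |partialDeriv i (partialDeriv j f) x| :=
    Finset.sum_nonneg fun _ _ => Finset.sum_nonneg fun _ _ => abs_nonneg _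
  have := abs_nonneg (f x)
  unfold jetNorm; linarith

lemma abs_partialDeriv₂_le_jetNorm (f : E d → ℝ) (i j : Fin d) (x : E d) :
    |partialDeriv i (partialDeriv j f) x| ≤ jetNorm f x := by
  have h1 : 0 ≤ ∑ i, |partialDeriv i f x| := Finset.sum_nonneg fun _ _ => abs_nonneg _
  have h2 : |partialDeriv i (partialDeriv j f) x| ≤
      ∑ j, |partialDeriv i (partialDeriv j f) x| :=
    Finset.single_le_sum (f := fun j => |partialDeriv i (partialDeriv j f) x|)
      (fun _ _ => abs_nonneg _) (Finset.mem_univ j)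
  have h3 : ∑ j, |partialDeriv i (partialDeriv j f) x| ≤
      ∑ i, ∑ j, |partialDeriv i (partialDeriv j f) x| :=
    Finset.single_le_sum (f := fun i => ∑ j, |partialDeriv i (partialDeriv j f) x|)
      (fun _ _ => Finset.sum_nonneg fun _ _ => abs_nonneg _) (Finset.mem_univ i)
  have := abs_nonneg (f x)
  unfold jetNorm; linarith

lemma IsTest.bounded_jetNorm {χ : E d → ℝ} (h : IsTest χ) : ∃ C, ∀ x, jetNorm χ x ≤ C := by
  choose C1 h1 using fun i => (h.partialDeriv i).bounded
  choose C2 h2 using fun i j => ((h.partialDeriv j).partialDeriv i).bounded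
  obtain ⟨C0, h0⟩ := h.bounded
  refine ⟨C0 + ∑ i, C1 i + ∑ i, ∑ j, C2 i j, fun x => ?_⟩
  exact add_le_add (add_le_add (h0 x) (Finset.sum_le_sum fun i _ => h1 i x))
    (Finset.sum_le_sum fun i _ => Finset.sum_le_sum fun j _ => h2 i j x)

/-- Leibniz rule; 4 is the number of terms in a second derivative of a product. -/
lemma jetNorm_mul_bounds {f g : E d → ℝ} (hf : ContDiff ℝ ∞ f) (hg : ContDiff ℝ ∞ g) (x : E d) :
    |f x * g x| ≤ 4 * (jetNorm f x * jetNorm g x) ∧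
    (∀ i, |partialDeriv i (fun x => f x * g x) x| ≤ 4 * (jetNorm f x * jetNorm g x)) ∧
    ∀ i j, |partialDeriv i (partialDeriv j (fun x => f x * g x)) x|
      ≤ 4 * (jetNorm f x * jetNorm g x) := by
  have df : Differentiable ℝ f := hf.differentiable (by simp)
  have dg : Differentiable ℝ g := hg.differentiable (by simp)
  have df' := fun i => (contDiff_partialDeriv hf i).differentiable (by simp)
  have dg' := fun i => (contDiff_partialDeriv hg i).differentiable (by simp)
  have hN : 0 ≤ jetNorm f x * jetNorm g x :=
    mul_nonneg ((abs_nonneg _).trans (abs_le_jetNorm f x)) ((abs_nonneg _).trans (abs_le_jetNorm g x))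
  have key : ∀ a b : ℝ, |a| ≤ jetNorm f x → |b| ≤ jetNorm g x →
      |a * b| ≤ jetNorm f x * jetNorm g x := fun a b ha hb => by
    rw [abs_mul]; exact mul_le_mul ha hb (abs_nonneg _) ((abs_nonneg _).trans ha)
  have kf := abs_le_jetNorm f x
  have kg := abs_le_jetNorm g x
  have kf1 := fun i => abs_partialDeriv_le_jetNorm f i x
  have kg1 := fun i => abs_partialDeriv_le_jetNorm g i x
  refine ⟨(key _ _ kf kg).trans (by linarith), fun i => ?_, fun i j => ?_⟩
  · rw [partialDeriv_mul df dg]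
    have h1 := key _ _ (kf1 i) kg
    have h2 := key _ _ kf (kg1 i)
    exact (abs_add_le _ _).trans (by linarith)
  · rw [partialDeriv_mul df dg, partialDeriv_add ((df' j).fun_mul dg) (df.fun_mul (dg' j)),
      partialDeriv_mul (df' j) dg, partialDeriv_mul df (dg' j)]
    have h1 := key _ _ (abs_partialDeriv₂_le_jetNorm f i j x) kg
    have h2 := key _ _ (kf1 j) (kg1 i)
    have h3 := key _ _ (kf1 i) (kg1 j)
    have h4 := key _ _ kf (abs_partialDeriv₂_le_jetNorm g i j x)
    refine (abs_add_le _ _).trans ((add_le_add (abs_add_le _ _) (abs_add_le _ _)).trans ?_)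
    linarith

/-- Each derivative of the dilated function brings out one factor `c`, and |c| ≤ 1. This keeps the
cutoffs bounded uniformly as the dilation spreads. -/
lemma jetNorm_comp_smul_le {χ : E d → ℝ} (h : IsTest χ) {c : ℝ} (hc : |c| ≤ 1) (x : E d) :
    jetNorm (fun x => χ (c • x)) x ≤ jetNorm χ (c • x) := by
  have d1 := fun j => (h.partialDeriv j).differentiable
  unfold jetNorm
  refine add_le_add (add_le_add le_rfl (Finset.sum_le_sum fun i _ => ?_))
    (Finset.sum_le_sum fun i _ => Finset.sum_le_sum fun j _ => ?_)
  · rw [partialDeriv_comp_smul h.differentiable, abs_mul]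
    exact mul_le_of_le_one_left (abs_nonneg _) hc
  · rw [partialDeriv_comp_smul h.differentiable,
      partialDeriv_const_mul (f := fun x => partialDeriv j χ (c • x))
        ((d1 j).comp (differentiable_id.const_smul c)),
      partialDeriv_comp_smul (d1 j), abs_mul, abs_mul, ← mul_assoc]
    exact mul_le_of_le_one_left (abs_nonneg _)
      (mul_le_one₀ hc (abs_nonneg _) hc)

lemma schwartz_partialDeriv (φ : 𝓢(E d, ℝ)) (i : Fin d) :
    partialDeriv i φ = ⇑(∂_{EuclideanSpace.single i (1 : ℝ)} φ : 𝓢(E d, ℝ)) := by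
  ext x
  rw [SchwartzMap.lineDerivOp_apply_eq_fderiv]; rfl

lemma memLp_jetNorm (φ : 𝓢(E d, ℝ)) : MemLp (jetNorm φ) 2 (volume : Measure (E d)) := by
  unfold jetNorm
  refine ((φ.memLp 2 volume).norm.add (memLp_finsetSum _ fun i _ => ?_)).add
    (memLp_finsetSum _ fun i _ => memLp_finsetSum _ fun j _ => ?_)
  · rw [schwartz_partialDeriv]
    exact (SchwartzMap.memLp _ 2 volume).abs
  · rw [schwartz_partialDeriv, schwartz_partialDeriv]
    exact (SchwartzMap.memLp _ 2 volume).abs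

/-- Schwartz functions are limits of test functions, with a square-integrable bound of the
derivatives of order at most two. -/
lemma exists_isTest_approx (φ : 𝓢(E d, ℝ)) :
    ∃ (ψ : ℕ → E d → ℝ) (G : E d → ℝ), MemLp G 2 (volume : Measure (E d)) ∧ (∀ n, IsTest (ψ n)) ∧
      (∀ n x, |ψ n x| ≤ G x ∧ (∀ i, |partialDeriv i (ψ n) x| ≤ G x) ∧
        ∀ i j, |partialDeriv i (partialDeriv j (ψ n)) x| ≤ G x) ∧
      ∀ x, ∀ᶠ n in atTop, ψ n x = φ x ∧ (∀ i, partialDeriv i (ψ n) x = partialDeriv i φ x) ∧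
        ∀ i j, partialDeriv i (partialDeriv j (ψ n)) x = partialDeriv i (partialDeriv j φ) x := by
  obtain ⟨χ, hχ, hχ1⟩ := exists_isTest_eq_one (d := d)
  obtain ⟨C, hC⟩ := hχ.bounded_jetNorm
  let c : ℕ → ℝ := fun n => 1 / ((n : ℝ) + 1)
  have c0 : ∀ n, 0 < c n := fun n => by positivity
  have c1 : ∀ n, |c n| ≤ 1 := fun n => by
    rw [abs_of_pos (c0 n)]
    exact (div_le_one (by positivity)).2 (by linarith [Nat.cast_nonneg (α := ℝ) n])
  have hφ : ContDiff ℝ ∞ φ := φ.smooth ⊤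
  refine ⟨fun n x => χ (c n • x) * φ x, fun x => 4 * (C * jetNorm φ x), ?_, fun n => ?_,
    fun n x => ?_, fun x => ?_⟩
  · exact ((memLp_jetNorm φ).const_mul C).const_mul 4
  · have := hχ.comp_smul (c0 n).ne'
    exact ⟨this.1.mul hφ, this.2.mul_right⟩
  · obtain ⟨h1, h2, h3⟩ := jetNorm_mul_bounds (hχ.comp_smul (c0 n).ne').1 hφ x
    have hle : 4 * (jetNorm (fun x => χ (c n • x)) x * jetNorm φ x) ≤ 4 * (C * jetNorm φ x) := by
      gcongr
      · exact (abs_nonneg _).trans (abs_le_jetNorm φ x)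
      · exact (jetNorm_comp_smul_le hχ (c1 n) x).trans (hC _)
    exact ⟨h1.trans hle, fun i => (h2 i).trans hle, fun i j => (h3 i j).trans hle⟩
  · have hlim : Tendsto (fun n => c n * ‖x‖) atTop (𝓝 0) := by
      simpa only [zero_mul] using (tendsto_one_div_add_atTop_nhds_zero_nat (𝕜 := ℝ)).mul_const ‖x‖
    filter_upwards [hlim.eventually (gt_mem_nhds one_pos)] with n hn
    -- Near a fixed point the cutoff is eventually identically one, so the derivatives agree exactly
    -- and no convergence of derivatives has to be proved.
    have hev : (fun x => χ (c n • x) * φ x) =ᶠ[𝓝 x] φ := by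
      have hopen : IsOpen {y : E d | ‖c n • y‖ < 1} :=
        isOpen_lt ((continuous_const_smul (c n)).norm) continuous_const
      have hx : x ∈ {y : E d | ‖c n • y‖ < 1} := by
        rw [mem_ofPred_eq, norm_smul, Real.norm_of_nonneg (c0 n).le]; exact hn
      filter_upwards [hopen.mem_nhds hx] with y hy
      rw [hχ1 _ (by simpa using hy), one_mul]
    exact ⟨hev.self_of_nhds, fun i => (partialDeriv_congr_nhds hev i).self_of_nhds,
      fun i j => (partialDeriv_congr_nhds (partialDeriv_congr_nhds hev j) i).self_of_nhds⟩

lemma tendsto_integral_mul_of_dominated (u : L2 d) {f : ℕ → E d → ℝ} {g G : E d → ℝ}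
    (hG : MemLp G 2 volume) (hf : ∀ n, Continuous (f n)) (hb : ∀ n x, |f n x| ≤ G x)
    (hl : ∀ x, ∀ᶠ n in atTop, f n x = g x) :
    Tendsto (fun n => ∫ x, u x * f n x) atTop (𝓝 (∫ x, u x * g x)) := by
  refine tendsto_integral_of_dominated_convergence (fun x => |u x| * G x) (fun n => ?_) ?_
    (fun n => .of_forall fun x => ?_) (.of_forall fun x => ?_)
  · exact (Lp.aestronglyMeasurable u).mul (hf n).aestronglyMeasurable
  · exact (Lp.memLp u).norm.integrable_mul hG
  · rw [norm_mul]; exact mul_le_mul_of_nonneg_left (hb n x) (norm_nonneg _)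
  · refine tendsto_const_nhds.congr' ?_
    filter_upwards [hl x] with n hn
    rw [hn]

/-- Dominated convergence along cutoffs. The larger class is needed because the Fourier transform of
a test function is a Schwartz function but in general not compactly supported. -/
lemma IsWeakPartial.schwartz {i : Fin d} {u v : L2 d} (h : IsWeakPartial i u v) (φ : 𝓢(E d, ℝ)) :
    ∫ x, u x * partialDeriv i φ x = - ∫ x, v x * φ x := by
  obtain ⟨ψ, G, hG, ht, hb, hl⟩ := exists_isTest_approx φ
  have l1 := tendsto_integral_mul_of_dominated u hG (fun n => ((ht n).partialDeriv i).1.continuous)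
    (fun n x => (hb n x).2.1 i) (fun x => (hl x).mono fun n hn => hn.2.1 i)
  have l2 := tendsto_integral_mul_of_dominated v hG (fun n => (ht n).1.continuous)
    (fun n x => (hb n x).1) (fun x => (hl x).mono fun n hn => hn.1)
  refine tendsto_nhds_unique l1 ?_
  refine l2.neg.congr fun n => ?_
  rw [h _ (ht n)]

/-- Real part of a Schwartz function. -/
def schwartzRe (Φ : 𝓢(E d, ℂ)) : 𝓢(E d, ℝ) := SchwartzMap.postcompCLM (𝕜 := ℝ) Complex.reCLM Φ

/-- Imaginary part of a Schwartz function. -/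
def schwartzIm (Φ : 𝓢(E d, ℂ)) : 𝓢(E d, ℝ) := SchwartzMap.postcompCLM (𝕜 := ℝ) Complex.imCLM Φ

@[simp] lemma schwartzRe_apply (Φ : 𝓢(E d, ℂ)) (x : E d) : schwartzRe Φ x = (Φ x).re := rfl
@[simp] lemma schwartzIm_apply (Φ : 𝓢(E d, ℂ)) (x : E d) : schwartzIm Φ x = (Φ x).im := rfl

lemma partialDeriv_schwartzRe (Φ : 𝓢(E d, ℂ)) (i : Fin d) :
    partialDeriv i (schwartzRe Φ) =
      ⇑(schwartzRe (∂_{EuclideanSpace.single i (1 : ℝ)} Φ : 𝓢(E d, ℂ))) := by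
  ext x
  rw [schwartzRe_apply, SchwartzMap.lineDerivOp_apply_eq_fderiv]
  have := (Complex.reCLM.hasFDerivAt (x := Φ x)).comp x (Φ.hasFDerivAt x)
  rw [partialDeriv, show ⇑(schwartzRe Φ) = Complex.reCLM ∘ Φ from rfl, this.fderiv]
  rfl

lemma partialDeriv_schwartzIm (Φ : 𝓢(E d, ℂ)) (i : Fin d) :
    partialDeriv i (schwartzIm Φ) =
      ⇑(schwartzIm (∂_{EuclideanSpace.single i (1 : ℝ)} Φ : 𝓢(E d, ℂ))) := by
  ext x
  rw [schwartzIm_apply, SchwartzMap.lineDerivOp_apply_eq_fderiv]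
  have := (Complex.imCLM.hasFDerivAt (x := Φ x)).comp x (Φ.hasFDerivAt x)
  rw [partialDeriv, show ⇑(schwartzIm Φ) = Complex.imCLM ∘ Φ from rfl, this.fderiv]
  rfl

lemma integral_cplx_mul (u : L2 d) (Φ : 𝓢(E d, ℂ)) :
    ∫ x, cplx d u x * Φ x = ((∫ x, u x * schwartzRe Φ x : ℝ) : ℂ)
      + Complex.I * ((∫ x, u x * schwartzIm Φ x : ℝ) : ℂ) := by
  rw [← integral_ofReal_mul, ← integral_complex_ofReal, ← integral_complex_ofReal,
    ← integral_const_mul, ← integral_add]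
  · refine integral_congr_ae (.of_forall fun x => ?_)
    apply Complex.ext <;> simp
  · exact (integrable_mul_of_memLp_real u ((schwartzRe Φ).memLp 2 _)).ofReal
  · exact (integrable_mul_of_memLp_real u ((schwartzIm Φ).memLp 2 _)).ofReal.const_mul _

lemma integral_ft_mul (u : L2 d) (Ψ : 𝓢(E d, ℂ)) :
    ∫ ξ, ft u ξ * Ψ ξ = ∫ x, cplx d u x * (𝓕 Ψ) x := by
  rw [integral_mul_fourier]; rfl

/-- Multiplication of a Schwartz function by `2πi ξ_i`. -/
def mulCoord (i : Fin d) (Ψ : 𝓢(E d, ℂ)) : 𝓢(E d, ℂ) :=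
  (2 * Real.pi * Complex.I) • SchwartzMap.smulLeftCLM ℂ
    (fun ξ : E d => inner ℝ ξ (EuclideanSpace.single i (1 : ℝ))) Ψ

lemma mulCoord_apply (i : Fin d) (Ψ : 𝓢(E d, ℂ)) (ξ : E d) :
    mulCoord i Ψ ξ = 2 * Real.pi * Complex.I * ξ i * Ψ ξ := by
  have : (inner ℝ · (EuclideanSpace.single i (1 : ℝ)) : E d → ℝ).HasTemperateGrowth := by fun_prop
  rw [mulCoord, smul_apply, SchwartzMap.smulLeftCLM_apply_apply this]
  simp [EuclideanSpace.inner_single_right]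
  ring

lemma lineDeriv_fourier (i : Fin d) (Ψ : 𝓢(E d, ℂ)) :
    (∂_{EuclideanSpace.single i (1 : ℝ)} (𝓕 Ψ) : 𝓢(E d, ℂ)) = -𝓕 (mulCoord i Ψ) := by
  rw [SchwartzMap.lineDerivOp_fourier_eq, mulCoord, neg_smul, FourierTransform.fourier_neg]

lemma locallyIntegrable_CL2 (w : CL2 d) : LocallyIntegrable w volume :=
  (Lp.memLp w).locallyIntegrable (by norm_num)

/-- On the Fourier side a generalized derivative is multiplication by `2πi ξ_i`. -/
lemma IsWeakPartial.ft_eq {i : Fin d} {u v : L2 d} (h : IsWeakPartial i u v) :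
    ∀ᵐ ξ, ft v ξ = 2 * Real.pi * Complex.I * ξ i * ft u ξ := by
  -- The weak derivative is tested against real functions, so it is applied to the real and the
  -- imaginary part of the transform separately.
  have key : ∀ Ψ : 𝓢(E d, ℂ), ∫ ξ, ft v ξ * Ψ ξ = ∫ ξ, ft u ξ * mulCoord i Ψ ξ := by
    intro Ψ
    have h1 := h.schwartz (schwartzRe (𝓕 Ψ))
    have h2 := h.schwartz (schwartzIm (𝓕 Ψ))
    rw [partialDeriv_schwartzRe, lineDeriv_fourier] at h1
    rw [partialDeriv_schwartzIm, lineDeriv_fourier] at h2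
    have e1 : ∀ x, schwartzRe (-𝓕 (mulCoord i Ψ)) x = -schwartzRe (𝓕 (mulCoord i Ψ)) x :=
      fun x => by simp
    have e2 : ∀ x, schwartzIm (-𝓕 (mulCoord i Ψ)) x = -schwartzIm (𝓕 (mulCoord i Ψ)) x :=
      fun x => by simp
    simp only [e1, mul_neg, integral_neg, neg_inj] at h1
    simp only [e2, mul_neg, integral_neg, neg_inj] at h2
    rw [integral_ft_mul, integral_ft_mul, integral_cplx_mul, integral_cplx_mul, h1, h2]
  -- The product of `ft u` with a coordinate is so far only known to be locally integrable, so the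
  -- two sides are compared through compactly supported smooth functions.
  refine ae_eq_of_integral_contDiff_smul_eq (locallyIntegrable_CL2 _) ?_ fun g hg hc => ?_
  · have hc : Continuous fun ξ : E d => 2 * (Real.pi : ℂ) * Complex.I * (ξ i : ℂ) := by fun_prop
    have := (locallyIntegrable_CL2 (ft u))
    rw [← locallyIntegrableOn_univ] at this ⊢
    exact this.continuousOn_mul hc.continuousOn isOpen_univ.isLocallyClosed
  · have := key (testSchwartz g ⟨hg, hc⟩)
    simp only [mulCoord_apply] at this
    calc ∫ x, g x • ft v x = ∫ x, ft v x * (g x : ℂ) := by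
          simp only [Complex.real_smul, mul_comm]
      _ = _ := this
      _ = _ := by
          refine integral_congr_ae (.of_forall fun x => ?_)
          simp only [Complex.real_smul]
          rw [show testSchwartz g ⟨hg, hc⟩ x = (g x : ℂ) from rfl]; ring

end

/-! ### Multiplication operators on L² and exponentials of integrals. -/

section

open Filter Topology

variable {d : ℕ}

lemma enorm_sq_Lp {F : Type*} [NormedAddCommGroup F] {X : Type*} [MeasurableSpace X]
    {μ : Measure X} (f : Lp F 2 μ) :
    ‖f‖ₑ ^ 2 = ∫⁻ x, ‖f x‖ₑ ^ 2 ∂μ := by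
  rw [Lp.enorm_def]
  have := eLpNorm_nnreal_pow_eq_lintegral (μ := μ) (f := f) (p := 2) two_ne_zero
  simpa using this

lemma eLpNorm_sq {F : Type*} [NormedAddCommGroup F] {X : Type*} [MeasurableSpace X]
    {μ : Measure X} (f : X → F) : eLpNorm f 2 μ ^ 2 = ∫⁻ x, ‖f x‖ₑ ^ 2 ∂μ := by
  have := eLpNorm_nnreal_pow_eq_lintegral (μ := μ) (f := f) (p := 2) two_ne_zero
  simpa using this

open Classical in
/-- Multiplication of a square-integrable function by a function (zero if the product is not
square-integrable). -/
def symb (g : E d → ℂ) (f : CL2 d) : CL2 d :=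
  if h : MemLp (fun ξ => g ξ * f ξ) 2 (volume : Measure (E d)) then h.toLp else 0

lemma coeFn_symb {g : E d → ℂ} {f : CL2 d}
    (h : MemLp (fun ξ => g ξ * f ξ) 2 (volume : Measure (E d))) :
    symb g f =ᵐ[volume] fun ξ => g ξ * f ξ := by
  rw [symb, dif_pos h]; exact h.coeFn_toLp

lemma enorm_symb_sq_le (g : E d → ℂ) (f : CL2 d) :
    ‖symb g f‖ₑ ^ 2 ≤ ∫⁻ ξ, ‖g ξ‖ₑ ^ 2 * ‖f ξ‖ₑ ^ 2 := by
  by_cases h : MemLp (fun ξ => g ξ * f ξ) 2 (volume : Measure (E d))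
  · rw [enorm_sq_Lp]
    refine (lintegral_congr_ae ?_).le
    filter_upwards [coeFn_symb h] with ξ hξ
    rw [hξ, enorm_mul, mul_pow]
  -- The default value 0 makes the bound hold without any integrability assumption.
  · rw [symb, dif_neg h]; simp

lemma memLp_mul_of_bound {g : E d → ℂ} (hg : Continuous g) (f : CL2 d) {G : E d → ℝ}
    (hG : MemLp G 2 (volume : Measure (E d))) (hb : ∀ᵐ ξ, ‖g ξ * f ξ‖ ≤ G ξ) :
    MemLp (fun ξ => g ξ * f ξ) 2 (volume : Measure (E d)) :=
  hG.of_le (hg.aestronglyMeasurable.mul (Lp.aestronglyMeasurable f))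
    (hb.mono fun _ h => h.trans (le_abs_self _))

lemma memLp_mul_of_bounded {g : E d → ℂ} (hg : Continuous g) (f : CL2 d) {C : ℝ}
    (hb : ∀ ξ, ‖g ξ‖ ≤ C) : MemLp (fun ξ => g ξ * f ξ) 2 (volume : Measure (E d)) :=
  memLp_mul_of_bound hg f ((Lp.memLp f).norm.const_mul C) (.of_forall fun ξ => by
    rw [norm_mul]; exact mul_le_mul_of_nonneg_right (hb ξ) (norm_nonneg _))

lemma enorm_symb_le {g : E d → ℂ} {f : CL2 d} {h : CL2 d} (hb : ∀ᵐ ξ, ‖g ξ * f ξ‖ ≤ ‖h ξ‖) :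
    ‖symb g f‖ₑ ≤ ‖h‖ₑ := by
  by_cases hm : MemLp (fun ξ => g ξ * f ξ) 2 (volume : Measure (E d))
  · rw [Lp.enorm_def, Lp.enorm_def]
    apply eLpNorm_mono_ae
    filter_upwards [coeFn_symb hm, hb] with ξ h1 h2
    rwa [h1]
  · rw [symb, dif_neg hm]; simp

lemma symb_one (f : CL2 d) : symb (fun _ => 1) f = f := by
  apply Lp.ext
  have : MemLp (fun ξ => (1 : ℂ) * f ξ) 2 (volume : Measure (E d)) := by
    simpa using Lp.memLp f
  filter_upwards [coeFn_symb this] with ξ hξ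
  rw [hξ, one_mul]

/-- Strong continuity of multiplication operators under domination. -/
lemma continuousOn_symb {S : Set ℝ} {g : ℝ → E d → ℂ} (f : CL2 d)
    (hg : ∀ s ∈ S, Continuous (g s)) (hc : ∀ ξ, ContinuousOn (fun s => g s ξ) S)
    (hb : ∀ s₀ ∈ S, ∃ G : E d → ℝ, MemLp G 2 (volume : Measure (E d)) ∧
      ∀ᶠ s in 𝓝[S] s₀, ∀ᵐ ξ, ‖g s ξ * f ξ‖ ≤ G ξ) :
    ContinuousOn (fun s => symb (g s) f) S := by
  intro s₀ hs₀
  obtain ⟨G, hG, hb⟩ := hb s₀ hs₀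
  have hb₀ : ∀ᵐ ξ, ‖g s₀ ξ * f ξ‖ ≤ G ξ := hb.self_of_nhdsWithin hs₀
  have hm₀ := memLp_mul_of_bound (hg s₀ hs₀) f hG hb₀
  rw [ContinuousWithinAt, Lp.tendsto_Lp_iff_tendsto_eLpNorm']
  have hsq : Tendsto (fun s => eLpNorm (⇑(symb (g s) f) - ⇑(symb (g s₀) f)) 2 volume ^ 2)
      (𝓝[S] s₀) (𝓝 0) := by
    have h1 : Tendsto (fun s => ∫⁻ ξ, ‖g s ξ * f ξ - g s₀ ξ * f ξ‖ₑ ^ 2) (𝓝[S] s₀)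
        (𝓝 (∫⁻ _ : E d, 0)) := by
      refine tendsto_lintegral_filter_of_dominated_convergence' (fun ξ => ‖2 * G ξ‖ₑ ^ 2) ?_ ?_ ?_ ?_
      · filter_upwards [self_mem_nhdsWithin] with s hs
        exact ((((hg s hs).aestronglyMeasurable.mul (Lp.aestronglyMeasurable f)).sub
          ((hg s₀ hs₀).aestronglyMeasurable.mul (Lp.aestronglyMeasurable f))).enorm).pow_const 2
      · filter_upwards [hb] with s hs
        filter_upwards [hs, hb₀] with ξ h1 h2
        gcongr
        rw [enorm_le_iff_norm_le]
        refine (norm_sub_le _ _).trans (le_trans ?_ (le_abs_self _))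
        linarith
      · rw [← eLpNorm_sq]
        exact (ENNReal.pow_lt_top (hG.const_mul 2).2).ne
      · refine .of_forall fun ξ => ?_
        have h2 : Tendsto (fun s => g s ξ * f ξ - g s₀ ξ * f ξ) (𝓝[S] s₀) (𝓝 0) := by
          simpa using (((hc ξ) s₀ hs₀).mul_const (f ξ)).sub_const (g s₀ ξ * f ξ)
        have h3 := ENNReal.Tendsto.pow (n := 2) h2.enorm
        simpa using h3
    rw [lintegral_zero] at h1
    refine h1.congr' ?_
    filter_upwards [hb, self_mem_nhdsWithin] with s hs hsS
    rw [eLpNorm_sq]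
    apply lintegral_congr_ae
    filter_upwards [coeFn_symb hm₀, coeFn_symb (memLp_mul_of_bound (hg s hsS) f hG hs)] with ξ h1 h2
    rw [Pi.sub_apply, h1, h2]
  have := hsq.ennrpow_const (1 / 2)
  simp only [← ENNReal.rpow_natCast, ← ENNReal.rpow_mul] at this
  simpa using this

/-- Mean value inequality on the convex half-plane Re z ≥ c, where the derivative of exp(-z) has
norm at most e^{-c}. Keeping the factor e^{-c} preserves the Gaussian decay when two multipliers are
compared. -/
lemma norm_exp_neg_sub_le {z w : ℂ} {c : ℝ} (hz : c ≤ z.re) (hw : c ≤ w.re) :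
    ‖Complex.exp (-z) - Complex.exp (-w)‖ ≤ Real.exp (-c) * ‖z - w‖ := by
  have hconv : Convex ℝ {z : ℂ | c ≤ z.re} := convex_halfSpace_re_ge c
  refine hconv.norm_image_sub_le_of_norm_hasDerivWithin_le
    (f := fun z => Complex.exp (-z)) (f' := fun z => -Complex.exp (-z)) (fun x _ => ?_)
    (fun x hx => ?_) hw hz
  · have := (Complex.hasDerivAt_exp (-x)).comp x (hasDerivAt_neg x)
    simpa [Function.comp_def] using this.hasDerivWithinAt
  · rw [norm_neg, Complex.norm_exp]
    have hx : c ≤ x.re := hx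
    simpa using hx

lemma intervalIntegrable_of_bounded {F : Type*} [NormedAddCommGroup F] {q : ℝ → F}
    (hq : AEStronglyMeasurable q volume) {C : ℝ} (hb : ∀ s, ‖q s‖ ≤ C) (a b : ℝ) :
    IntervalIntegrable q volume a b := by
  refine (intervalIntegrable_const (c := C)).mono_fun hq.restrict (.of_forall fun s => ?_)
  exact (hb s).trans (le_abs_self _)

lemma norm_integral_sub_le {F : Type*} [NormedAddCommGroup F] [NormedSpace ℝ F] {q : ℝ → F}
    (hq : AEStronglyMeasurable q volume) {C : ℝ} (hb : ∀ s, ‖q s‖ ≤ C) (t r s : ℝ) :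
    ‖(∫ x in t..r, q x) - ∫ x in t..s, q x‖ ≤ C * |r - s| := by
  have h := intervalIntegrable_of_bounded hq hb
  rw [intervalIntegral.integral_interval_sub_left (h _ _) (h _ _)]
  exact intervalIntegral.norm_integral_le_of_norm_le_const fun x _ => hb x

lemma continuous_integral_of_bounded {F : Type*} [NormedAddCommGroup F] [NormedSpace ℝ F]
    {q : ℝ → F} (hq : AEStronglyMeasurable q volume) {C : ℝ} (hb : ∀ s, ‖q s‖ ≤ C) (t : ℝ) :
    Continuous fun s => ∫ x in t..s, q x :=
  intervalIntegral.continuous_primitive (intervalIntegrable_of_bounded hq hb) t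

/-- The exponential of an integral solves its linear equation in integrated form. -/
lemma exp_neg_integral_eq {q : ℝ → ℂ} (hq : AEStronglyMeasurable q volume) {C : ℝ}
    (hb : ∀ s, ‖q s‖ ≤ C) (hre : ∀ s, 0 ≤ (q s).re) {t s : ℝ} (hts : t ≤ s) :
    Complex.exp (-∫ r in t..s, q r)
      = 1 - ∫ r in t..s, q r * Complex.exp (-∫ x in t..r, q x) := by
  have hC : 0 ≤ C := (norm_nonneg _).trans (hb t)
  have hint := intervalIntegrable_of_bounded hq hb
  set Q : ℝ → ℂ := fun s => ∫ r in t..s, q r with hQ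
  have hQc : Continuous Q := continuous_integral_of_bounded hq hb t
  have hQre : ∀ r ∈ Icc t s, 0 ≤ (Q r).re := by
    intro r hr
    have := (Complex.reCLM.intervalIntegral_comp_comm (hint t r))
    simp only [Complex.reCLM_apply] at this
    rw [hQ]; simp only; rw [← this]
    exact intervalIntegral.integral_nonneg hr.1 fun u _ => hre u
  have hv : AEStronglyMeasurable (fun r => q r * Complex.exp (-Q r)) volume :=
    hq.mul (Complex.continuous_exp.comp hQc.neg).aestronglyMeasurable
  have hvint : ∀ a b, IntervalIntegrable (fun r => q r * Complex.exp (-Q r)) volume a b :=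
    fun a b => (hint a b).mul_continuousOn (Complex.continuous_exp.comp hQc.neg).continuousOn
  -- `q` is only measurable, so `Q` is differentiable only almost everywhere. Both summands are
  -- Lipschitz on [t,s], so their sum is absolutely continuous with zero derivative almost
  -- everywhere, hence constant.
  let F : ℝ → ℂ := fun r => Complex.exp (-Q r) + ∫ x in t..r, q x * Complex.exp (-Q x)
  have hAC1 : AbsolutelyContinuousOnInterval (fun r => Complex.exp (-Q r)) t s := by
    refine LipschitzOnWith.absolutelyContinuousOnInterval (K := C.toNNReal) ?_
    refine LipschitzOnWith.of_dist_le_mul fun x hx y hy => ?_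
    rw [uIcc_of_le hts] at hx hy
    rw [dist_eq_norm, Real.coe_toNNReal _ hC]
    refine (norm_exp_neg_sub_le (hQre x hx) (hQre y hy)).trans ?_
    rw [neg_zero, Real.exp_zero, one_mul]
    exact norm_integral_sub_le hq hb t x y
  have hAC2 : AbsolutelyContinuousOnInterval (fun r => ∫ x in t..r, q x * Complex.exp (-Q x)) t s := by
    refine LipschitzOnWith.absolutelyContinuousOnInterval (K := C.toNNReal) ?_
    refine LipschitzOnWith.of_dist_le_mul fun x hx y hy => ?_
    rw [uIcc_of_le hts] at hx hy
    rw [dist_eq_norm, Real.coe_toNNReal _ hC,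
      intervalIntegral.integral_interval_sub_left (hvint _ _) (hvint _ _), Real.dist_eq]
    refine intervalIntegral.norm_integral_le_of_norm_le_const fun r hr => ?_
    have hr' : r ∈ Icc t s := ⟨(le_min hy.1 hx.1).trans hr.1.le, hr.2.trans (max_le hy.2 hx.2)⟩
    rw [norm_mul, Complex.norm_exp]
    refine (mul_le_of_le_one_right (norm_nonneg _) (Real.exp_le_one_iff.2 ?_)).trans (hb r)
    simpa using hQre r hr'
  have hF := (hAC1.add hAC2).const_of_ae_hasDerivAt_zero (by
    filter_upwards [(hint t s).ae_hasDerivAt_integral, (hvint t s).ae_hasDerivAt_integral]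
      with r h1 h2 hr
    have h1 := h1 hr t left_mem_uIcc
    have h2 := h2 hr t left_mem_uIcc
    have h3 := (Complex.hasDerivAt_exp (-Q r)).comp r h1.neg
    have h4 := h3.add h2
    have : Complex.exp (-Q r) * -q r + q r * Complex.exp (-Q r) = 0 := by ring
    rw [this] at h4
    exact h4)
  obtain ⟨c, hc⟩ := hF
  have e1 := hc s right_mem_uIcc
  have e2 := hc t left_mem_uIcc
  simp only [Pi.add_apply, hQ, intervalIntegral.integral_same, neg_zero, Complex.exp_zero,
    add_zero] at e1 e2
  rw [eq_sub_iff_add_eq, e2]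
  exact e1

end

/-! ### Time-dependent coefficients, their symbols and multipliers. -/

section

open Filter Topology

variable {d : ℕ}

/-- The coefficient of the bound of the symbol. -/
def symBound (ξ : E d) : ℝ := 4 * Real.pi ^ 2 * d ^ 2 * ‖ξ‖ ^ 2 + 2 * Real.pi * d * ‖ξ‖

lemma abs_coord_le (ξ : E d) (i : Fin d) : |ξ i| ≤ ‖ξ‖ := PiLp.norm_apply_le ξ i

lemma abs_quad_le {A : Fin d → Fin d → ℝ} {M : ℝ} (hA : ∀ i j, |A i j| ≤ M) (ξ : E d) :
    |∑ i, ∑ j, A i j * ξ i * ξ j| ≤ M * (d ^ 2 * ‖ξ‖ ^ 2) := by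
  calc |∑ i, ∑ j, A i j * ξ i * ξ j| ≤ ∑ i : Fin d, ∑ j : Fin d, M * ‖ξ‖ * ‖ξ‖ := by
        refine (Finset.abs_sum_le_sum_abs _ _).trans (Finset.sum_le_sum fun i _ => ?_)
        refine (Finset.abs_sum_le_sum_abs _ _).trans (Finset.sum_le_sum fun j _ => ?_)
        have hM : 0 ≤ M := (abs_nonneg _).trans (hA i j)
        rw [abs_mul, abs_mul]
        gcongr
        exacts [hA i j, abs_coord_le ξ i, abs_coord_le ξ j]
    _ = _ := by simp; ring

lemma abs_lin_le {B : Fin d → ℝ} {M : ℝ} (hB : ∀ i, |B i| ≤ M) (ξ : E d) :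
    |∑ i, B i * ξ i| ≤ M * (d * ‖ξ‖) := by
  calc |∑ i, B i * ξ i| ≤ ∑ i : Fin d, M * ‖ξ‖ := by
        refine (Finset.abs_sum_le_sum_abs _ _).trans (Finset.sum_le_sum fun i _ => ?_)
        have hM : 0 ≤ M := (abs_nonneg _).trans (hB i)
        rw [abs_mul]
        gcongr
        exacts [hB i, abs_coord_le ξ i]
    _ = _ := by simp; ring

lemma norm_sym_le {A : Fin d → Fin d → ℝ} {B : Fin d → ℝ} {M : ℝ} (hA : ∀ i j, |A i j| ≤ M)
    (hB : ∀ i, |B i| ≤ M) (ξ : E d) : ‖sym A B ξ‖ ≤ M * symBound ξ := by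
  unfold sym symBound
  refine (norm_add_le _ _).trans ?_
  have h1 := abs_quad_le hA ξ
  have h2 := abs_lin_le hB ξ
  simp only [norm_mul, norm_pow, Complex.norm_real, Complex.norm_I, Complex.norm_ofNat,
    Real.norm_eq_abs, abs_of_pos Real.pi_pos]
  calc _ ≤ 4 * Real.pi ^ 2 * (M * (d ^ 2 * ‖ξ‖ ^ 2)) + 2 * Real.pi * 1 * (M * (d * ‖ξ‖)) := by
        gcongr
    _ = _ := by ring

lemma sym_re (A : Fin d → Fin d → ℝ) (B : Fin d → ℝ) (ξ : E d) :
    (sym A B ξ).re = 4 * Real.pi ^ 2 * ∑ i, ∑ j, A i j * ξ i * ξ j := by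
  have e : sym A B ξ = ((4 * Real.pi ^ 2 * ∑ i, ∑ j, A i j * ξ i * ξ j : ℝ) : ℂ) +
      ((2 * Real.pi * ∑ i, B i * ξ i : ℝ) : ℂ) * Complex.I := by
    unfold sym; push_cast; ring
  rw [e]
  simp only [Complex.add_re, Complex.ofReal_re, Complex.re_ofReal_mul, Complex.I_re, mul_zero,
    add_zero]

lemma sym_sub (A A' : Fin d → Fin d → ℝ) (B B' : Fin d → ℝ) (ξ : E d) :
    sym A B ξ - sym A' B' ξ = sym (fun i j => A i j - A' i j) (fun i => B i - B' i) ξ := by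
  unfold sym
  simp only [sub_mul, Finset.sum_sub_distrib]
  push_cast; ring

/-- Conjugation reverses the first order part only. This is why the adjoint evolution is the
evolution with drift -β. -/
lemma conj_sym (A : Fin d → Fin d → ℝ) (B : Fin d → ℝ) (ξ : E d) :
    (starRingEnd ℂ) (sym A B ξ) = sym A (fun i => -B i) ξ := by
  unfold sym
  simp only [map_add, map_mul, map_pow, Complex.conj_ofReal, Complex.conj_I, map_ofNat, neg_mul,
    Finset.sum_neg_distrib]
  push_cast; ring

lemma continuous_sym : Continuous fun p : ((Fin d → Fin d → ℝ) × (Fin d → ℝ)) × E d =>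
    sym p.1.1 p.1.2 p.2 := by
  unfold sym; fun_prop

lemma continuous_sym_comp {X : Type*} [TopologicalSpace X] {A : X → Fin d → Fin d → ℝ}
    {B : X → Fin d → ℝ} {f : X → E d} (hA : Continuous A) (hB : Continuous B) (hf : Continuous f) :
    Continuous fun x => sym (A x) (B x) (f x) := by
  have aux : ∀ S : ((Fin d → Fin d → ℝ) × (Fin d → ℝ)) × E d → ℂ, Continuous S →
      Continuous fun x => S ((A x, B x), f x) :=
    fun S hS => hS.comp ((hA.prodMk hB).prodMk hf)
  exact aux _ continuous_sym

lemma aestronglyMeasurable_sym_comp {X : Type*} [MeasurableSpace X] {μ : Measure X}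
    {A : X → Fin d → Fin d → ℝ} {B : X → Fin d → ℝ} {f : X → E d}
    (hA : AEStronglyMeasurable A μ) (hB : AEStronglyMeasurable B μ)
    (hf : AEStronglyMeasurable f μ) :
    AEStronglyMeasurable (fun x => sym (A x) (B x) (f x)) μ := by
  have aux : ∀ S : ((Fin d → Fin d → ℝ) × (Fin d → ℝ)) × E d → ℂ, Continuous S →
      AEStronglyMeasurable (fun x => S ((A x, B x), f x)) μ :=
    fun S hS => hS.comp_aestronglyMeasurable ((hA.prodMk hB).prodMk hf)
  exact aux _ continuous_sym

/-- Bounded measurable elliptic coefficients depending on time only. -/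
structure IsCoef (γ M : ℝ) (α : ℝ → Fin d → Fin d → ℝ) (β : ℝ → Fin d → ℝ) : Prop where
  meas_α : AEStronglyMeasurable α volume
  meas_β : AEStronglyMeasurable β volume
  bdd_α : ∀ s i j, |α s i j| ≤ M
  bdd_β : ∀ s i, |β s i| ≤ M
  symm : ∀ s i j, α s i j = α s j i
  ell : ∀ s (ξ : E d), γ * ‖ξ‖ ^ 2 ≤ ∑ i, ∑ j, α s i j * ξ i * ξ j

/-- The integrated second order coefficients. -/
def intA (α : ℝ → Fin d → Fin d → ℝ) (t s : ℝ) (i j : Fin d) : ℝ := ∫ r in t..s, α r i j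

/-- The integrated first order coefficients. -/
def intB (β : ℝ → Fin d → ℝ) (t s : ℝ) (i : Fin d) : ℝ := ∫ r in t..s, β r i

/-- The Fourier multiplier of the evolution from time `t` to time `s`. -/
def mult (α : ℝ → Fin d → Fin d → ℝ) (β : ℝ → Fin d → ℝ) (t s : ℝ) (ξ : E d) : ℂ :=
  Complex.exp (-sym (intA α t s) (intB β t s) ξ)

lemma intervalIntegrable_fun_sum {ι : Type*} {f : ι → ℝ → ℝ} {a b : ℝ} (s : Finset ι)
    (h : ∀ i ∈ s, IntervalIntegrable (f i) volume a b) :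
    IntervalIntegrable (fun r => ∑ i ∈ s, f i r) volume a b := by
  have := IntervalIntegrable.sum s h
  rwa [Finset.sum_fn] at this

lemma intervalIntegrable_ofReal {f : ℝ → ℝ} {a b : ℝ} (h : IntervalIntegrable f volume a b) :
    IntervalIntegrable (fun r => (f r : ℂ)) volume a b := ⟨h.1.ofReal, h.2.ofReal⟩

namespace IsCoef

variable {γ M : ℝ} {α α' : ℝ → Fin d → Fin d → ℝ} {β β' : ℝ → Fin d → ℝ} {t s : ℝ}

lemma meas_α_apply (h : IsCoef γ M α β) (i j : Fin d) :
    AEStronglyMeasurable (fun s => α s i j) volume :=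
  (continuous_apply_apply i j).comp_aestronglyMeasurable h.meas_α

lemma meas_β_apply (h : IsCoef γ M α β) (i : Fin d) :
    AEStronglyMeasurable (fun s => β s i) volume :=
  (continuous_apply i).comp_aestronglyMeasurable h.meas_β

lemma neg (h : IsCoef γ M α β) : IsCoef γ M α (fun s i => -β s i) where
  meas_α := h.meas_α
  meas_β := h.meas_β.neg
  bdd_α := h.bdd_α
  bdd_β s i := by rw [abs_neg]; exact h.bdd_β s i
  symm := h.symm
  ell := h.ell

lemma integrable_α (h : IsCoef γ M α β) (i j : Fin d) (a b : ℝ) :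
    IntervalIntegrable (fun s => α s i j) volume a b :=
  intervalIntegrable_of_bounded (h.meas_α_apply i j) (fun s => h.bdd_α s i j) a b

lemma integrable_β (h : IsCoef γ M α β) (i : Fin d) (a b : ℝ) :
    IntervalIntegrable (fun s => β s i) volume a b :=
  intervalIntegrable_of_bounded (h.meas_β_apply i) (fun s => h.bdd_β s i) a b

lemma continuous_intA (h : IsCoef γ M α β) (t : ℝ) : Continuous (intA α t) :=
  continuous_pi fun i => continuous_pi fun j =>
    continuous_integral_of_bounded (h.meas_α_apply i j) (fun s => h.bdd_α s i j) t

lemma continuous_intB (h : IsCoef γ M α β) (t : ℝ) : Continuous (intB β t) :=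
  continuous_pi fun i =>
    continuous_integral_of_bounded (h.meas_β_apply i) (fun s => h.bdd_β s i) t

lemma quad_intA (h : IsCoef γ M α β) (t s : ℝ) (ξ : E d) :
    ∑ i, ∑ j, intA α t s i j * ξ i * ξ j = ∫ r in t..s, ∑ i, ∑ j, α r i j * ξ i * ξ j := by
  have hi : ∀ i j, IntervalIntegrable (fun r => α r i j * ξ i * ξ j) volume t s :=
    fun i j => ((h.integrable_α i j t s).mul_const _).mul_const _
  rw [intervalIntegral.integral_finsetSum fun i _ =>
    (intervalIntegrable_fun_sum (f := fun j r => α r i j * ξ i * ξ j) Finset.univ fun j _ => hi i j)]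
  refine Finset.sum_congr rfl fun i _ => ?_
  rw [intervalIntegral.integral_finsetSum fun j _ => hi i j]
  refine Finset.sum_congr rfl fun j _ => ?_
  rw [intervalIntegral.integral_mul_const, intervalIntegral.integral_mul_const, intA]

lemma lin_intB (h : IsCoef γ M α β) (t s : ℝ) (ξ : E d) :
    ∑ i, intB β t s i * ξ i = ∫ r in t..s, ∑ i, β r i * ξ i := by
  rw [intervalIntegral.integral_finsetSum fun i _ => (h.integrable_β i t s).mul_const _]
  refine Finset.sum_congr rfl fun i _ => ?_
  rw [intervalIntegral.integral_mul_const, intB]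

lemma meas_sym (h : IsCoef γ M α β) (ξ : E d) :
    AEStronglyMeasurable (fun r => sym (α r) (β r) ξ) volume :=
  aestronglyMeasurable_sym_comp h.meas_α h.meas_β aestronglyMeasurable_const

lemma norm_sym_le (h : IsCoef γ M α β) (r : ℝ) (ξ : E d) :
    ‖sym (α r) (β r) ξ‖ ≤ M * symBound ξ :=
  FokkerPlanck.norm_sym_le (h.bdd_α r) (h.bdd_β r) ξ

/-- The symbol is linear in the coefficients, so the multiplier is the exponential of the time
integral of a scalar function, as `exp_neg_integral_eq` requires. -/
lemma sym_int (h : IsCoef γ M α β) (t s : ℝ) (ξ : E d) :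
    sym (intA α t s) (intB β t s) ξ = ∫ r in t..s, sym (α r) (β r) ξ := by
  have i1 : IntervalIntegrable (fun r => ∑ i, ∑ j, α r i j * ξ i * ξ j) volume t s :=
    intervalIntegrable_fun_sum (f := fun i r => ∑ j, α r i j * ξ i * ξ j) _ fun i _ =>
      intervalIntegrable_fun_sum (f := fun j r => α r i j * ξ i * ξ j) _ fun j _ =>
        ((h.integrable_α i j t s).mul_const _).mul_const _
  have i2 : IntervalIntegrable (fun r => ∑ i, β r i * ξ i) volume t s :=
    intervalIntegrable_fun_sum (f := fun i r => β r i * ξ i) _ fun i _ =>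
      (h.integrable_β i t s).mul_const _
  unfold sym
  rw [h.quad_intA, h.lin_intB, ← intervalIntegral.integral_ofReal,
    ← intervalIntegral.integral_ofReal, ← intervalIntegral.integral_const_mul,
    ← intervalIntegral.integral_const_mul, ← intervalIntegral.integral_add]
  · exact (intervalIntegrable_ofReal i1).const_mul _
  · exact (intervalIntegrable_ofReal i2).const_mul _

lemma quad_ge (h : IsCoef γ M α β) (hts : t ≤ s) (ξ : E d) :
    γ * (s - t) * ‖ξ‖ ^ 2 ≤ ∑ i, ∑ j, intA α t s i j * ξ i * ξ j := by
  rw [h.quad_intA]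
  have i1 : IntervalIntegrable (fun r => ∑ i, ∑ j, α r i j * ξ i * ξ j) volume t s :=
    intervalIntegrable_fun_sum (f := fun i r => ∑ j, α r i j * ξ i * ξ j) _ fun i _ =>
      intervalIntegrable_fun_sum (f := fun j r => α r i j * ξ i * ξ j) _ fun j _ =>
        ((h.integrable_α i j t s).mul_const _).mul_const _
  have := intervalIntegral.integral_mono_on hts intervalIntegrable_const i1
    (fun r _ => h.ell r ξ)
  rw [intervalIntegral.integral_const, smul_eq_mul] at this
  linarith

lemma sym_re_ge (h : IsCoef γ M α β) (hts : t ≤ s) (ξ : E d) :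
    4 * Real.pi ^ 2 * γ * (s - t) * ‖ξ‖ ^ 2 ≤ (sym (intA α t s) (intB β t s) ξ).re := by
  rw [sym_re]
  have := h.quad_ge hts ξ
  have h4 : 0 ≤ 4 * Real.pi ^ 2 := by positivity
  nlinarith [mul_le_mul_of_nonneg_left this h4]

/-- Ellipticity integrated over [t,s] bounds the real part of the integrated symbol from below. The
drift contributes only a phase. -/
lemma norm_mult_le (h : IsCoef γ M α β) (hts : t ≤ s) (ξ : E d) :
    ‖mult α β t s ξ‖ ≤ Real.exp (-(4 * Real.pi ^ 2 * γ * (s - t) * ‖ξ‖ ^ 2)) := by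
  rw [mult, Complex.norm_exp, Complex.neg_re]
  exact Real.exp_le_exp.2 (neg_le_neg (h.sym_re_ge hts ξ))

lemma norm_mult_le_one (h : IsCoef γ M α β) (hγ : 0 ≤ γ) (hts : t ≤ s) (ξ : E d) :
    ‖mult α β t s ξ‖ ≤ 1 := by
  refine (h.norm_mult_le hts ξ).trans (Real.exp_le_one_iff.2 (neg_nonpos.2 ?_))
  have : 0 ≤ s - t := sub_nonneg.2 hts
  positivity

lemma continuous_mult (h : IsCoef γ M α β) (t : ℝ) :
    Continuous fun p : ℝ × E d => mult α β t p.1 p.2 := by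
  have h1 : Continuous fun p : ℝ × E d => sym (intA α t p.1) (intB β t p.1) p.2 :=
    continuous_sym_comp ((h.continuous_intA t).comp continuous_fst)
      ((h.continuous_intB t).comp continuous_fst) continuous_snd
  exact Complex.continuous_exp.comp h1.neg

lemma continuous_mult_right (h : IsCoef γ M α β) (t s : ℝ) : Continuous (mult α β t s) :=
  Continuous.comp (h.continuous_mult t) (f := fun ξ => (s, ξ)) (by fun_prop)

lemma continuous_mult_left (h : IsCoef γ M α β) (t : ℝ) (ξ : E d) :
    Continuous fun s => mult α β t s ξ :=
  Continuous.comp (h.continuous_mult t) (f := fun s => (s, ξ)) (by fun_prop)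

lemma mult_self (α : ℝ → Fin d → Fin d → ℝ) (β : ℝ → Fin d → ℝ) (t : ℝ) :
    mult α β t t = fun _ : E d => (1 : ℂ) := by
  ext ξ
  simp [mult, sym, intA, intB]

lemma mult_eq (h : IsCoef γ M α β) (hγ : 0 ≤ γ) (hts : t ≤ s) (ξ : E d) :
    mult α β t s ξ = 1 - ∫ r in t..s, sym (α r) (β r) ξ * mult α β t r ξ := by
  have := exp_neg_integral_eq (h.meas_sym ξ) (fun r => h.norm_sym_le r ξ) (fun r => ?_) hts
  · simp only [mult, h.sym_int]; exact this
  · rw [sym_re]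
    have := h.ell r ξ
    have : 0 ≤ γ * ‖ξ‖ ^ 2 := by positivity
    have h4 : 0 ≤ 4 * Real.pi ^ 2 := by positivity
    exact mul_nonneg h4 (by linarith)

/-- Integrated form of the evolution equation on the Fourier side. -/
lemma integral_mult_mul (h : IsCoef γ M α β) (hγ : 0 ≤ γ) (hts : t ≤ s) {G : E d → ℂ}
    (hG : Integrable G) (hG' : Integrable fun ξ => symBound ξ * ‖G ξ‖) :
    ∫ ξ, mult α β t s ξ * G ξ
      = (∫ ξ, G ξ) + ∫ r in t..s, ∫ ξ, (mult α β t r ξ * (-sym (α r) (β r) ξ)) * G ξ := by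
  -- Fubini is justified by |`mult`| ≤ 1 on [t,s] and |`sym`| ≤ M · `symBound`.
  have hint : Integrable (Function.uncurry fun r ξ =>
      (mult α β t r ξ * (-sym (α r) (β r) ξ)) * G ξ)
      ((volume.restrict (Ioc t s)).prod (volume : Measure (E d))) := by
    have hdom : Integrable (fun p : ℝ × E d => M * (symBound p.2 * ‖G p.2‖))
        ((volume.restrict (Ioc t s)).prod (volume : Measure (E d))) :=
      (hG'.const_mul M).comp_snd _
    refine hdom.mono' ?_ ?_
    · refine ((h.continuous_mult t).aestronglyMeasurable.mul ?_).mul hG.1.comp_snd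
      have hα : AEStronglyMeasurable (fun p : ℝ × E d => α p.1)
          ((volume.restrict (Ioc t s)).prod (volume : Measure (E d))) := h.meas_α.restrict.comp_fst
      have hβ : AEStronglyMeasurable (fun p : ℝ × E d => β p.1)
          ((volume.restrict (Ioc t s)).prod (volume : Measure (E d))) := h.meas_β.restrict.comp_fst
      exact (aestronglyMeasurable_sym_comp hα hβ continuous_snd.aestronglyMeasurable).neg
    · have : ∀ᵐ p ∂((volume.restrict (Ioc t s)).prod (volume : Measure (E d))), p.1 ∈ Ioc t s :=
        Measure.quasiMeasurePreserving_fst.ae (ae_restrict_mem measurableSet_Ioc)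
      filter_upwards [this] with p hp
      simp only [Function.uncurry, norm_mul, norm_neg]
      calc ‖mult α β t p.1 p.2‖ * ‖sym (α p.1) (β p.1) p.2‖ * ‖G p.2‖
          ≤ 1 * (M * symBound p.2) * ‖G p.2‖ := by
            gcongr
            · exact h.norm_mult_le_one hγ hp.1.le _
            · exact h.norm_sym_le _ _
        _ = _ := by ring
  rw [intervalIntegral.integral_of_le hts, integral_integral_swap hint]
  refine Eq.trans (integral_congr_ae (.of_forall fun ξ => ?_))
    (integral_add hG hint.integral_prod_right)
  simp only
  rw [h.mult_eq hγ hts ξ, ← intervalIntegral.integral_of_le hts,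
    intervalIntegral.integral_mul_const]
  have : ∫ r in t..s, mult α β t r ξ * -sym (α r) (β r) ξ
      = -∫ r in t..s, sym (α r) (β r) ξ * mult α β t r ξ := by
    rw [← intervalIntegral.integral_neg]
    congr 1; ext r; ring
  rw [this]; ring

end IsCoef

/-- From e^y ≥ 1 + y and 1 + u² ≥ 2u with u = x√c. With c proportional to s - t, one factor |ξ| is
absorbed at the cost of (s-t)^{-1/2}. -/
lemma mul_exp_neg_le {c x : ℝ} (hc : 0 < c) : x * Real.exp (-(c * x ^ 2)) ≤ 1 / √c := by
  rw [le_div_iff₀ (Real.sqrt_pos.2 hc), Real.exp_neg, mul_assoc, mul_comm (Real.exp _)⁻¹,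
    ← mul_assoc, ← div_eq_mul_inv, div_le_one (Real.exp_pos _)]
  have h1 := Real.add_one_le_exp (c * x ^ 2)
  have h2 : (x * √c) ^ 2 = c * x ^ 2 := by rw [mul_pow, Real.sq_sqrt hc.le]; ring
  nlinarith [sq_nonneg (x * √c - 1)]

lemma sq_mul_exp_neg_le {c x : ℝ} (hc : 0 < c) : x ^ 2 * Real.exp (-(c * x ^ 2)) ≤ 1 / c := by
  rw [le_div_iff₀ hc, Real.exp_neg, mul_assoc, mul_comm (Real.exp _)⁻¹,
    ← mul_assoc, ← div_eq_mul_inv, div_le_one (Real.exp_pos _)]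
  have h1 := Real.add_one_le_exp (c * x ^ 2)
  linarith

/-- The parabolic smoothing integral. -/
lemma lintegral_sq_mul_exp_le {c x t T : ℝ} (hc : 0 < c) (htT : t ≤ T) :
    ∫⁻ s in Icc t T, ENNReal.ofReal (x ^ 2 * Real.exp (-(c * (s - t) * x ^ 2)) ^ 2)
      ≤ ENNReal.ofReal (1 / (2 * c)) := by
  have hcont : Continuous fun s => x ^ 2 * Real.exp (-(c * (s - t) * x ^ 2)) ^ 2 := by fun_prop
  rw [← ofReal_integral_eq_lintegral_ofReal (hcont.integrableOn_Icc)
    (.of_forall fun s => by positivity)]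
  refine ENNReal.ofReal_le_ofReal ?_
  rw [integral_Icc_eq_integral_Ioc, ← intervalIntegral.integral_of_le htT]
  -- The factor x² in the integrand spares this primitive a division by x², so x = 0 is no exception
  -- and the bound is uniform in x.
  have hderiv : ∀ s ∈ uIcc t T, HasDerivAt
      (fun s => -(1 / (2 * c)) * Real.exp (-(2 * c * x ^ 2 * (s - t))))
      (x ^ 2 * Real.exp (-(c * (s - t) * x ^ 2)) ^ 2) s := by
    intro s _
    have h1 : HasDerivAt (fun s => -(2 * c * x ^ 2 * (s - t))) (-(2 * c * x ^ 2 * 1)) s :=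
      (((hasDerivAt_id s).sub_const t).const_mul _).neg
    have h2 := (h1.exp).const_mul (-(1 / (2 * c)))
    convert! h2 using 1
    rw [← Real.exp_nat_mul]
    push_cast
    rw [show (2 : ℝ) * -(c * (s - t) * x ^ 2) = -(2 * c * x ^ 2 * (s - t)) by ring]
    field_simp
  rw [intervalIntegral.integral_eq_sub_of_hasDerivAt hderiv (hcont.intervalIntegrable _ _)]
  simp only [sub_self, mul_zero, neg_zero, Real.exp_zero]
  have : 0 ≤ (1 / (2 * c)) * Real.exp (-(2 * c * x ^ 2 * (T - t))) := by positivity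
  linarith

end

/-! ### The evolution operator: contraction, continuity and weak form. -/

section

open Filter Topology
open scoped SchwartzMap

variable {d : ℕ}

/-- The evolution from time `t` to time `s` with coefficients `α`, `β`. -/
def evol (α : ℝ → Fin d → Fin d → ℝ) (β : ℝ → Fin d → ℝ) (t s : ℝ) (φ : L2 d) : L2 d :=
  ift d (symb (mult α β t s) (ft φ))

lemma evol_self (α : ℝ → Fin d → Fin d → ℝ) (β : ℝ → Fin d → ℝ) (t : ℝ) (φ : L2 d) :
    evol α β t t φ = φ := by
  rw [evol, IsCoef.mult_self, symb_one, ift_ft]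

lemma enorm_ft (u : L2 d) : ‖ft u‖ₑ = ‖u‖ₑ := by
  rw [← ofReal_norm, ← ofReal_norm, norm_ft]

lemma chk_memLp {ψ : E d → ℝ} (h : IsTest ψ) : MemLp (chk ψ h) 2 (volume : Measure (E d)) :=
  (chk ψ h).memLp 2 _

/-- Elements of `L²` are determined by their pairings with test functions. -/
lemma L2_ext_test {u v : L2 d} (h : ∀ ψ : E d → ℝ, IsTest ψ → ∫ x, u x * ψ x = ∫ x, v x * ψ x) :
    u = v := by
  apply Lp.ext
  refine ae_eq_of_integral_contDiff_smul_eq ((Lp.memLp u).locallyIntegrable (by norm_num))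
    ((Lp.memLp v).locallyIntegrable (by norm_num)) fun g hg hc => ?_
  simpa only [smul_eq_mul, mul_comm] using h g ⟨hg, hc⟩

/-- The decay of `Ψ` beats the quadratic growth of the symbol. This is the integrability needed to
exchange the integrals in time and frequency. -/
lemma schwartz_symBound_mul (f : CL2 d) (Ψ : 𝓢(E d, ℂ)) :
    Integrable (fun ξ => symBound ξ * ‖f ξ * Ψ ξ‖) := by
  have h1 : ∀ k : ℕ, MemLp (fun ξ => ‖ξ‖ ^ k * ‖Ψ ξ‖) 2 (volume : Measure (E d)) := by
    intro k
    have hbdd : ∃ C : ℝ, ∀ ξ, ‖ξ‖ ^ k * ‖Ψ ξ‖ ≤ C := by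
      obtain ⟨C, hC⟩ := Ψ.decay k 0
      exact ⟨C, fun ξ => by simpa using hC.2 ξ⟩
    obtain ⟨C, hC⟩ := hbdd
    have hint := Ψ.integrable_pow_mul volume k
    rw [memLp_two_iff_integrable_sq hint.1]
    refine (hint.const_mul C).mono' (hint.1.pow 2) (.of_forall fun ξ => ?_)
    have h0 : 0 ≤ ‖ξ‖ ^ k * ‖Ψ ξ‖ := by positivity
    rw [Real.norm_of_nonneg (by positivity), sq]
    exact mul_le_mul_of_nonneg_right (hC ξ) h0
  have h2 : MemLp (fun ξ => symBound ξ * ‖Ψ ξ‖) 2 (volume : Measure (E d)) := by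
    have := ((h1 2).const_mul (4 * Real.pi ^ 2 * d ^ 2)).add ((h1 1).const_mul (2 * Real.pi * d))
    refine this.ae_eq (.of_forall fun ξ => ?_)
    simp only [Pi.add_apply, symBound, pow_one]; ring
  have := (Lp.memLp f).norm.integrable_mul h2
  refine this.congr (.of_forall fun ξ => ?_)
  simp only [Pi.mul_apply, norm_mul]; ring

namespace IsCoef

variable {γ M : ℝ} {α α' : ℝ → Fin d → Fin d → ℝ} {β β' : ℝ → Fin d → ℝ} {t s T : ℝ}

lemma memLp_mult (h : IsCoef γ M α β) (hγ : 0 ≤ γ) (hts : t ≤ s) (f : CL2 d) :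
    MemLp (fun ξ => mult α β t s ξ * f ξ) 2 (volume : Measure (E d)) :=
  memLp_mul_of_bounded (h.continuous_mult_right t s) f (h.norm_mult_le_one hγ hts)

lemma enorm_evol_le (h : IsCoef γ M α β) (hγ : 0 ≤ γ) (hts : t ≤ s) (φ : L2 d) :
    ‖evol α β t s φ‖ₑ ≤ ‖φ‖ₑ := by
  refine (enorm_ift_le _).trans ?_
  rw [← enorm_ft φ]
  refine enorm_symb_le (.of_forall fun ξ => ?_)
  rw [norm_mul]
  exact mul_le_of_le_one_left (norm_nonneg _) (h.norm_mult_le_one hγ hts ξ)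

lemma norm_evol_le (h : IsCoef γ M α β) (hγ : 0 ≤ γ) (hts : t ≤ s) (φ : L2 d) :
    ‖evol α β t s φ‖ ≤ ‖φ‖ := by
  have := h.enorm_evol_le hγ hts φ
  rwa [enorm_le_iff_norm_le] at this

lemma continuousOn_evol (h : IsCoef γ M α β) (hγ : 0 ≤ γ) (t : ℝ) (φ : L2 d) :
    ContinuousOn (fun s => evol α β t s φ) (Ici t) := by
  refine (ift d).continuous.comp_continuousOn (continuousOn_symb (ft φ)
    (fun s _ => h.continuous_mult_right t s) (fun ξ => (h.continuous_mult_left t ξ).continuousOn)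
    fun s₀ _ => ⟨fun ξ => ‖ft φ ξ‖, (Lp.memLp _).norm, ?_⟩)
  filter_upwards [self_mem_nhdsWithin] with s hs
  refine .of_forall fun ξ => ?_
  rw [norm_mul]
  exact mul_le_of_le_one_left (norm_nonneg _) (h.norm_mult_le_one hγ hs ξ)

lemma integral_evol_mul (h : IsCoef γ M α β) (hγ : 0 ≤ γ) (hts : t ≤ s) (φ : L2 d)
    {ψ : E d → ℝ} (hψ : IsTest ψ) :
    ∫ x, evol α β t s φ x * ψ x = (∫ ξ, mult α β t s ξ * (ft φ ξ * chk ψ hψ ξ)).re := by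
  rw [evol, integral_ift_mul _ ψ hψ]
  congr 1
  refine integral_congr_ae ?_
  filter_upwards [coeFn_symb (h.memLp_mult hγ hts (ft φ))] with ξ hξ
  rw [hξ]; ring

lemma re_intervalIntegral {F : ℝ → ℂ} (hF : IntervalIntegrable F volume t s) :
    (∫ r in t..s, F r).re = ∫ r in t..s, (F r).re :=
  (Complex.reCLM.intervalIntegral_comp_comm hF).symm

lemma intervalIntegrable_mult (h : IsCoef γ M α β) (hγ : 0 ≤ γ) (hts : t ≤ s) {G : E d → ℂ}
    (hG : AEStronglyMeasurable G volume) (hG' : Integrable fun ξ => symBound ξ * ‖G ξ‖) :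
    IntervalIntegrable (fun r => ∫ ξ, (mult α β t r ξ * (-sym (α r) (β r) ξ)) * G ξ) volume t s := by
  rw [intervalIntegrable_iff_integrableOn_Ioc_of_le hts]
  have hdom : Integrable (fun p : ℝ × E d => M * (symBound p.2 * ‖G p.2‖))
      ((volume.restrict (Ioc t s)).prod (volume : Measure (E d))) :=
    (hG'.const_mul M).comp_snd _
  refine Integrable.integral_prod_left (f := fun p : ℝ × E d =>
    (mult α β t p.1 p.2 * (-sym (α p.1) (β p.1) p.2)) * G p.2) (hdom.mono' ?_ ?_)
  · refine ((h.continuous_mult t).aestronglyMeasurable.mul ?_).mul hG.comp_snd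
    have hα : AEStronglyMeasurable (fun p : ℝ × E d => α p.1)
        ((volume.restrict (Ioc t s)).prod (volume : Measure (E d))) := h.meas_α.restrict.comp_fst
    have hβ : AEStronglyMeasurable (fun p : ℝ × E d => β p.1)
        ((volume.restrict (Ioc t s)).prod (volume : Measure (E d))) := h.meas_β.restrict.comp_fst
    exact (aestronglyMeasurable_sym_comp hα hβ continuous_snd.aestronglyMeasurable).neg
  · have : ∀ᵐ p ∂((volume.restrict (Ioc t s)).prod (volume : Measure (E d))), p.1 ∈ Ioc t s :=
      Measure.quasiMeasurePreserving_fst.ae (ae_restrict_mem measurableSet_Ioc)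
    filter_upwards [this] with p hp
    simp only [norm_mul, norm_neg]
    calc ‖mult α β t p.1 p.2‖ * ‖sym (α p.1) (β p.1) p.2‖ * ‖G p.2‖
        ≤ 1 * (M * symBound p.2) * ‖G p.2‖ := by
          gcongr
          · exact h.norm_mult_le_one hγ hp.1.le _
          · exact h.norm_sym_le _ _
      _ = _ := by ring

lemma re_integral_mult_mul (h : IsCoef γ M α β) (hγ : 0 ≤ γ) (hts : t ≤ s) {G : E d → ℂ}
    (hG : Integrable G) (hG' : Integrable fun ξ => symBound ξ * ‖G ξ‖) :
    (∫ ξ, mult α β t s ξ * G ξ).re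
      = (∫ ξ, G ξ).re
        + ∫ r in t..s, (∫ ξ, (mult α β t r ξ * (-sym (α r) (β r) ξ)) * G ξ).re := by
  rw [h.integral_mult_mul hγ hts hG hG', Complex.add_re,
    re_intervalIntegral (h.intervalIntegrable_mult hγ hts hG.1 hG')]

/-- The evolution solves the equation in the weak sense. -/
lemma evol_weak (h : IsCoef γ M α β) (hγ : 0 ≤ γ) (hts : t ≤ s) (φ : L2 d)
    {ψ : E d → ℝ} (hψ : IsTest ψ) :
    ∫ x, evol α β t s φ x * ψ x = (∫ x, φ x * ψ x)
      + ∫ r in t..s, ∫ x, evol α β t r φ x * ellOp (α r) (β r) ψ x := by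
  have h0 := h.integral_evol_mul hγ le_rfl φ hψ (t := t)
  simp only [evol_self, mult_self, one_mul] at h0
  rw [h.integral_evol_mul hγ hts φ hψ, h0, h.re_integral_mult_mul hγ hts
    (integrable_mul_of_memLp _ (chk_memLp hψ)) (schwartz_symBound_mul _ _)]
  congr 1
  refine intervalIntegral.integral_congr fun r hr => ?_
  rw [uIcc_of_le hts] at hr
  -- Multiplication by minus the symbol is read back as the dual operator acting on the test
  -- function.
  rw [h.integral_evol_mul hγ hr.1 φ (hψ.ellOp (α r) (β r))]
  congr 2
  ext ξ
  rw [chk_ellOp hψ]; ring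

end IsCoef

lemma isWeakPartial_ift {i : Fin d} {v w : CL2 d}
    (h : ∀ᵐ ξ, w ξ = 2 * Real.pi * Complex.I * ξ i * v ξ) :
    IsWeakPartial i (ift d v) (ift d w) := by
  intro ψ hψ
  rw [integral_ift_mul _ _ (hψ.partialDeriv i), integral_ift_mul _ _ hψ, ← Complex.neg_re,
    ← integral_neg]
  congr 1
  refine integral_congr_ae ?_
  filter_upwards [h] with ξ hξ
  rw [chk_partialDeriv hψ, hξ]; ring

/-- The square of the seminorm of `W^{1,2}`, up to a constant, on the Fourier side. -/
def gradSq (φ : L2 d) : ℝ≥0∞ := ∫⁻ ξ, ‖ξ‖ₑ ^ 2 * ‖ft φ ξ‖ₑ ^ 2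

lemma sum_enorm_coord_sq (ξ : E d) : ∑ i, ‖ξ i‖ₑ ^ 2 = ‖ξ‖ₑ ^ 2 := by
  have h := EuclideanSpace.norm_sq_eq ξ
  have e : ∀ r : ℝ, 0 ≤ r → ENNReal.ofReal (r ^ 2) = ENNReal.ofReal r ^ 2 :=
    fun r hr => ENNReal.ofReal_pow hr 2
  simp only [← ofReal_norm]
  rw [← e _ (norm_nonneg _), h, ENNReal.ofReal_sum_of_nonneg fun _ _ => by positivity]
  exact Finset.sum_congr rfl fun i _ => (e _ (norm_nonneg _)).symm

/-- By Plancherel, ‖g i‖² is the integral of |2π ξ_i `ft φ`|² for every admissible gradient `g`, so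
the infimum is bounded below. The factor (2π)² ≥ 1 is discarded. -/
lemma gradSq_le (φ : L2 d) : gradSq φ ≤ enormW12 φ ^ 2 := by
  have : gradSq φ ^ (1 / 2 : ℝ) ≤ enormW12 φ := by
    refine le_iInf₂ fun g hg => ENNReal.rpow_le_rpow ?_ (by norm_num)
    refine le_trans ?_ le_add_self
    have e : ∀ i, ‖g i‖ₑ ^ 2 = ∫⁻ ξ : E d, ‖2 * Real.pi * Complex.I * ξ i * ft φ ξ‖ₑ ^ 2 := by
      intro i
      rw [← enorm_ft, enorm_sq_Lp]
      refine lintegral_congr_ae ?_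
      filter_upwards [(hg i).ft_eq] with ξ hξ
      rw [hξ]
    simp only [e]
    rw [← lintegral_finsetSum' _ fun i _ => ?_]
    · refine lintegral_mono fun ξ => ?_
      simp only [enorm_mul, mul_pow, ← Finset.sum_mul]
      gcongr
      rw [← sum_enorm_coord_sq]
      refine Finset.sum_le_sum fun i _ => ?_
      have h2 : (1 : ℝ≥0∞) ≤ ‖(2 : ℂ)‖ₑ := by
        rw [← ofReal_norm]; simp
      have hpi : (1 : ℝ≥0∞) ≤ ‖(Real.pi : ℂ)‖ₑ := by
        rw [← ofReal_norm, Complex.norm_real, Real.norm_of_nonneg Real.pi_pos.le,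
          ← ENNReal.ofReal_one]
        exact ENNReal.ofReal_le_ofReal (by linarith [Real.pi_gt_three])
      have hI : ‖Complex.I‖ₑ = 1 := by rw [← ofReal_norm]; simp
      have hr : ‖((ξ i : ℝ) : ℂ)‖ₑ = ‖ξ i‖ₑ := by
        rw [← ofReal_norm, ← ofReal_norm, Complex.norm_real]
      rw [hI, hr, one_pow, mul_one]
      exact le_mul_of_one_le_left' (one_le_mul (one_le_pow_of_one_le' h2 2) (one_le_pow_of_one_le' hpi 2))
    · refine AEMeasurable.pow_const (AEStronglyMeasurable.enorm ?_) 2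
      have hc : Continuous fun ξ : E d => 2 * (Real.pi : ℂ) * Complex.I * (ξ i : ℂ) := by fun_prop
      exact hc.aestronglyMeasurable.mul (Lp.aestronglyMeasurable _)
  calc gradSq φ = (gradSq φ ^ (1 / 2 : ℝ)) ^ 2 := by
        rw [← ENNReal.rpow_natCast, ← ENNReal.rpow_mul]; norm_num
    _ ≤ _ := by gcongr

lemma enormW12_lt_top {φ : L2 d} (h : MemW12 φ) : enormW12 φ < ⊤ := by
  obtain ⟨g, hg⟩ := h
  refine lt_of_le_of_lt (iInf₂_le g hg) (ENNReal.rpow_lt_top_of_nonneg (by positivity) ?_)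
  refine ENNReal.add_ne_top.2 ⟨by finiteness, ?_⟩
  exact ENNReal.sum_ne_top.2 fun i _ => by finiteness

end

/-! ### Parabolic smoothing and dependence on the coefficients. -/

section

open Filter Topology
open scoped SchwartzMap

variable {d : ℕ}

lemma enorm_sq_eq_ofReal {F : Type*} [SeminormedAddCommGroup F] (x : F) :
    ‖x‖ₑ ^ 2 = ENNReal.ofReal (‖x‖ ^ 2) := by
  rw [← ofReal_norm, ENNReal.ofReal_pow (norm_nonneg _)]

/-- The constant `4π²γ` governing the decay of the multipliers. -/
def decayRate (γ : ℝ) : ℝ := 4 * Real.pi ^ 2 * γ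

lemma decayRate_pos {γ : ℝ} (hγ : 0 < γ) : 0 < decayRate γ := by unfold decayRate; positivity

/-- A function whose growth is compensated by every Gaussian. -/
def GaussBdd (p : E d → ℂ) : Prop :=
  Continuous p ∧ ∀ τ > 0, ∃ C, ∀ ξ, ‖p ξ‖ * Real.exp (-(τ * ‖ξ‖ ^ 2)) ≤ C

/-- The function `2πi ξ_i`. -/
def coordI (i : Fin d) (ξ : E d) : ℂ := 2 * Real.pi * Complex.I * ξ i

lemma continuous_coordI (i : Fin d) : Continuous (coordI i) := by unfold coordI; fun_prop

lemma norm_coordI (i : Fin d) (ξ : E d) : ‖coordI i ξ‖ = 2 * Real.pi * |ξ i| := by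
  simp [coordI, abs_of_pos Real.pi_pos]

lemma norm_coordI_le (i : Fin d) (ξ : E d) : ‖coordI i ξ‖ ≤ 2 * Real.pi * ‖ξ‖ := by
  rw [norm_coordI]
  exact mul_le_mul_of_nonneg_left (abs_coord_le ξ i) (by positivity)

lemma gaussBdd_coordI (i : Fin d) : GaussBdd (coordI i) := by
  refine ⟨continuous_coordI i, fun τ hτ => ⟨2 * Real.pi * (1 / √τ), fun ξ => ?_⟩⟩
  calc _ ≤ 2 * Real.pi * ‖ξ‖ * Real.exp (-(τ * ‖ξ‖ ^ 2)) := by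
        gcongr; exact norm_coordI_le i ξ
    _ ≤ _ := by
        rw [mul_assoc]
        exact mul_le_mul_of_nonneg_left (mul_exp_neg_le hτ) (by positivity)

lemma gaussBdd_coordI_mul (i j : Fin d) : GaussBdd fun ξ => coordI i ξ * coordI j ξ := by
  refine ⟨(continuous_coordI i).mul (continuous_coordI j),
    fun τ hτ => ⟨(2 * Real.pi) ^ 2 * (1 / τ), fun ξ => ?_⟩⟩
  calc _ ≤ (2 * Real.pi * ‖ξ‖) * (2 * Real.pi * ‖ξ‖) * Real.exp (-(τ * ‖ξ‖ ^ 2)) := by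
        rw [norm_mul]; gcongr <;> exact norm_coordI_le _ ξ
    _ = (2 * Real.pi) ^ 2 * (‖ξ‖ ^ 2 * Real.exp (-(τ * ‖ξ‖ ^ 2))) := by ring
    _ ≤ _ := mul_le_mul_of_nonneg_left (sq_mul_exp_neg_le hτ) (by positivity)

/-- Separates the coefficients, merely measurable in time, from fixed functions of ξ. Measurability
in time of operators built from the symbol then reduces to that of scalars times continuous curves.
-/
lemma sym_eq_coordI (A : Fin d → Fin d → ℝ) (B : Fin d → ℝ) (ξ : E d) :
    sym A B ξ = -(∑ i, ∑ j, (A i j : ℂ) * (coordI i ξ * coordI j ξ))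
      + ∑ i, (B i : ℂ) * coordI i ξ := by
  simp only [sym, coordI]
  push_cast
  simp only [Finset.mul_sum, ← Finset.sum_neg_distrib]
  congr 1
  · refine Finset.sum_congr rfl fun i _ => Finset.sum_congr rfl fun j _ => ?_
    linear_combination (4 * Real.pi ^ 2 * A i j * ξ i * ξ j) * Complex.I_sq
  · exact Finset.sum_congr rfl fun i _ => by ring

lemma coeFn_finset_sum {ι : Type*} (s : Finset ι) (f : ι → CL2 d) :
    ⇑(∑ i ∈ s, f i) =ᵐ[volume] fun ξ => ∑ i ∈ s, f i ξ := by
  classical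
  induction s using Finset.induction_on with
  | empty =>
    simp only [Finset.sum_empty]
    exact Lp.coeFn_zero _ _ _
  | insert a s ha ih =>
    simp only [Finset.sum_insert ha]
    filter_upwards [Lp.coeFn_add (f a) (∑ i ∈ s, f i), ih] with ξ h1 h2
    rw [h1, Pi.add_apply, h2]

namespace IsCoef

variable {γ M : ℝ} {α α' : ℝ → Fin d → Fin d → ℝ} {β β' : ℝ → Fin d → ℝ} {t s T : ℝ}

lemma norm_mult_le' (h : IsCoef γ M α β) (hts : t ≤ s) (ξ : E d) :
    ‖mult α β t s ξ‖ ≤ Real.exp (-(decayRate γ * (s - t) * ‖ξ‖ ^ 2)) := h.norm_mult_le hts ξ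

/-- The Gaussian at the earliest time s₁ > t dominates all later ones, so the bound is uniform for s
≥ s₁. It degenerates as s₁ tends to t. -/
lemma norm_mul_mult_le (h : IsCoef γ M α β) (hγ : 0 < γ) {p : E d → ℂ} (hp : GaussBdd p)
    {s₁ : ℝ} (hts : t < s₁) : ∃ C, ∀ s, s₁ ≤ s → ∀ ξ, ‖p ξ * mult α β t s ξ‖ ≤ C := by
  have hc := decayRate_pos hγ
  obtain ⟨C, hC⟩ := hp.2 (decayRate γ * (s₁ - t)) (mul_pos hc (sub_pos.2 hts))
  refine ⟨C, fun s hs ξ => ?_⟩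
  refine le_trans ?_ (hC ξ)
  rw [norm_mul]
  refine mul_le_mul_of_nonneg_left ((h.norm_mult_le' (hts.le.trans hs) ξ).trans ?_) (norm_nonneg _)
  refine Real.exp_le_exp.2 (neg_le_neg ?_)
  gcongr

lemma memLp_mul_mult (h : IsCoef γ M α β) (hγ : 0 < γ) {p : E d → ℂ} (hp : GaussBdd p)
    (hts : t < s) (f : CL2 d) :
    MemLp (fun ξ => p ξ * mult α β t s ξ * f ξ) 2 (volume : Measure (E d)) := by
  obtain ⟨C, hC⟩ := h.norm_mul_mult_le hγ hp hts
  exact memLp_mul_of_bounded (hp.1.mul (h.continuous_mult_right t s)) f (hC s le_rfl)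

lemma continuousOn_symb_mul_mult (h : IsCoef γ M α β) (hγ : 0 < γ) {p : E d → ℂ}
    (hp : GaussBdd p) (t : ℝ) (f : CL2 d) :
    ContinuousOn (fun s => symb (fun ξ => p ξ * mult α β t s ξ) f) (Ioi t) := by
  refine continuousOn_symb f (fun s _ => hp.1.mul (h.continuous_mult_right t s))
    (fun ξ => (continuous_const.mul (h.continuous_mult_left t ξ)).continuousOn) fun s₀ hs₀ => ?_
  have hs₀ : t < s₀ := hs₀
  -- The midpoint keeps a neighbourhood of `s₀` at positive distance from `t`, where the uniform
  -- bound is available.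
  have hts : t < (t + s₀) / 2 := by linarith
  obtain ⟨C, hC⟩ := h.norm_mul_mult_le hγ hp hts
  refine ⟨fun ξ => C * ‖f ξ‖, (Lp.memLp f).norm.const_mul C, ?_⟩
  filter_upwards [mem_nhdsWithin_of_mem_nhds (Ici_mem_nhds (show (t + s₀) / 2 < s₀ by linarith))]
    with s hs
  refine .of_forall fun ξ => ?_
  rw [norm_mul]
  exact mul_le_mul_of_nonneg_right (hC s hs ξ) (norm_nonneg _)

lemma aestronglyMeasurable_symb_mul_mult (h : IsCoef γ M α β) (hγ : 0 < γ) {p : E d → ℂ}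
    (hp : GaussBdd p) (t T : ℝ) (f : CL2 d) :
    AEStronglyMeasurable (fun s => symb (fun ξ => p ξ * mult α β t s ξ) f)
      (volume.restrict (Icc t T)) := by
  -- Continuity is known only for s > t; the endpoint is a null set.
  rw [← restrict_Ioc_eq_restrict_Icc]
  exact ((h.continuousOn_symb_mul_mult hγ hp t f).mono Ioc_subset_Ioi_self).aestronglyMeasurable
    measurableSet_Ioc

end IsCoef

/-- The generalized derivative of the evolution. -/
def evolGrad (α : ℝ → Fin d → Fin d → ℝ) (β : ℝ → Fin d → ℝ) (t : ℝ) (φ : L2 d) (i : Fin d)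
    (s : ℝ) : L2 d :=
  ift d (symb (fun ξ => coordI i ξ * mult α β t s ξ) (ft φ))

namespace IsCoef

variable {γ M : ℝ} {α α' : ℝ → Fin d → Fin d → ℝ} {β β' : ℝ → Fin d → ℝ} {t s T : ℝ}

lemma isWeakPartial_evol (h : IsCoef γ M α β) (hγ : 0 < γ) (hts : t < s) (φ : L2 d) (i : Fin d) :
    IsWeakPartial i (evol α β t s φ) (evolGrad α β t φ i s) := by
  refine isWeakPartial_ift ?_
  filter_upwards [coeFn_symb (h.memLp_mult hγ.le hts.le (ft φ)),
    coeFn_symb (h.memLp_mul_mult hγ (gaussBdd_coordI i) hts (ft φ))] with ξ h1 h2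
  rw [h1, h2, coordI]; ring

lemma aestronglyMeasurable_evolGrad (h : IsCoef γ M α β) (hγ : 0 < γ) (φ : L2 d) (i : Fin d) :
    AEStronglyMeasurable (evolGrad α β t φ i) (volume.restrict (Icc t T)) :=
  (ift d).continuous.comp_aestronglyMeasurable
    (h.aestronglyMeasurable_symb_mul_mult hγ (gaussBdd_coordI i) t T (ft φ))

lemma sum_enorm_evolGrad_le (h : IsCoef γ M α β) (hts : t ≤ s) (φ : L2 d) :
    ∑ i, ‖evolGrad α β t φ i s‖ₑ ^ 2 ≤ ∫⁻ ξ, ENNReal.ofReal ((2 * Real.pi) ^ 2 *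
      (‖ξ‖ ^ 2 * Real.exp (-(decayRate γ * (s - t) * ‖ξ‖ ^ 2)) ^ 2)) * ‖ft φ ξ‖ₑ ^ 2 := by
  calc ∑ i, ‖evolGrad α β t φ i s‖ₑ ^ 2
      ≤ ∑ i, ∫⁻ ξ, ‖coordI i ξ * mult α β t s ξ‖ₑ ^ 2 * ‖ft φ ξ‖ₑ ^ 2 := by
        refine Finset.sum_le_sum fun i _ => ?_
        refine le_trans ?_ (enorm_symb_sq_le _ _)
        gcongr
        exact enorm_ift_le _
    _ = ∫⁻ ξ, ∑ i, ‖coordI i ξ * mult α β t s ξ‖ₑ ^ 2 * ‖ft φ ξ‖ₑ ^ 2 := by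
        rw [lintegral_finsetSum']
        intro i _
        exact ((((continuous_coordI i).mul
          (h.continuous_mult_right t s)).aestronglyMeasurable.enorm).pow_const 2).mul
          ((Lp.aestronglyMeasurable _).enorm.pow_const 2)
    _ ≤ _ := by
        refine lintegral_mono fun ξ => ?_
        simp only [← Finset.sum_mul]
        gcongr
        simp only [enorm_sq_eq_ofReal]
        rw [← ENNReal.ofReal_sum_of_nonneg fun _ _ => by positivity]
        refine ENNReal.ofReal_le_ofReal ?_
        simp only [norm_mul, mul_pow, norm_coordI, sq_abs, ← Finset.sum_mul, ← Finset.mul_sum]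
        have := EuclideanSpace.norm_sq_eq ξ
        simp only [Real.norm_eq_abs, sq_abs] at this
        rw [← this, mul_assoc]
        gcongr
        exact h.norm_mult_le' hts ξ

/-- Tonelli, then the smoothing integral at each frequency with c = 4π²γ. The constant is (2π)² / (2
· 4π²γ) = 1/(2γ). -/
lemma lintegral_evolGrad_le (h : IsCoef γ M α β) (hγ : 0 < γ) (htT : t ≤ T) (φ : L2 d) :
    ∫⁻ s in Icc t T, ∑ i, ‖evolGrad α β t φ i s‖ₑ ^ 2
      ≤ ENNReal.ofReal (1 / (2 * γ)) * ‖φ‖ₑ ^ 2 := by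
  have hc := decayRate_pos hγ
  calc ∫⁻ s in Icc t T, ∑ i, ‖evolGrad α β t φ i s‖ₑ ^ 2
      ≤ ∫⁻ s in Icc t T, ∫⁻ ξ, ENNReal.ofReal ((2 * Real.pi) ^ 2 *
        (‖ξ‖ ^ 2 * Real.exp (-(decayRate γ * (s - t) * ‖ξ‖ ^ 2)) ^ 2)) * ‖ft φ ξ‖ₑ ^ 2 :=
        setLIntegral_mono_ae' measurableSet_Icc
          (.of_forall fun s hs => h.sum_enorm_evolGrad_le hs.1 φ)
    _ = ∫⁻ ξ, ∫⁻ s in Icc t T, ENNReal.ofReal ((2 * Real.pi) ^ 2 *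
        (‖ξ‖ ^ 2 * Real.exp (-(decayRate γ * (s - t) * ‖ξ‖ ^ 2)) ^ 2)) * ‖ft φ ξ‖ₑ ^ 2 := by
        refine lintegral_lintegral_swap ?_
        have h1 : Continuous fun p : ℝ × E d => (2 * Real.pi) ^ 2 *
            (‖p.2‖ ^ 2 * Real.exp (-(decayRate γ * (p.1 - t) * ‖p.2‖ ^ 2)) ^ 2) := by fun_prop
        exact AEMeasurable.mul h1.measurable.ennreal_ofReal.aemeasurable
          (AEMeasurable.comp_snd ((Lp.aestronglyMeasurable (ft φ)).enorm.pow_const 2))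
    _ ≤ ∫⁻ ξ, ENNReal.ofReal (1 / (2 * γ)) * ‖ft φ ξ‖ₑ ^ 2 := by
        refine lintegral_mono fun ξ => ?_
        have hm : Measurable fun s : ℝ => ENNReal.ofReal (‖ξ‖ ^ 2 *
            Real.exp (-(decayRate γ * (s - t) * ‖ξ‖ ^ 2)) ^ 2) := by fun_prop
        simp only [ENNReal.ofReal_mul (show 0 ≤ (2 * Real.pi) ^ 2 by positivity)]
        rw [lintegral_mul_const _ (hm.const_mul _), lintegral_const_mul _ hm]
        gcongr
        calc _ ≤ ENNReal.ofReal ((2 * Real.pi) ^ 2) * ENNReal.ofReal (1 / (2 * decayRate γ)) := by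
              gcongr
              exact lintegral_sq_mul_exp_le hc htT
          _ = _ := by
              rw [← ENNReal.ofReal_mul (by positivity)]
              congr 1
              unfold decayRate
              field_simp
              ring
    _ = _ := by
        rw [lintegral_const_mul'', ← enorm_sq_Lp, enorm_ft]
        exact (Lp.aestronglyMeasurable _).enorm.pow_const 2

lemma ae_isWeakPartial_evol (h : IsCoef γ M α β) (hγ : 0 < γ) (φ : L2 d) :
    ∀ᵐ s ∂(volume.restrict (Icc t T)), ∀ i,
      IsWeakPartial i (evol α β t s φ) (evolGrad α β t φ i s) := by
  rw [← restrict_Ioc_eq_restrict_Icc]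
  filter_upwards [ae_restrict_mem measurableSet_Ioc] with s hs i
  exact h.isWeakPartial_evol hγ hs.1 φ i

lemma memLp_evol_top (h : IsCoef γ M α β) (hγ : 0 < γ) (φ : L2 d) :
    MemLp (fun s => evol α β t s φ) ∞ (volume.restrict (Icc t T)) :=
  memLp_top_of_bound (((h.continuousOn_evol hγ.le t φ).mono Icc_subset_Ici_self).aestronglyMeasurable
    measurableSet_Icc) ‖φ‖ (by
      filter_upwards [ae_restrict_mem measurableSet_Icc] with s hs
      exact h.norm_evol_le hγ.le hs.1 φ)

lemma memL2W12_evol (h : IsCoef γ M α β) (hγ : 0 < γ) (htT : t ≤ T) (φ : L2 d) :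
    MemL2W12 t T (fun s => evol α β t s φ) := by
  refine ⟨(h.memLp_evol_top hγ φ).mono_exponent le_top, evolGrad α β t φ, fun i => ?_,
    h.ae_isWeakPartial_evol hγ φ⟩
  refine ⟨h.aestronglyMeasurable_evolGrad hγ φ i, ?_⟩
  have h1 : eLpNorm (evolGrad α β t φ i) 2 (volume.restrict (Icc t T)) ^ 2 < ⊤ := by
    rw [eLpNorm_sq]
    refine lt_of_le_of_lt ((lintegral_mono fun s => ?_).trans (h.lintegral_evolGrad_le hγ htT φ))
      (by finiteness)
    exact Finset.single_le_sum (f := fun i => ‖evolGrad α β t φ i s‖ₑ ^ 2)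
      (fun _ _ => zero_le) (Finset.mem_univ i)
  exact (ENNReal.pow_lt_top_iff.1 h1).resolve_right (by norm_num)

/-- T - t comes from integrating the contraction bound in time, 1/(2γ) from the gradient. -/
lemma enormL2W12_evol_le (h : IsCoef γ M α β) (hγ : 0 < γ) (htT : t ≤ T) (φ : L2 d) :
    enormL2W12 t T (fun s => evol α β t s φ)
      ≤ ENNReal.ofReal √(T - t + 1 / (2 * γ)) * ‖φ‖ₑ := by
  have h0 : 0 ≤ T - t := sub_nonneg.2 htT
  have hsq : ∫⁻ s in Icc t T, enormW12 (evol α β t s φ) ^ 2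
      ≤ (ENNReal.ofReal √(T - t + 1 / (2 * γ)) * ‖φ‖ₑ) ^ 2 := by
    calc _ ≤ ∫⁻ s in Icc t T, (‖φ‖ₑ ^ 2 + ∑ i, ‖evolGrad α β t φ i s‖ₑ ^ 2) := by
          refine lintegral_mono_ae ?_
          filter_upwards [h.ae_isWeakPartial_evol hγ φ, ae_restrict_mem measurableSet_Icc]
            with s hs hs'
          have h1 : enormW12 (evol α β t s φ) ≤
            (‖evol α β t s φ‖ₑ ^ 2 + ∑ i, ‖evolGrad α β t φ i s‖ₑ ^ 2) ^ (1 / 2 : ℝ) :=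
            iInf₂_le (fun i => evolGrad α β t φ i s) hs
          calc _ ≤ ((‖evol α β t s φ‖ₑ ^ 2 + ∑ i, ‖evolGrad α β t φ i s‖ₑ ^ 2) ^ (1 / 2 : ℝ)) ^ 2 := by
                gcongr
            _ = ‖evol α β t s φ‖ₑ ^ 2 + ∑ i, ‖evolGrad α β t φ i s‖ₑ ^ 2 := by
                rw [← ENNReal.rpow_natCast, ← ENNReal.rpow_mul]; norm_num
            _ ≤ _ := by gcongr; exact h.enorm_evol_le hγ.le hs'.1 φ
      _ = ‖φ‖ₑ ^ 2 * ENNReal.ofReal (T - t) + ∫⁻ s in Icc t T, ∑ i, ‖evolGrad α β t φ i s‖ₑ ^ 2 := by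
          rw [lintegral_add_left measurable_const, setLIntegral_const, Real.volume_Icc]
      _ ≤ ‖φ‖ₑ ^ 2 * ENNReal.ofReal (T - t) + ENNReal.ofReal (1 / (2 * γ)) * ‖φ‖ₑ ^ 2 := by
          gcongr; exact h.lintegral_evolGrad_le hγ htT φ
      _ = _ := by
          rw [mul_pow, ← ENNReal.ofReal_pow (Real.sqrt_nonneg _), Real.sq_sqrt (by positivity),
            ENNReal.ofReal_add h0 (by positivity)]
          ring
  calc _ ≤ ((ENNReal.ofReal √(T - t + 1 / (2 * γ)) * ‖φ‖ₑ) ^ 2) ^ (1 / 2 : ℝ) :=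
        ENNReal.rpow_le_rpow hsq (by norm_num)
    _ = _ := by rw [← ENNReal.rpow_natCast, ← ENNReal.rpow_mul]; norm_num

end IsCoef

/-- The constant in the difference estimate. -/
def diffConst (d : ℕ) (γ T : ℝ) : ℝ :=
  4 * Real.pi ^ 2 * d ^ 2 / √(decayRate γ) + 2 * Real.pi * d * √T

lemma diffConst_nonneg (d : ℕ) (γ T : ℝ) : 0 ≤ diffConst d γ T := by unfold diffConst; positivity

/-- One factor |ξ| is kept for the W^{1,2} norm. The remaining one in the second order term is
absorbed by the Gaussian; the first order term has none left and is put over √τ by √T/√τ ≥ 1. -/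
lemma exp_mul_symBound_le {γ τ T : ℝ} (hγ : 0 < γ) (hτ : 0 < τ) (hT : τ ≤ T) (ξ : E d) :
    Real.exp (-(decayRate γ * τ * ‖ξ‖ ^ 2)) * symBound ξ ≤ diffConst d γ T / √τ * ‖ξ‖ := by
  have hc := decayRate_pos hγ
  have h1 := mul_exp_neg_le (x := ‖ξ‖) (mul_pos hc hτ)
  have h2 : Real.exp (-(decayRate γ * τ * ‖ξ‖ ^ 2)) ≤ 1 :=
    Real.exp_le_one_iff.2 (neg_nonpos.2 (by positivity))
  have h3 : 1 ≤ √T / √τ := by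
    rw [one_le_div (Real.sqrt_pos.2 hτ)]; exact Real.sqrt_le_sqrt hT
  rw [Real.sqrt_mul hc.le] at h1
  calc _ = 4 * Real.pi ^ 2 * d ^ 2 * ‖ξ‖ * (‖ξ‖ * Real.exp (-(decayRate γ * τ * ‖ξ‖ ^ 2)))
        + 2 * Real.pi * d * ‖ξ‖ * Real.exp (-(decayRate γ * τ * ‖ξ‖ ^ 2)) := by
        unfold symBound; ring
    _ ≤ 4 * Real.pi ^ 2 * d ^ 2 * ‖ξ‖ * (1 / (√(decayRate γ) * √τ))
        + 2 * Real.pi * d * ‖ξ‖ * (√T / √τ) := by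
        gcongr
        exact h2.trans h3
    _ = _ := by
        unfold diffConst
        have := Real.sqrt_pos.2 hc
        have := Real.sqrt_pos.2 hτ
        field_simp

namespace IsCoef

variable {γ M : ℝ} {α α' : ℝ → Fin d → Fin d → ℝ} {β β' : ℝ → Fin d → ℝ} {t s T : ℝ}

/-- Dependence of the evolution on the coefficients. -/
lemma enorm_evol_sub_le (h : IsCoef γ M α β) (h' : IsCoef γ M α' β') (hγ : 0 < γ) (hts : t < s)
    (hsT : s - t ≤ T) {δ : ℝ} (hA : ∀ i j, |intA α t s i j - intA α' t s i j| ≤ δ)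
    (hB : ∀ i, |intB β t s i - intB β' t s i| ≤ δ) (hδ : 0 ≤ δ) (φ : L2 d) :
    ‖evol α β t s φ - evol α' β' t s φ‖ₑ
      ≤ ENNReal.ofReal (diffConst d γ T / √(s - t) * δ) * enormW12 φ := by
  have hK := diffConst_nonneg d γ T
  have hτ : 0 < s - t := sub_pos.2 hts
  -- Both exponents have real part at least 4π²γ(s-t)|ξ|², so the difference of exponentials keeps
  -- the Gaussian factor.
  have hpt : ∀ ξ : E d, ‖mult α β t s ξ - mult α' β' t s ξ‖
      ≤ diffConst d γ T / √(s - t) * δ * ‖ξ‖ := by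
    intro ξ
    refine (norm_exp_neg_sub_le (h.sym_re_ge hts.le ξ) (h'.sym_re_ge hts.le ξ)).trans ?_
    rw [sym_sub]
    calc _ ≤ Real.exp (-(4 * Real.pi ^ 2 * γ * (s - t) * ‖ξ‖ ^ 2)) * (δ * symBound ξ) := by
          gcongr
          exact FokkerPlanck.norm_sym_le hA hB ξ
      _ = δ * (Real.exp (-(decayRate γ * (s - t) * ‖ξ‖ ^ 2)) * symBound ξ) := by
          unfold decayRate; ring
      _ ≤ δ * (diffConst d γ T / √(s - t) * ‖ξ‖) := by
          exact mul_le_mul_of_nonneg_left (exp_mul_symBound_le hγ hτ hsT ξ) hδ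
      _ = _ := by ring
  have hsq : ‖evol α β t s φ - evol α' β' t s φ‖ₑ ^ 2
      ≤ (ENNReal.ofReal (diffConst d γ T / √(s - t) * δ) * enormW12 φ) ^ 2 := by
    rw [evol, evol, ← map_sub]
    calc _ ≤ ‖symb (mult α β t s) (ft φ) - symb (mult α' β' t s) (ft φ)‖ₑ ^ 2 := by
          gcongr; exact enorm_ift_le _
      _ = ∫⁻ ξ, ‖(mult α β t s ξ - mult α' β' t s ξ) * ft φ ξ‖ₑ ^ 2 := by
          rw [enorm_sq_Lp]
          refine lintegral_congr_ae ?_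
          filter_upwards [Lp.coeFn_sub (symb (mult α β t s) (ft φ)) (symb (mult α' β' t s) (ft φ)),
            coeFn_symb (h.memLp_mult hγ.le hts.le (ft φ)),
            coeFn_symb (h'.memLp_mult hγ.le hts.le (ft φ))] with ξ h1 h2 h3
          rw [h1, Pi.sub_apply, h2, h3, sub_mul]
      _ ≤ ∫⁻ ξ, ENNReal.ofReal (diffConst d γ T / √(s - t) * δ) ^ 2 * (‖ξ‖ₑ ^ 2 * ‖ft φ ξ‖ₑ ^ 2) := by
          refine lintegral_mono fun ξ => ?_
          have hpt' : ‖mult α β t s ξ - mult α' β' t s ξ‖ₑ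
              ≤ ENNReal.ofReal (diffConst d γ T / √(s - t) * δ) * ‖ξ‖ₑ := by
            rw [← ofReal_norm, ← ofReal_norm, ← ENNReal.ofReal_mul (by positivity)]
            exact ENNReal.ofReal_le_ofReal (hpt ξ)
          rw [enorm_mul, mul_pow, ← mul_assoc]
          exact mul_le_mul_left ((pow_le_pow_left' hpt' 2).trans_eq (mul_pow _ _ _)) _
      _ = ENNReal.ofReal (diffConst d γ T / √(s - t) * δ) ^ 2 * gradSq φ := by
          rw [lintegral_const_mul'', gradSq]
          exact (by fun_prop : AEMeasurable (fun ξ : E d => ‖ξ‖ₑ ^ 2)).mul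
            ((Lp.aestronglyMeasurable (ft φ)).enorm.pow_const 2)
      _ ≤ _ := by rw [mul_pow]; gcongr; exact gradSq_le φ
  exact (ENNReal.pow_le_pow_left_iff two_ne_zero).1 hsq

end IsCoef

end

/-! ### The time derivative of the evolution. -/

section

open Filter Topology
open scoped SchwartzMap

variable {d : ℕ}

/-- The pairing with a square-integrable function as a continuous linear functional. -/
def testPair {ψ : E d → ℝ} (h : MemLp ψ 2 (volume : Measure (E d))) : L2 d →L[ℝ] ℝ :=
  innerSL ℝ h.toLp

lemma testPair_apply {ψ : E d → ℝ} (h : MemLp ψ 2 (volume : Measure (E d))) (u : L2 d) :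
    testPair h u = ∫ x, u x * ψ x := by
  rw [testPair, innerSL_apply_apply, L2.inner_def]
  refine integral_congr_ae ?_
  filter_upwards [h.coeFn_toLp] with x hx
  simp [hx]

/-- The Fourier transform of the time derivative of the evolution. -/
def evolDotHat (α : ℝ → Fin d → Fin d → ℝ) (β : ℝ → Fin d → ℝ) (t : ℝ) (f : CL2 d) (s : ℝ) :
    CL2 d :=
  (∑ i, ∑ j, (α s i j : ℂ) • symb (fun ξ => coordI i ξ * coordI j ξ * mult α β t s ξ) f)
    - ∑ i, (β s i : ℂ) • symb (fun ξ => coordI i ξ * mult α β t s ξ) f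

/-- The time derivative of the evolution. -/
def evolDot (α : ℝ → Fin d → Fin d → ℝ) (β : ℝ → Fin d → ℝ) (t : ℝ) (φ : L2 d) (s : ℝ) : L2 d :=
  ift d (evolDotHat α β t (ft φ) s)

/-- The square of the constant in the estimate of the time derivative. -/
def dotConst (d : ℕ) (γ M T : ℝ) : ℝ :=
  2 * M ^ 2 * ((4 * Real.pi ^ 2 * d ^ 2) ^ 2 * (1 / (2 * decayRate γ)) + (2 * Real.pi * d) ^ 2 * T)

namespace IsCoef

variable {γ M : ℝ} {α α' : ℝ → Fin d → Fin d → ℝ} {β β' : ℝ → Fin d → ℝ} {t s T : ℝ}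

/-- `evolDotHat` is split coefficient by coefficient for the sake of measurability in time. Here the
pieces are recombined into the symbol. -/
lemma coeFn_evolDotHat (h : IsCoef γ M α β) (hγ : 0 < γ) (hts : t < s) (f : CL2 d) :
    ⇑(evolDotHat α β t f s) =ᵐ[volume] fun ξ => -sym (α s) (β s) ξ * mult α β t s ξ * f ξ := by
  have h1 : ∀ᵐ ξ, ∀ i j : Fin d,
      ((α s i j : ℂ) • symb (fun ξ => coordI i ξ * coordI j ξ * mult α β t s ξ) f : CL2 d) ξ
        = α s i j * (coordI i ξ * coordI j ξ * mult α β t s ξ * f ξ) := by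
    rw [ae_all_iff]; intro i
    rw [ae_all_iff]; intro j
    filter_upwards [Lp.coeFn_smul (α s i j : ℂ)
      (symb (fun ξ => coordI i ξ * coordI j ξ * mult α β t s ξ) f),
      coeFn_symb (h.memLp_mul_mult hγ (gaussBdd_coordI_mul i j) hts f)] with ξ h1 h2
    rw [h1, Pi.smul_apply, h2, smul_eq_mul]
  have h2 : ∀ᵐ ξ, ∀ i : Fin d,
      ((β s i : ℂ) • symb (fun ξ => coordI i ξ * mult α β t s ξ) f : CL2 d) ξ
        = β s i * (coordI i ξ * mult α β t s ξ * f ξ) := by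
    rw [ae_all_iff]; intro i
    filter_upwards [Lp.coeFn_smul (β s i : ℂ)
      (symb (fun ξ => coordI i ξ * mult α β t s ξ) f),
      coeFn_symb (h.memLp_mul_mult hγ (gaussBdd_coordI i) hts f)] with ξ h1 h2
    rw [h1, Pi.smul_apply, h2, smul_eq_mul]
  have h3 : ∀ᵐ ξ, ∀ i : Fin d,
      (∑ j, (α s i j : ℂ) • symb (fun ξ => coordI i ξ * coordI j ξ * mult α β t s ξ) f : CL2 d) ξ
      = ∑ j, ((α s i j : ℂ) • symb (fun ξ => coordI i ξ * coordI j ξ * mult α β t s ξ) f : CL2 d) ξ :=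
    ae_all_iff.2 fun i => coeFn_finset_sum _ _
  unfold evolDotHat
  filter_upwards [h1, h2, h3, Lp.coeFn_sub
      (∑ i, ∑ j, (α s i j : ℂ) • symb (fun ξ => coordI i ξ * coordI j ξ * mult α β t s ξ) f)
      (∑ i, (β s i : ℂ) • symb (fun ξ => coordI i ξ * mult α β t s ξ) f),
    coeFn_finset_sum Finset.univ
      (fun i => ∑ j, (α s i j : ℂ) • symb (fun ξ => coordI i ξ * coordI j ξ * mult α β t s ξ) f),
    coeFn_finset_sum Finset.univ
      (fun i => (β s i : ℂ) • symb (fun ξ => coordI i ξ * mult α β t s ξ) f)]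
    with ξ h1 h2 h3 h4 h5 h6
  rw [h4, Pi.sub_apply, h5, h6, sym_eq_coordI]
  simp only [h3, h1, h2]
  simp only [neg_add, neg_neg, add_mul, neg_mul, Finset.sum_mul]
  rw [sub_eq_add_neg]
  congr 1
  · exact Finset.sum_congr rfl fun i _ => Finset.sum_congr rfl fun j _ => by ring
  · congr 1
    exact Finset.sum_congr rfl fun i _ => by ring

lemma aestronglyMeasurable_evolDot (h : IsCoef γ M α β) (hγ : 0 < γ) (φ : L2 d) :
    AEStronglyMeasurable (evolDot α β t φ) (volume.restrict (Icc t T)) := by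
  refine (ift d).continuous.comp_aestronglyMeasurable (AEStronglyMeasurable.sub ?_ ?_)
  · refine Finset.aestronglyMeasurable_fun_sum _ fun i _ =>
      Finset.aestronglyMeasurable_fun_sum _ fun j _ => ?_
    exact (Complex.continuous_ofReal.comp_aestronglyMeasurable (h.meas_α_apply i j).restrict).smul
      (h.aestronglyMeasurable_symb_mul_mult hγ (gaussBdd_coordI_mul i j) t T (ft φ))
  · refine Finset.aestronglyMeasurable_fun_sum _ fun i _ => ?_
    exact (Complex.continuous_ofReal.comp_aestronglyMeasurable (h.meas_β_apply i).restrict).smul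
      (h.aestronglyMeasurable_symb_mul_mult hγ (gaussBdd_coordI i) t T (ft φ))

/-- The squared symbol grows like |ξ|⁴ + |ξ|². A factor |ξ|² is set aside for `gradSq`; what remains
is |ξ|² times a squared Gaussian, integrable in time uniformly in ξ, plus a constant. -/
lemma enorm_evolDot_le (h : IsCoef γ M α β) (hγ : 0 < γ) (hts : t < s) (φ : L2 d) :
    ‖evolDot α β t φ s‖ₑ ^ 2 ≤ ∫⁻ ξ, ENNReal.ofReal (2 * M ^ 2 * ((4 * Real.pi ^ 2 * d ^ 2) ^ 2 *
      (‖ξ‖ ^ 2 * Real.exp (-(decayRate γ * (s - t) * ‖ξ‖ ^ 2)) ^ 2) + (2 * Real.pi * d) ^ 2))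
      * (‖ξ‖ₑ ^ 2 * ‖ft φ ξ‖ₑ ^ 2) := by
  refine le_trans (pow_le_pow_left' (enorm_ift_le _) 2) ?_
  rw [enorm_sq_Lp]
  refine lintegral_mono_ae ?_
  filter_upwards [h.coeFn_evolDotHat hγ hts (ft φ)] with ξ hξ
  rw [hξ, enorm_mul, mul_pow, ← mul_assoc]
  refine mul_le_mul_left ?_ _
  rw [enorm_sq_eq_ofReal, enorm_sq_eq_ofReal, ← ENNReal.ofReal_mul (by positivity)]
  refine ENNReal.ofReal_le_ofReal ?_
  rw [norm_mul, norm_neg]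
  set e := Real.exp (-(decayRate γ * (s - t) * ‖ξ‖ ^ 2)) with he
  have he0 : 0 < e := Real.exp_pos _
  have he1 : e ≤ 1 := by
    refine Real.exp_le_one_iff.2 (neg_nonpos.2 ?_)
    have := decayRate_pos hγ
    have : 0 ≤ s - t := by linarith
    positivity
  have h1 : ‖sym (α s) (β s) ξ‖ * ‖mult α β t s ξ‖ ≤ M * symBound ξ * e :=
    mul_le_mul (h.norm_sym_le s ξ) (h.norm_mult_le' hts.le ξ) (norm_nonneg _)
      ((norm_nonneg _).trans (h.norm_sym_le s ξ))
  have h0 : 0 ≤ ‖sym (α s) (β s) ξ‖ * ‖mult α β t s ξ‖ := by positivity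
  refine (pow_le_pow_left₀ h0 h1 2).trans ?_
  unfold symBound
  set a := 4 * Real.pi ^ 2 * (d : ℝ) ^ 2
  set b := 2 * Real.pi * (d : ℝ)
  have h2 : (a * ‖ξ‖ ^ 2 + b * ‖ξ‖) ^ 2 ≤ 2 * ((a * ‖ξ‖ ^ 2) ^ 2 + (b * ‖ξ‖) ^ 2) := by
    nlinarith [sq_nonneg (a * ‖ξ‖ ^ 2 - b * ‖ξ‖)]
  have h3 : e ^ 2 ≤ 1 := pow_le_one₀ he0.le he1
  calc (M * (a * ‖ξ‖ ^ 2 + b * ‖ξ‖) * e) ^ 2 = M ^ 2 * e ^ 2 * (a * ‖ξ‖ ^ 2 + b * ‖ξ‖) ^ 2 := by ring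
    _ ≤ M ^ 2 * e ^ 2 * (2 * ((a * ‖ξ‖ ^ 2) ^ 2 + (b * ‖ξ‖) ^ 2)) := by gcongr
    _ = 2 * M ^ 2 * (a ^ 2 * (‖ξ‖ ^ 2 * e ^ 2) + b ^ 2 * e ^ 2) * ‖ξ‖ ^ 2 := by ring
    _ ≤ 2 * M ^ 2 * (a ^ 2 * (‖ξ‖ ^ 2 * e ^ 2) + b ^ 2 * 1) * ‖ξ‖ ^ 2 := by gcongr
    _ = _ := by ring

lemma lintegral_evolDot_le (h : IsCoef γ M α β) (hγ : 0 < γ) (htT : t ≤ T) (φ : L2 d) :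
    ∫⁻ s in Icc t T, ‖evolDot α β t φ s‖ₑ ^ 2
      ≤ ENNReal.ofReal (dotConst d γ M (T - t)) * gradSq φ := by
  have hc := decayRate_pos hγ
  have h0 : 0 ≤ T - t := sub_nonneg.2 htT
  set a := 4 * Real.pi ^ 2 * (d : ℝ) ^ 2 with ha
  set b := 2 * Real.pi * (d : ℝ) with hb
  let F : ℝ → E d → ℝ := fun s ξ => 2 * M ^ 2 * (a ^ 2 *
      (‖ξ‖ ^ 2 * Real.exp (-(decayRate γ * (s - t) * ‖ξ‖ ^ 2)) ^ 2) + b ^ 2)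
  have hF : Continuous fun p : ℝ × E d => F p.1 p.2 := by
    simp only [F]; fun_prop
  have hm : AEMeasurable (fun ξ : E d => ‖ξ‖ₑ ^ 2 * ‖ft φ ξ‖ₑ ^ 2) :=
    (by fun_prop : AEMeasurable (fun ξ : E d => ‖ξ‖ₑ ^ 2)).mul
      ((Lp.aestronglyMeasurable (ft φ)).enorm.pow_const 2)
  calc ∫⁻ s in Icc t T, ‖evolDot α β t φ s‖ₑ ^ 2
      ≤ ∫⁻ s in Icc t T, ∫⁻ ξ, ENNReal.ofReal (F s ξ) * (‖ξ‖ₑ ^ 2 * ‖ft φ ξ‖ₑ ^ 2) := by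
        rw [← restrict_Ioc_eq_restrict_Icc]
        exact setLIntegral_mono_ae' measurableSet_Ioc
          (.of_forall fun s hs => h.enorm_evolDot_le hγ hs.1 φ)
    _ = ∫⁻ ξ, ∫⁻ s in Icc t T, ENNReal.ofReal (F s ξ) * (‖ξ‖ₑ ^ 2 * ‖ft φ ξ‖ₑ ^ 2) := by
        refine lintegral_lintegral_swap ?_
        exact AEMeasurable.mul hF.measurable.ennreal_ofReal.aemeasurable (AEMeasurable.comp_snd hm)
    _ ≤ ∫⁻ ξ, ENNReal.ofReal (dotConst d γ M (T - t)) * (‖ξ‖ₑ ^ 2 * ‖ft φ ξ‖ₑ ^ 2) := by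
        refine lintegral_mono fun ξ => ?_
        have hm1 : Measurable fun s : ℝ => ENNReal.ofReal (F s ξ) :=
          Measurable.ennreal_ofReal (Continuous.measurable
            (Continuous.comp hF (f := fun s => (s, ξ)) (by fun_prop)))
        rw [lintegral_mul_const _ hm1]
        refine mul_le_mul_left ?_ _
        have hm2 : Measurable fun s : ℝ => ENNReal.ofReal (‖ξ‖ ^ 2 *
            Real.exp (-(decayRate γ * (s - t) * ‖ξ‖ ^ 2)) ^ 2) := by fun_prop
        have e1 : ∀ s, ENNReal.ofReal (F s ξ) = ENNReal.ofReal (2 * M ^ 2 * a ^ 2) *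
            ENNReal.ofReal (‖ξ‖ ^ 2 * Real.exp (-(decayRate γ * (s - t) * ‖ξ‖ ^ 2)) ^ 2)
            + ENNReal.ofReal (2 * M ^ 2 * b ^ 2) := by
          intro s
          rw [← ENNReal.ofReal_mul (by positivity), ← ENNReal.ofReal_add (by positivity)
            (by positivity)]
          congr 1; simp only [F]; ring
        simp only [e1]
        rw [lintegral_add_right _ measurable_const, lintegral_const_mul _ hm2, setLIntegral_const,
          Real.volume_Icc]
        calc _ ≤ ENNReal.ofReal (2 * M ^ 2 * a ^ 2) * ENNReal.ofReal (1 / (2 * decayRate γ))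
              + ENNReal.ofReal (2 * M ^ 2 * b ^ 2) * ENNReal.ofReal (T - t) := by
              gcongr
              exact lintegral_sq_mul_exp_le hc htT
          _ = _ := by
              rw [← ENNReal.ofReal_mul (by positivity), ← ENNReal.ofReal_mul (by positivity),
                ← ENNReal.ofReal_add (by positivity) (by positivity)]
              congr 1
              unfold dotConst
              ring
    _ = _ := by rw [lintegral_const_mul'' _ hm, gradSq]

lemma eLpNorm_evolDot_le (h : IsCoef γ M α β) (hγ : 0 < γ) (htT : t ≤ T) (φ : L2 d) :
    eLpNorm (evolDot α β t φ) 2 (volume.restrict (Icc t T))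
      ≤ ENNReal.ofReal √(dotConst d γ M (T - t)) * enormW12 φ := by
  have h0 : 0 ≤ T - t := sub_nonneg.2 htT
  have hc := decayRate_pos hγ
  refine (ENNReal.pow_le_pow_left_iff two_ne_zero).1 ?_
  rw [eLpNorm_sq, mul_pow, ← ENNReal.ofReal_pow (Real.sqrt_nonneg _),
    Real.sq_sqrt (by unfold dotConst; positivity)]
  refine (h.lintegral_evolDot_le hγ htT φ).trans ?_
  gcongr
  exact gradSq_le φ

lemma memLp_evolDot (h : IsCoef γ M α β) (hγ : 0 < γ) (htT : t ≤ T) {φ : L2 d} (hφ : MemW12 φ) :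
    MemLp (evolDot α β t φ) 2 (volume.restrict (Icc t T)) :=
  ⟨h.aestronglyMeasurable_evolDot hγ φ, (h.eLpNorm_evolDot_le hγ htT φ).trans_lt
    (ENNReal.mul_lt_top ENNReal.ofReal_lt_top (enormW12_lt_top hφ))⟩

lemma integral_evolDot_mul (h : IsCoef γ M α β) (hγ : 0 < γ) (hts : t < s) (φ : L2 d)
    {ψ : E d → ℝ} (hψ : IsTest ψ) :
    ∫ x, evolDot α β t φ s x * ψ x = ∫ x, evol α β t s φ x * ellOp (α s) (β s) ψ x := by
  rw [h.integral_evol_mul hγ.le hts.le φ (hψ.ellOp (α s) (β s)), evolDot,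
    integral_ift_mul _ ψ hψ]
  congr 1
  refine integral_congr_ae ?_
  filter_upwards [h.coeFn_evolDotHat hγ hts (ft φ)] with ξ hξ
  rw [hξ, chk_ellOp hψ]; ring

/-- The evolution of a function in `W^{1,2}` is differentiable in time. -/
lemma isTimeDeriv_evol (h : IsCoef γ M α β) (hγ : 0 < γ) (htT : t ≤ T) {φ : L2 d}
    (hφ : MemW12 φ) : IsTimeDeriv t T (fun s => evol α β t s φ) (evolDot α β t φ) := by
  have hm := h.memLp_evolDot hγ htT hφ
  refine ⟨hm, fun s hs => ?_⟩
  have hint : IntervalIntegrable (evolDot α β t φ) volume t s := by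
    rw [intervalIntegrable_iff_integrableOn_Icc_of_le hs.1]
    exact (hm.integrable (by norm_num)).mono_measure
      (Measure.restrict_mono (Icc_subset_Icc_right hs.2) le_rfl)
  -- Tested against `ψ`, the identity between elements of L² is the weak form of the equation,
  -- because the Bochner integral commutes with the pairing.
  refine L2_ext_test fun ψ hψ => ?_
  have hψ2 := memLp_testSchwartz ψ hψ
  simp only [← testPair_apply hψ2]
  rw [map_add, ← ContinuousLinearMap.intervalIntegral_comp_comm _ hint]
  simp only [testPair_apply hψ2, evol_self]
  rw [h.evol_weak hγ.le hs.1 φ hψ]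
  congr 1
  refine intervalIntegral.integral_congr_ae ?_
  rw [uIoc_of_le hs.1]
  exact .of_forall fun r hr => (h.integral_evolDot_mul hγ hr.1 φ hψ).symm

end IsCoef

end

/-! ### A singular Grönwall inequality and second order weak identities on the Fourier side. -/

section

open FourierTransform Filter Topology
open scoped SchwartzMap LineDeriv

variable {d : ℕ}

lemma one_sub_exp_neg_le_sqrt {y : ℝ} (hy : 0 ≤ y) : 1 - Real.exp (-y) ≤ √y := by
  rcases le_total y 1 with h | h
  · have h1 := Real.add_one_le_exp (-y)
    have h2 : y ≤ √y := Real.le_sqrt_of_sq_le (by nlinarith)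
    linarith
  · have h1 := Real.exp_pos (-y)
    have h2 : 1 ≤ √y := Real.one_le_sqrt.2 h
    linarith

/-- The integral equals e^{lτ}(1 - e^{-lτ})/l with τ = s - t, and 1 - e^{-y} ≤ √y at y = lτ cancels
the singularity 1/√τ. The gain 1/√l makes the singular kernel small for large weights. -/
lemma integral_exp_weight_le {l t s : ℝ} (hl : 0 < l) (hts : t < s) :
    1 / √(s - t) * ∫ r in t..s, Real.exp (l * (r - t)) ≤ Real.exp (l * (s - t)) / √l := by
  have hτ : 0 < s - t := sub_pos.2 hts
  have hderiv : ∀ r ∈ uIcc t s, HasDerivAt (fun r => Real.exp (l * (r - t)) / l)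
      (Real.exp (l * (r - t))) r := by
    intro r _
    have h1 : HasDerivAt (fun r => l * (r - t)) (l * 1) r :=
      ((hasDerivAt_id r).sub_const t).const_mul l
    convert! h1.exp.div_const l using 1
    field_simp
  rw [intervalIntegral.integral_eq_sub_of_hasDerivAt hderiv
    (Continuous.intervalIntegrable (by fun_prop) _ _)]
  have h := one_sub_exp_neg_le_sqrt (mul_pos hl hτ).le
  rw [Real.sqrt_mul hl.le] at h
  have hsl := Real.sqrt_pos.2 hl
  have hst := Real.sqrt_pos.2 hτ
  have hl2 : √l * √l = l := Real.mul_self_sqrt hl.le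
  have he := Real.exp_pos (l * (s - t))
  have hmul : Real.exp (l * (s - t)) - 1 ≤ Real.exp (l * (s - t)) * (√l * √(s - t)) := by
    have := mul_le_mul_of_nonneg_left h he.le
    rw [mul_sub, ← Real.exp_add, mul_one, add_neg_cancel, Real.exp_zero] at this
    exact this
  simp only [sub_self, mul_zero, Real.exp_zero]
  rw [div_mul_eq_mul_div, one_mul, ← sub_div, div_div, div_le_div_iff₀ (by positivity) hsl]
  calc (Real.exp (l * (s - t)) - 1) * √l
      ≤ Real.exp (l * (s - t)) * (√l * √(s - t)) * √l := by gcongr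
    _ = Real.exp (l * (s - t)) * ((√l * √l) * √(s - t)) := by ring
    _ = _ := by rw [hl2]

/-- Grönwall's inequality with an integrable singularity. -/
lemma gronwall_sqrt {D : ℝ → ℝ} {t T c κ S₀ : ℝ} (htT : t ≤ T) (hκ : 0 ≤ κ) (hc : 0 ≤ c)
    (hD : ∀ s ∈ Icc t T, 0 ≤ D s) (hb : ∀ s ∈ Icc t T, D s ≤ S₀)
    (hi : IntervalIntegrable D volume t T) (ht : D t ≤ c)
    (h : ∀ s ∈ Ioc t T, D s ≤ c + κ / √(s - t) * ∫ r in t..s, D r) :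
    ∀ s ∈ Icc t T, D s ≤ 2 * c * Real.exp ((2 * κ + 1) ^ 2 * (s - t)) := by
  -- Chosen so that √l = 2κ + 1 and hence κ/√l ≤ 1/2.
  set l := (2 * κ + 1) ^ 2 with hl
  have hlpos : 0 < l := by positivity
  have hsl : √l = 2 * κ + 1 := Real.sqrt_sq (by positivity)
  let U : Set ℝ := (fun s => Real.exp (-(l * (s - t))) * D s) '' Icc t T
  have hUb : BddAbove U := by
    refine ⟨S₀, ?_⟩
    rintro _ ⟨s, hs, rfl⟩
    refine (mul_le_of_le_one_left (hD s hs) ?_).trans (hb s hs)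
    refine Real.exp_le_one_iff.2 (neg_nonpos.2 ?_)
    have : 0 ≤ s - t := sub_nonneg.2 hs.1
    positivity
  have hUn : U.Nonempty := ⟨_, t, left_mem_Icc.2 htT, rfl⟩
  set S := sSup U with hS
  have hle : ∀ s ∈ Icc t T, D s ≤ S * Real.exp (l * (s - t)) := by
    intro s hs
    have h1 : Real.exp (-(l * (s - t))) * D s ≤ S := le_csSup hUb ⟨s, hs, rfl⟩
    have := mul_le_mul_of_nonneg_right h1 (Real.exp_pos (l * (s - t))).le
    rwa [mul_right_comm, ← Real.exp_add, neg_add_cancel, Real.exp_zero, one_mul] at this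
  have hS0 : 0 ≤ S := by
    have := (hD t (left_mem_Icc.2 htT)).trans (hle t (left_mem_Icc.2 htT))
    simpa using this
  -- The weighted supremum reproduces itself with factor 1/2. It is finite by the a priori bound
  -- `S₀`, so it can be absorbed, giving S ≤ 2c.
  have hS2 : S ≤ c + S / 2 := by
    refine csSup_le hUn ?_
    rintro _ ⟨s, hs, rfl⟩
    rcases eq_or_lt_of_le hs.1 with rfl | hts
    · simp only [sub_self, mul_zero, neg_zero, Real.exp_zero, one_mul]; linarith
    · have h1 := h s ⟨hts, hs.2⟩
      have h2 : ∫ r in t..s, D r ≤ ∫ r in t..s, S * Real.exp (l * (r - t)) := by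
        refine intervalIntegral.integral_mono_on hts.le
          (hi.mono_set (by rw [uIcc_of_le hts.le, uIcc_of_le htT]; exact Icc_subset_Icc_right hs.2))
          (Continuous.intervalIntegrable (by fun_prop) _ _) fun r hr =>
            hle r ⟨hr.1, hr.2.trans hs.2⟩
      rw [intervalIntegral.integral_const_mul] at h2
      have h3 := integral_exp_weight_le hlpos hts
      have h4 : κ / √(s - t) * ∫ r in t..s, D r ≤ κ * S * (Real.exp (l * (s - t)) / √l) := by
        calc _ ≤ κ / √(s - t) * (S * ∫ r in t..s, Real.exp (l * (r - t))) := by gcongr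
          _ = κ * S * (1 / √(s - t) * ∫ r in t..s, Real.exp (l * (r - t))) := by ring
          _ ≤ _ := by gcongr
      have h5 : κ / √l ≤ 1 / 2 := by
        rw [hsl, div_le_div_iff₀ (by positivity) two_pos]; linarith
      have he1 : Real.exp (-(l * (s - t))) ≤ 1 := by
        refine Real.exp_le_one_iff.2 (neg_nonpos.2 ?_)
        have : 0 ≤ s - t := sub_nonneg.2 hs.1
        positivity
      calc Real.exp (-(l * (s - t))) * D s
          ≤ Real.exp (-(l * (s - t))) * (c + κ * S * (Real.exp (l * (s - t)) / √l)) := by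
            gcongr; linarith
        _ = Real.exp (-(l * (s - t))) * c
            + κ / √l * S * (Real.exp (-(l * (s - t))) * Real.exp (l * (s - t))) := by ring
        _ = Real.exp (-(l * (s - t))) * c + κ / √l * S := by
            rw [← Real.exp_add, neg_add_cancel, Real.exp_zero, mul_one]
        _ ≤ 1 * c + 1 / 2 * S := by gcongr
        _ = _ := by ring
  intro s hs
  refine (hle s hs).trans ?_
  gcongr
  linarith

/-- A distributional identity with derivatives up to order two, on the Fourier side. -/
lemma ft_eq_of_weak {w : L2 d} {W : Fin d → Fin d → L2 d} {V : Fin d → L2 d}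
    (h : ∀ ψ : E d → ℝ, IsTest ψ → ∫ x, w x * ψ x =
      (∑ i, ∑ j, ∫ x, W i j x * partialDeriv i (partialDeriv j ψ) x)
        + ∑ i, ∫ x, V i x * partialDeriv i ψ x) :
    ∀ᵐ ξ, ft w ξ = (∑ i, ∑ j, coordI i ξ * coordI j ξ * ft (W i j) ξ)
      - ∑ i, coordI i ξ * ft (V i) ξ := by
  -- The identity must reach Schwartz functions before it can be tested against Fourier transforms.
  have hS : ∀ φ : 𝓢(E d, ℝ), ∫ x, w x * φ x =
      (∑ i, ∑ j, ∫ x, W i j x * partialDeriv i (partialDeriv j φ) x)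
        + ∑ i, ∫ x, V i x * partialDeriv i φ x := by
    intro φ
    obtain ⟨ψ, G, hG, ht, hb, hl⟩ := exists_isTest_approx φ
    have l1 := tendsto_integral_mul_of_dominated w hG (fun n => (ht n).1.continuous)
      (fun n x => (hb n x).1) (fun x => (hl x).mono fun n hn => hn.1)
    have l2 := fun i => tendsto_integral_mul_of_dominated (V i) hG
      (fun n => ((ht n).partialDeriv i).1.continuous)
      (fun n x => (hb n x).2.1 i) (fun x => (hl x).mono fun n hn => hn.2.1 i)
    have l3 := fun i j => tendsto_integral_mul_of_dominated (W i j) hG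
      (fun n => (((ht n).partialDeriv j).partialDeriv i).1.continuous)
      (fun n x => (hb n x).2.2 i j) (fun x => (hl x).mono fun n hn => hn.2.2 i j)
    refine tendsto_nhds_unique l1 ?_
    refine Tendsto.congr (fun n => (h _ (ht n)).symm) (Tendsto.add ?_ ?_)
    · exact tendsto_finsetSum _ fun i _ => tendsto_finsetSum _ fun j _ => l3 i j
    · exact tendsto_finsetSum _ fun i _ => l2 i
  have key : ∀ Ψ : 𝓢(E d, ℂ), ∫ ξ, ft w ξ * Ψ ξ =
      (∑ i, ∑ j, ∫ ξ, ft (W i j) ξ * mulCoord i (mulCoord j Ψ) ξ)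
        - ∑ i, ∫ ξ, ft (V i) ξ * mulCoord i Ψ ξ := by
    intro Ψ
    have h1 := hS (schwartzRe (𝓕 Ψ))
    have h2 := hS (schwartzIm (𝓕 Ψ))
    have d2 : ∀ i j, (∂_{EuclideanSpace.single i (1 : ℝ)}
        (∂_{EuclideanSpace.single j (1 : ℝ)} (𝓕 Ψ)) : 𝓢(E d, ℂ))
        = 𝓕 (mulCoord i (mulCoord j Ψ)) := by
      intro i j
      rw [lineDeriv_fourier, LineDeriv.lineDerivOp_neg, lineDeriv_fourier, neg_neg]
    simp only [partialDeriv_schwartzRe, d2] at h1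
    simp only [partialDeriv_schwartzIm, d2] at h2
    simp only [lineDeriv_fourier] at h1 h2
    have e1 : ∀ i x, schwartzRe (-𝓕 (mulCoord i Ψ)) x = -schwartzRe (𝓕 (mulCoord i Ψ)) x :=
      fun i x => by simp
    have e2 : ∀ i x, schwartzIm (-𝓕 (mulCoord i Ψ)) x = -schwartzIm (𝓕 (mulCoord i Ψ)) x :=
      fun i x => by simp
    simp only [e1, mul_neg, integral_neg, Finset.sum_neg_distrib] at h1
    simp only [e2, mul_neg, integral_neg, Finset.sum_neg_distrib] at h2
    simp only [integral_ft_mul, integral_cplx_mul]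
    rw [h1, h2]
    push_cast
    simp only [Finset.sum_add_distrib, ← Finset.mul_sum]
    ring
  have hloc : ∀ (p : E d → ℂ) (u : L2 d), Continuous p →
      LocallyIntegrable (fun ξ => p ξ * ft u ξ) volume := by
    intro p u hp
    have := (locallyIntegrable_CL2 (ft u))
    rw [← locallyIntegrableOn_univ] at this ⊢
    exact this.continuousOn_mul hp.continuousOn isOpen_univ.isLocallyClosed
  have cc := fun i => continuous_coordI (d := d) i
  refine ae_eq_of_integral_contDiff_smul_eq (locallyIntegrable_CL2 _) ?_ fun g hg hc => ?_
  · refine LocallyIntegrable.sub ?_ ?_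
    · exact locallyIntegrable_finsetSum _ fun i _ => locallyIntegrable_finsetSum _ fun j _ =>
        hloc _ _ ((cc i).mul (cc j))
    · exact locallyIntegrable_finsetSum _ fun i _ => hloc _ _ (cc i)
  · have h0 := key (testSchwartz g ⟨hg, hc⟩)
    have hT : ∀ ξ, testSchwartz g ⟨hg, hc⟩ ξ = (g ξ : ℂ) := fun _ => rfl
    simp only [mulCoord_apply] at h0
    have hcoord : ∀ (i : Fin d) (ξ : E d), 2 * (Real.pi : ℂ) * Complex.I * ξ i = coordI i ξ :=
      fun _ _ => rfl
    simp only [hcoord, hT] at h0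
    have hint : ∀ (p : E d → ℂ) (u : L2 d), Continuous p →
        Integrable (fun ξ => ft u ξ * (p ξ * g ξ)) := fun p u hp =>
      integrable_mul_of_memLp _ ((hp.mul (Complex.continuous_ofReal.comp hg.continuous)).memLp_of_hasCompactSupport
        ((hc.comp_left Complex.ofReal_zero).mul_left (f := p)))
    calc ∫ x, g x • ft w x = ∫ x, ft w x * (g x : ℂ) := by
          simp only [Complex.real_smul, mul_comm]
      _ = _ := h0
      _ = ∫ ξ, ((∑ i, ∑ j, ft (W i j) ξ * (coordI i ξ * coordI j ξ * g ξ))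
            - ∑ i, ft (V i) ξ * (coordI i ξ * g ξ)) := by
          rw [integral_sub, integral_finsetSum, integral_finsetSum]
          · congr 1
            refine Finset.sum_congr rfl fun i _ => ?_
            rw [integral_finsetSum]
            · exact Finset.sum_congr rfl fun j _ => by
                congr 1; ext ξ; ring
            · exact fun j _ => hint (fun ξ => coordI i ξ * coordI j ξ) _ ((cc i).mul (cc j))
          · exact fun i _ => hint _ _ (cc i)
          · exact fun i _ => integrable_finsetSum _ fun j _ =>
              hint (fun ξ => coordI i ξ * coordI j ξ) _ ((cc i).mul (cc j))
          · exact integrable_finsetSum _ fun i _ => integrable_finsetSum _ fun j _ =>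
              hint (fun ξ => coordI i ξ * coordI j ξ) _ ((cc i).mul (cc j))
          · exact integrable_finsetSum _ fun i _ => hint _ _ (cc i)
      _ = _ := by
          refine integral_congr_ae (.of_forall fun x => ?_)
          simp only [Complex.real_smul, mul_sub, Finset.mul_sum]
          congr 1
          · exact Finset.sum_congr rfl fun i _ => Finset.sum_congr rfl fun j _ => by ring
          · exact Finset.sum_congr rfl fun i _ => by ring

end

/-! ### Uniqueness for the linear equation. -/

section

open FourierTransform Filter Topology

variable {d : ℕ}

lemma IsTest.memLp {ψ : E d → ℝ} (h : IsTest ψ) : MemLp ψ 2 (volume : Measure (E d)) :=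
  memLp_testSchwartz ψ h

/-- The Fourier transform of real square-integrable functions as a real-linear map. -/
def ftL (d : ℕ) : L2 d →L[ℝ] CL2 d :=
  ((Lp.fourierTransformₗᵢ (E d) ℂ).toContinuousLinearEquiv.toContinuousLinearMap.restrictScalars
    ℝ).comp (cplx d)

/-- The Fourier transform restricted to a ball. -/
def ftBall (d : ℕ) (R : ℝ) : L2 d →L[ℝ] Lp ℂ 2 (volume.restrict (Metric.ball (0 : E d) R)) :=
  ((LpToLpRestrictCLM (E d) ℂ ℂ volume 2 (Metric.ball 0 R)).restrictScalars ℝ).comp (ftL d)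

lemma coeFn_ftBall (R : ℝ) (u : L2 d) :
    ⇑(ftBall d R u) =ᵐ[volume.restrict (Metric.ball (0 : E d) R)] ft u :=
  LpToLpRestrictCLM_coeFn ℂ _ _

lemma eq_zero_of_ftBall {u : L2 d} (h : ∀ n : ℕ, ftBall d n u = 0) : u = 0 := by
  have h1 : ft u = 0 := by
    apply Lp.ext
    have h2 : ∀ n : ℕ, ∀ᵐ ξ, ξ ∈ Metric.ball (0 : E d) n → ft u ξ = 0 := by
      intro n
      rw [← ae_restrict_iff' measurableSet_ball]
      have h3 := coeFn_ftBall (n : ℝ) u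
      rw [h n] at h3
      filter_upwards [h3, Lp.coeFn_zero ℂ 2 (volume.restrict (Metric.ball (0 : E d) (n : ℝ)))]
        with ξ h4 h5
      rw [← h4, h5]; rfl
    filter_upwards [ae_all_iff.2 h2, Lp.coeFn_zero ℂ 2 (volume : Measure (E d))] with ξ h4 h5
    obtain ⟨n, hn⟩ := exists_nat_gt ‖ξ‖
    rw [h4 n (by simpa using hn), h5]; rfl
  rw [← norm_eq_zero, ← norm_ft, h1, norm_zero]

lemma enorm_ftBall (R : ℝ) (u : L2 d) :
    ‖ftBall d R u‖ₑ = eLpNorm (ft u) 2 (volume.restrict (Metric.ball (0 : E d) R)) := by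
  rw [Lp.enorm_def]
  exact eLpNorm_congr_ae (coeFn_ftBall R u)

/-- On frequencies below R each derivative is multiplication by a function bounded by 2πR, so the
second order operator becomes bounded. This is what lets an elementary Grönwall argument prove
uniqueness. -/
lemma norm_ftBall_le {R : ℝ} (hR : 0 ≤ R) {w : L2 d} {W : Fin d → Fin d → L2 d} {V : Fin d → L2 d}
    (h : ∀ᵐ ξ, ft w ξ = (∑ i, ∑ j, coordI i ξ * coordI j ξ * ft (W i j) ξ)
      - ∑ i, coordI i ξ * ft (V i) ξ) :
    ‖ftBall d R w‖ ≤ (∑ i, ∑ j, (2 * Real.pi * R) ^ 2 * ‖ftBall d R (W i j)‖)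
      + ∑ i, (2 * Real.pi * R) * ‖ftBall d R (V i)‖ := by
  set C := 2 * Real.pi * R
  have hC : 0 ≤ C := by positivity
  set ν := volume.restrict (Metric.ball (0 : E d) R) with hν
  have hc : ∀ᵐ ξ ∂ν, ∀ i, ‖coordI i ξ‖ ≤ C := by
    filter_upwards [ae_restrict_mem measurableSet_ball] with ξ hξ i
    exact (norm_coordI_le i ξ).trans (mul_le_mul_of_nonneg_left
      (by simpa using (mem_ball_zero_iff.1 hξ).le) (by positivity : 0 ≤ 2 * Real.pi))
  have hm : ∀ u : L2 d, AEStronglyMeasurable (ft u) ν :=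
    fun u => (Lp.aestronglyMeasurable (ft u)).restrict
  have cc := fun i => continuous_coordI (d := d) i
  have hW : ∀ i j, eLpNorm (fun ξ => coordI i ξ * coordI j ξ * ft (W i j) ξ) 2 ν
      ≤ ENNReal.ofReal (C ^ 2 * ‖ftBall d R (W i j)‖) := by
    intro i j
    rw [ENNReal.ofReal_mul (by positivity), ofReal_norm, enorm_ftBall]
    refine eLpNorm_le_mul_eLpNorm_of_ae_le_mul ?_ 2
    filter_upwards [hc] with ξ hξ
    rw [norm_mul, norm_mul, sq]
    have h1 := hξ i
    have h2 := hξ j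
    gcongr
  have hV : ∀ i, eLpNorm (fun ξ => coordI i ξ * ft (V i) ξ) 2 ν
      ≤ ENNReal.ofReal (C * ‖ftBall d R (V i)‖) := by
    intro i
    rw [ENNReal.ofReal_mul (by positivity), ofReal_norm, enorm_ftBall]
    refine eLpNorm_le_mul_eLpNorm_of_ae_le_mul ?_ 2
    filter_upwards [hc] with ξ hξ
    rw [norm_mul]
    have h1 := hξ i
    gcongr
  have mW : ∀ i j, AEStronglyMeasurable (fun ξ => coordI i ξ * coordI j ξ * ft (W i j) ξ) ν :=
    fun i j => (((cc i).mul (cc j)).aestronglyMeasurable).mul (hm _)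
  have mV : ∀ i, AEStronglyMeasurable (fun ξ => coordI i ξ * ft (V i) ξ) ν :=
    fun i => ((cc i).aestronglyMeasurable).mul (hm _)
  have hS : eLpNorm (ft w) 2 ν ≤ (∑ i, ∑ j, ENNReal.ofReal (C ^ 2 * ‖ftBall d R (W i j)‖))
      + ∑ i, ENNReal.ofReal (C * ‖ftBall d R (V i)‖) := by
    have e : eLpNorm (ft w) 2 ν
        = eLpNorm ((∑ i, ∑ j, fun ξ => coordI i ξ * coordI j ξ * ft (W i j) ξ)
          - ∑ i, fun ξ => coordI i ξ * ft (V i) ξ) 2 ν := by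
      refine eLpNorm_congr_ae ?_
      filter_upwards [ae_restrict_of_ae h] with ξ hξ
      rw [hξ]; simp [Finset.sum_apply]
    rw [e]
    refine (eLpNorm_sub_le ?_ ?_ (by norm_num)).trans (add_le_add ?_ ?_)
    · exact Finset.aestronglyMeasurable_sum _ fun i _ =>
        Finset.aestronglyMeasurable_sum _ fun j _ => mW i j
    · exact Finset.aestronglyMeasurable_sum _ fun i _ => mV i
    · refine (eLpNorm_sum_le (fun i _ => Finset.aestronglyMeasurable_sum _ fun j _ => mW i j)
        (by norm_num)).trans (Finset.sum_le_sum fun i _ => ?_)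
      exact (eLpNorm_sum_le (fun j _ => mW i j) (by norm_num)).trans
        (Finset.sum_le_sum fun j _ => hW i j)
    · exact (eLpNorm_sum_le (fun i _ => mV i) (by norm_num)).trans
        (Finset.sum_le_sum fun i _ => hV i)
  have e1 : ∀ i, ∑ j, ENNReal.ofReal (C ^ 2 * ‖ftBall d R (W i j)‖)
      = ENNReal.ofReal (∑ j, C ^ 2 * ‖ftBall d R (W i j)‖) := fun i =>
    (ENNReal.ofReal_sum_of_nonneg fun j _ => by positivity).symm
  simp only [e1] at hS
  rw [← enorm_ftBall, ← ofReal_norm, ← ENNReal.ofReal_sum_of_nonneg fun i _ => by positivity,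
    ← ENNReal.ofReal_sum_of_nonneg fun i _ => by positivity,
    ← ENNReal.ofReal_add (by positivity) (by positivity)] at hS
  exact (ENNReal.ofReal_le_ofReal_iff (by positivity)).1 hS

lemma ae_le_of_memLp_top {F : Type*} [NormedAddCommGroup F] {ν : Measure ℝ} {u : ℝ → F}
    (hu : MemLp u ∞ ν) : ∀ᵐ s ∂ν, ‖u s‖ ≤ (eLpNorm u ∞ ν).toReal := by
  filter_upwards [ae_le_eLpNormEssSup (f := u) (μ := ν)] with s hs
  rw [← eLpNorm_exponent_top] at hs
  rw [← toReal_enorm]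
  exact ENNReal.toReal_mono hu.2.ne hs

namespace IsCoef

variable {γ M : ℝ} {α α' : ℝ → Fin d → Fin d → ℝ} {β β' : ℝ → Fin d → ℝ} {t s T : ℝ}

lemma intervalIntegrable_smul {F : Type*} [NormedAddCommGroup F] [NormedSpace ℝ F] {c : ℝ → ℝ}
    (hc : AEStronglyMeasurable c volume) (hb : ∀ r, |c r| ≤ M) {w : ℝ → F}
    (hw : IntervalIntegrable w volume t s) : IntervalIntegrable (fun r => c r • w r) volume t s :=
  ⟨hw.1.bdd_smul M hc.restrict (.of_forall hb), hw.2.bdd_smul M hc.restrict (.of_forall hb)⟩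

lemma integral_mul_ellOp {u : L2 d} {ψ : E d → ℝ} (hψ : IsTest ψ) (A : Fin d → Fin d → ℝ)
    (B : Fin d → ℝ) : ∫ x, u x * ellOp A B ψ x
      = (∑ i, ∑ j, A i j * ∫ x, u x * partialDeriv i (partialDeriv j ψ) x)
        + ∑ i, B i * ∫ x, u x * partialDeriv i ψ x := by
  have i2 : ∀ i j, Integrable fun x => A i j * (u x * partialDeriv i (partialDeriv j ψ) x) :=
    fun i j => (integrable_mul_of_memLp_real u ((hψ.partialDeriv j).partialDeriv i).memLp).const_mul _
  have i1 : ∀ i, Integrable fun x => B i * (u x * partialDeriv i ψ x) :=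
    fun i => (integrable_mul_of_memLp_real u (hψ.partialDeriv i).memLp).const_mul _
  have e : ∀ x, u x * ellOp A B ψ x = (∑ i, ∑ j, A i j * (u x * partialDeriv i (partialDeriv j ψ) x))
      + ∑ i, B i * (u x * partialDeriv i ψ x) := by
    intro x
    simp only [ellOp, mul_add, Finset.mul_sum]
    congr 1
    · exact Finset.sum_congr rfl fun i _ => Finset.sum_congr rfl fun j _ => by ring
    · exact Finset.sum_congr rfl fun i _ => by ring
  simp only [e]
  rw [integral_add (integrable_finsetSum _ fun i _ => integrable_finsetSum _ fun j _ => i2 i j)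
    (integrable_finsetSum _ fun i _ => i1 i), integral_finsetSum _ fun i _ =>
      integrable_finsetSum _ fun j _ => i2 i j, integral_finsetSum _ fun i _ => i1 i]
  simp only [integral_finsetSum _ fun j _ => i2 _ j, integral_const_mul]

/-- The weak form integrated against a curve in `L²`, with the coefficients moved to the curve. -/
lemma integral_integral_ellOp (h : IsCoef γ M α β) {w : ℝ → L2 d}
    (hw : IntervalIntegrable w volume t s) {ψ : E d → ℝ} (hψ : IsTest ψ) :
    ∫ r in t..s, ∫ x, w r x * ellOp (α r) (β r) ψ x
      = (∑ i, ∑ j, ∫ x, (∫ r in t..s, α r i j • w r : L2 d) x * partialDeriv i (partialDeriv j ψ) x)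
        + ∑ i, ∫ x, (∫ r in t..s, β r i • w r : L2 d) x * partialDeriv i ψ x := by
  have hA := fun i j => intervalIntegrable_smul (h.meas_α_apply i j) (fun r => h.bdd_α r i j) hw
  have hB := fun i => intervalIntegrable_smul (h.meas_β_apply i) (fun r => h.bdd_β r i) hw
  have hT : ∀ {u : ℝ → L2 d} {g : E d → ℝ} (hg : IsTest g), IntervalIntegrable u volume t s →
      IntervalIntegrable (fun r => testPair hg.memLp (u r)) volume t s :=
    fun hg hu => ⟨(testPair hg.memLp).integrable_comp hu.1, (testPair hg.memLp).integrable_comp hu.2⟩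
  simp only [integral_mul_ellOp hψ]
  simp only [← testPair_apply ((hψ.partialDeriv _).partialDeriv _).memLp,
    ← testPair_apply (hψ.partialDeriv _).memLp]
  simp only [← ContinuousLinearMap.intervalIntegral_comp_comm _ (hA _ _),
    ← ContinuousLinearMap.intervalIntegral_comp_comm _ (hB _)]
  have tA := fun i j => hT ((hψ.partialDeriv j).partialDeriv i) (hA i j)
  have tB := fun i => hT (hψ.partialDeriv i) (hB i)
  simp only [map_smul, smul_eq_mul] at tA tB ⊢
  have tA' : ∀ i, IntervalIntegrable (fun r => ∑ j, α r i j *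
      testPair ((hψ.partialDeriv j).partialDeriv i).memLp (w r)) volume t s := fun i =>
    intervalIntegrable_fun_sum (f := fun j r => α r i j *
      testPair ((hψ.partialDeriv j).partialDeriv i).memLp (w r)) _ fun j _ => tA i j
  rw [intervalIntegral.integral_add, intervalIntegral.integral_finsetSum fun i _ => tA' i,
    intervalIntegral.integral_finsetSum fun i _ => tB i]
  · congr 1
    exact Finset.sum_congr rfl fun i _ => intervalIntegral.integral_finsetSum fun j _ => tA i j
  · exact intervalIntegrable_fun_sum (f := fun i r => ∑ j, α r i j *
      testPair ((hψ.partialDeriv j).partialDeriv i).memLp (w r)) _ fun i _ => tA' i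
  · exact intervalIntegrable_fun_sum (f := fun i r => β r i *
      testPair (hψ.partialDeriv i).memLp (w r)) _ fun i _ => tB i

/-- Bounded curves in `L²` solving the linear equation with zero initial value vanish. -/
lemma eq_zero_of_weak (h : IsCoef γ M α β) (htT : t ≤ T) {w : ℝ → L2 d}
    (hw : AEStronglyMeasurable w (volume.restrict (Icc t T))) {S : ℝ}
    (hS : ∀ᵐ s ∂(volume.restrict (Icc t T)), ‖w s‖ ≤ S)
    (hweak : ∀ ψ : E d → ℝ, IsTest ψ → ∀ s ∈ Icc t T,
      ∫ x, w s x * ψ x = ∫ r in t..s, ∫ x, w r x * ellOp (α r) (β r) ψ x) :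
    ∀ s ∈ Icc t T, w s = 0 := by
  have hwi : IntervalIntegrable w volume t T := by
    rw [intervalIntegrable_iff_integrableOn_Icc_of_le htT]
    exact Integrable.mono' (integrable_const S) hw hS
  have hws : ∀ s ∈ Icc t T, IntervalIntegrable w volume t s := fun s hs =>
    hwi.mono_set (by rw [uIcc_of_le hs.1, uIcc_of_le htT]; exact Icc_subset_Icc_right hs.2)
  have key : ∀ R : ℝ, 0 ≤ R → ∃ K, 0 ≤ K ∧ ∀ s ∈ Icc t T,
      ‖ftBall d R (w s)‖ ≤ K * ∫ r in t..s, ‖ftBall d R (w r)‖ := by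
    intro R hR
    refine ⟨d * (d * ((2 * Real.pi * R) ^ 2 * |M|)) + d * (2 * Real.pi * R * |M|),
      by positivity, fun s hs => ?_⟩
    have hA := fun i j => intervalIntegrable_smul (h.meas_α_apply i j)
      (fun r => h.bdd_α r i j) (hws s hs)
    have hB := fun i => intervalIntegrable_smul (h.meas_β_apply i) (fun r => h.bdd_β r i)
      (hws s hs)
    have h1 := norm_ftBall_le hR (ft_eq_of_weak fun ψ hψ =>
      (hweak ψ hψ s hs).trans (h.integral_integral_ellOp (hws s hs) hψ))
    simp only [← ContinuousLinearMap.intervalIntegral_comp_comm _ (hA _ _),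
      ← ContinuousLinearMap.intervalIntegral_comp_comm _ (hB _), map_smul] at h1
    have hN : IntervalIntegrable (fun r => ‖ftBall d R (w r)‖) volume t s :=
      ⟨((ftBall d R).integrable_comp (hws s hs).1).norm,
        ((ftBall d R).integrable_comp (hws s hs).2).norm⟩
    have hc : ∀ {c : ℝ → ℝ}, (∀ r, |c r| ≤ M) →
        ‖∫ r in t..s, c r • ftBall d R (w r)‖ ≤ |M| * ∫ r in t..s, ‖ftBall d R (w r)‖ := by
      intro c hc
      rw [← intervalIntegral.integral_const_mul]
      refine intervalIntegral.norm_integral_le_of_norm_le hs.1 (.of_forall fun r _ => ?_)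
        (hN.const_mul _)
      rw [norm_smul]
      exact mul_le_mul_of_nonneg_right ((hc r).trans (le_abs_self M)) (norm_nonneg _)
    refine h1.trans ?_
    calc _ ≤ (∑ i : Fin d, ∑ j : Fin d, (2 * Real.pi * R) ^ 2 *
            (|M| * ∫ r in t..s, ‖ftBall d R (w r)‖))
          + ∑ i : Fin d, (2 * Real.pi * R) * (|M| * ∫ r in t..s, ‖ftBall d R (w r)‖) := by
          gcongr with i _ j _ i _
          · exact hc fun r => h.bdd_α r i j
          · exact hc fun r => h.bdd_β r i
      _ = _ := by simp; ring
  intro s hs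
  refine eq_zero_of_ftBall fun n => ?_
  obtain ⟨K, hK, hle⟩ := key n n.cast_nonneg
  have hNi : IntervalIntegrable (fun r => ‖ftBall d n (w r)‖) volume t T :=
    ⟨((ftBall d n).integrable_comp hwi.1).norm, ((ftBall d n).integrable_comp hwi.2).norm⟩
  have hsub : ∀ s ∈ Icc t T, IntervalIntegrable (fun r => ‖ftBall d n (w r)‖) volume t s :=
    fun s hs => hNi.mono_set
      (by rw [uIcc_of_le hs.1, uIcc_of_le htT]; exact Icc_subset_Icc_right hs.2)
  have hmono : ∀ s ∈ Icc t T, ∫ r in t..s, ‖ftBall d n (w r)‖ ≤ ∫ r in t..T, ‖ftBall d n (w r)‖ := by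
    intro s hs
    exact intervalIntegral.integral_mono_interval le_rfl hs.1 hs.2
      (.of_forall fun _ => norm_nonneg _) hNi
  -- The inequality D ≤ K ∫ D is put in singular form through K ≤ K√(T-t)/√(s-t). With c = 0 the
  -- conclusion is D = 0.
  have hg := gronwall_sqrt (D := fun s => ‖ftBall d n (w s)‖) (c := 0) (κ := K * √(T - t))
    (S₀ := K * ∫ r in t..T, ‖ftBall d n (w r)‖) htT (by positivity) le_rfl
    (fun _ _ => norm_nonneg _)
    (fun s hs => (hle s hs).trans (mul_le_mul_of_nonneg_left (hmono s hs) hK)) hNi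
    (by simpa using hle t (left_mem_Icc.2 htT))
    (fun s hs => by
      have hs' : s ∈ Icc t T := ⟨hs.1.le, hs.2⟩
      rw [zero_add]
      refine (hle s hs').trans (mul_le_mul_of_nonneg_right ?_
        (intervalIntegral.integral_nonneg hs.1.le fun _ _ => norm_nonneg _))
      rw [le_div_iff₀ (Real.sqrt_pos.2 (sub_pos.2 hs.1))]
      exact mul_le_mul_of_nonneg_left (Real.sqrt_le_sqrt (by linarith [hs.2])) hK) s hs
  simp only [mul_zero, zero_mul] at hg
  exact norm_le_zero_iff.1 hg

/-- The linear equation is well posed: its bounded weak solutions are given by the evolution. -/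
lemma eq_evol_of_weak (h : IsCoef γ M α β) (hγ : 0 < γ) (htT : t ≤ T) {m : ℝ → L2 d} {μ : L2 d}
    (hm : MemLp m ∞ (volume.restrict (Icc t T)))
    (hweak : ∀ ψ : E d → ℝ, IsTest ψ → ∀ s ∈ Icc t T, ∫ x, m s x * ψ x = (∫ x, μ x * ψ x)
      + ∫ r in t..s, ∫ x, m r x * ellOp (α r) (β r) ψ x) :
    ∀ s ∈ Icc t T, m s = evol α β t s μ := by
  have he : MemLp (fun s => evol α β t s μ) ∞ (volume.restrict (Icc t T)) := h.memLp_evol_top hγ μ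
  have hw := hm.sub he
  have hI : ∀ {u : ℝ → L2 d}, MemLp u ∞ (volume.restrict (Icc t T)) → ∀ s ∈ Icc t T,
      IntervalIntegrable u volume t s := by
    intro u hu s hs
    have : IntervalIntegrable u volume t T := by
      rw [intervalIntegrable_iff_integrableOn_Icc_of_le htT]
      exact hu.integrable le_top
    exact this.mono_set (by rw [uIcc_of_le hs.1, uIcc_of_le htT]; exact Icc_subset_Icc_right hs.2)
  have := h.eq_zero_of_weak htT hw.1 (ae_le_of_memLp_top hw) fun ψ hψ s hs => ?_
  · intro s hs
    exact sub_eq_zero.1 (this s hs)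
  · have e1 := hweak ψ hψ s hs
    have e2 := h.evol_weak hγ.le hs.1 μ hψ
    -- With the coefficients moved to the curve, each right-hand side is linear in an integrable L²
    -- curve, so the two weak forms can be subtracted term by term.
    rw [h.integral_integral_ellOp (hI hm s hs) hψ] at e1
    rw [h.integral_integral_ellOp (hI he s hs) hψ] at e2
    rw [h.integral_integral_ellOp (hI hw s hs) hψ]
    have hA := fun {u} hu i j => intervalIntegrable_smul (w := u) (h.meas_α_apply i j)
      (fun r => h.bdd_α r i j) (hI hu s hs)
    have hB := fun {u} hu i => intervalIntegrable_smul (w := u) (h.meas_β_apply i)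
      (fun r => h.bdd_β r i) (hI hu s hs)
    simp only [← testPair_apply ((hψ.partialDeriv _).partialDeriv _).memLp,
      ← testPair_apply (hψ.partialDeriv _).memLp, ← testPair_apply hψ.memLp] at e1 e2 ⊢
    simp only [Pi.sub_apply, smul_sub, intervalIntegral.integral_sub (hA hm _ _) (hA he _ _),
      intervalIntegral.integral_sub (hB hm _) (hB he _), map_sub, Finset.sum_sub_distrib]
    rw [e1, e2]
    ring

end IsCoef

end

/-! ### Coefficients depending on the state. -/

section

open Filter Topology

variable {d : ℕ}

/-- Bounded Lipschitz elliptic coefficients depending on the state only. -/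
structure IsStateCoef (γ K : ℝ) (a : L2 d → Fin d → Fin d → ℝ) (b : L2 d → Fin d → ℝ) : Prop where
  bdd_a : ∀ ν i j, |a ν i j| ≤ K
  bdd_b : ∀ ν i, |b ν i| ≤ K
  lip_a : ∀ ν ν' i j, |a ν i j - a ν' i j| ≤ K * ‖ν - ν'‖
  lip_b : ∀ ν ν' i, |b ν i - b ν' i| ≤ K * ‖ν - ν'‖
  symm : ∀ ν i j, a ν i j = a ν j i
  ell : ∀ ν (ξ : E d), γ * ‖ξ‖ ^ 2 ≤ ∑ i, ∑ j, a ν i j * ξ i * ξ j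

lemma RegularFunctional.abs_le {L : ℝ} {F : E d → L2 d → ℝ} (h : RegularFunctional L F)
    (hL : 0 ≤ L) (x : E d) (m : L2 d) : |F x m| ≤ L := by
  obtain ⟨DF, -, h2, -⟩ := h
  exact (ENNReal.ofReal_le_ofReal_iff hL).1 (le_self_add.trans (h2 x m))

lemma RegularFunctional.abs_sub_le {L : ℝ} {F : E d → L2 d → ℝ} (h : RegularFunctional L F)
    (x : E d) (m m' : L2 d) : |F x m - F x m'| ≤ L * ‖m - m'‖ := by
  obtain ⟨DF, -, -, h3⟩ := h
  have := h3 x x m' m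
  rw [sub_self, norm_zero, zero_add] at this
  linarith [norm_nonneg (DF x m - DF x m')]

lemma diffusion_eq_sum (σ : E d → L2 d → Matrix (Fin d) (Fin d) ℝ) (x : E d) (m : L2 d)
    (i j : Fin d) : diffusion σ x m i j = 1 / 2 * ∑ k, σ x m i k * σ x m j k := by
  simp [diffusion, Matrix.mul_apply]

/-- With a = ½σσ*, a sum of d products, a is bounded by dL²/2 and has Lipschitz constant dL². The
drift contributes L to both, and one constant K = L + dL² serves for all. -/
lemma isStateCoef_of_regular {γ L : ℝ} (hL : 0 ≤ L) {b : E d → L2 d → E d}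
    {σ : E d → L2 d → Matrix (Fin d) (Fin d) ℝ} (he : UniformlyElliptic γ σ)
    (hr : RegularCoefficients L b σ) :
    IsStateCoef γ (L + d * L ^ 2) (diffusion σ 0) (fun ν i => b 0 ν i) where
  bdd_a ν i j := by
    rw [diffusion_eq_sum, abs_mul]
    have : |∑ k, σ 0 ν i k * σ 0 ν j k| ≤ ∑ k : Fin d, L * L := by
      refine (Finset.abs_sum_le_sum_abs _ _).trans (Finset.sum_le_sum fun k _ => ?_)
      rw [abs_mul]
      gcongr
      exacts [(hr.σ_reg i k).abs_le hL 0 ν, (hr.σ_reg j k).abs_le hL 0 ν]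
    simp only [Finset.sum_const, Finset.card_univ, Fintype.card_fin, nsmul_eq_mul] at this
    rw [abs_of_pos (by norm_num : (0 : ℝ) < 1 / 2)]
    have h2 : 0 ≤ d * L ^ 2 := by positivity
    nlinarith
  bdd_b ν i := by
    have h1 := (hr.b_reg i).abs_le hL 0 ν
    have h2 : 0 ≤ d * L ^ 2 := by positivity
    linarith
  lip_a ν ν' i j := by
    rw [diffusion_eq_sum, diffusion_eq_sum, ← mul_sub, ← Finset.sum_sub_distrib, abs_mul]
    have : |∑ k, (σ 0 ν i k * σ 0 ν j k - σ 0 ν' i k * σ 0 ν' j k)|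
        ≤ ∑ k : Fin d, 2 * (L ^ 2 * ‖ν - ν'‖) := by
      refine (Finset.abs_sum_le_sum_abs _ _).trans (Finset.sum_le_sum fun k _ => ?_)
      have e : σ 0 ν i k * σ 0 ν j k - σ 0 ν' i k * σ 0 ν' j k
          = (σ 0 ν i k - σ 0 ν' i k) * σ 0 ν j k + σ 0 ν' i k * (σ 0 ν j k - σ 0 ν' j k) := by ring
      rw [e]
      refine (abs_add_le _ _).trans ?_
      rw [abs_mul, abs_mul]
      have h1 := (hr.σ_reg i k).abs_sub_le 0 ν ν'
      have h2 := (hr.σ_reg j k).abs_sub_le 0 ν ν'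
      have h3 := (hr.σ_reg j k).abs_le hL 0 ν
      have h4 := (hr.σ_reg i k).abs_le hL 0 ν'
      calc _ ≤ (L * ‖ν - ν'‖) * L + L * (L * ‖ν - ν'‖) := by gcongr
        _ = _ := by ring
    simp only [Finset.sum_const, Finset.card_univ, Fintype.card_fin, nsmul_eq_mul] at this
    rw [abs_of_pos (by norm_num : (0 : ℝ) < 1 / 2)]
    have h2 : 0 ≤ L * ‖ν - ν'‖ := by positivity
    nlinarith
  lip_b ν ν' i := by
    have h1 := (hr.b_reg i).abs_sub_le 0 ν ν'
    have h2 : 0 ≤ d * L ^ 2 * ‖ν - ν'‖ := by positivity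
    linarith
  symm ν i j := by
    rw [diffusion_eq_sum, diffusion_eq_sum]
    simp only [mul_comm]
  ell ν ξ := he 0 ν ξ

/-- Independence of x enters the proof only here: every coefficient is replaced by its value at the
origin. -/
lemma dualOp_eq_ellOp {b : E d → L2 d → E d} {σ : E d → L2 d → Matrix (Fin d) (Fin d) ℝ}
    (hx : ∀ (x x' : E d) (m : L2 d), b x m = b x' m ∧ σ x m = σ x' m) (ν : L2 d) (ψ : E d → ℝ) :
    dualOp b σ ν ψ = ellOp (diffusion σ 0 ν) (fun i => b 0 ν i) ψ := by
  ext x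
  simp only [dualOp, ellOp, diffusion, (hx x 0 ν).1, (hx x 0 ν).2]

lemma MemL2W12.congr {t T : ℝ} {u v : ℝ → L2 d} (h : MemL2W12 t T u) (huv : EqOn u v (Icc t T)) :
    MemL2W12 t T v := by
  have hae : u =ᵐ[volume.restrict (Icc t T)] v :=
    (ae_restrict_mem measurableSet_Icc).mono fun s hs => huv hs
  obtain ⟨h1, g, hg, h2⟩ := h
  refine ⟨h1.ae_eq hae, g, hg, ?_⟩
  filter_upwards [h2, hae] with s hs he i
  rw [← he]; exact hs i

namespace IsCoef

variable {γ M : ℝ} {α : ℝ → Fin d → Fin d → ℝ} {β : ℝ → Fin d → ℝ} {t s : ℝ}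

lemma evol_sub (h : IsCoef γ M α β) (hγ : 0 ≤ γ) (hts : t ≤ s) (φ φ' : L2 d) :
    evol α β t s (φ - φ') = evol α β t s φ - evol α β t s φ' := by
  rw [evol, evol, evol, ← map_sub, ft_sub]
  congr 1
  apply Lp.ext
  filter_upwards [coeFn_symb (h.memLp_mult hγ hts (ft φ - ft φ')),
    coeFn_symb (h.memLp_mult hγ hts (ft φ)), coeFn_symb (h.memLp_mult hγ hts (ft φ')),
    Lp.coeFn_sub (ft φ) (ft φ'),
    Lp.coeFn_sub (symb (mult α β t s) (ft φ)) (symb (mult α β t s) (ft φ'))] with ξ h1 h2 h3 h4 h5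
  rw [h1, h4, h5, Pi.sub_apply, Pi.sub_apply, h2, h3, mul_sub]

end IsCoef

namespace IsStateCoef

variable {γ K : ℝ} {a : L2 d → Fin d → Fin d → ℝ} {b : L2 d → Fin d → ℝ} {t s T : ℝ}

lemma neg (h : IsStateCoef γ K a b) : IsStateCoef γ K a (fun ν i => -b ν i) where
  bdd_a := h.bdd_a
  bdd_b ν i := by rw [abs_neg]; exact h.bdd_b ν i
  lip_a := h.lip_a
  lip_b ν ν' i := by rw [neg_sub_neg, abs_sub_comm]; exact h.lip_b ν ν' i
  symm := h.symm
  ell := h.ell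

lemma continuous_a (h : IsStateCoef γ K a b) : Continuous a :=
  continuous_pi fun i => continuous_pi fun j => by
    refine (LipschitzWith.of_dist_le_mul (K := K.toNNReal) fun ν ν' => ?_).continuous
    rw [Real.dist_eq, dist_eq_norm]
    exact (h.lip_a ν ν' i j).trans
      (mul_le_mul_of_nonneg_right (Real.le_coe_toNNReal K) (norm_nonneg _))

lemma continuous_b (h : IsStateCoef γ K a b) : Continuous b :=
  continuous_pi fun i => by
    refine (LipschitzWith.of_dist_le_mul (K := K.toNNReal) fun ν ν' => ?_).continuous
    rw [Real.dist_eq, dist_eq_norm]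
    exact (h.lip_b ν ν' i).trans
      (mul_le_mul_of_nonneg_right (Real.le_coe_toNNReal K) (norm_nonneg _))

lemma isCoef (h : IsStateCoef γ K a b) {m : ℝ → L2 d} (hm : AEStronglyMeasurable m volume) :
    IsCoef γ K (fun s => a (m s)) (fun s => b (m s)) where
  meas_α := h.continuous_a.comp_aestronglyMeasurable hm
  meas_β := h.continuous_b.comp_aestronglyMeasurable hm
  bdd_α s := h.bdd_a (m s)
  bdd_β s := h.bdd_b (m s)
  symm s := h.symm (m s)
  ell s := h.ell (m s)

/-- Dependence of the evolution on the curve along which the coefficients are taken. -/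
lemma norm_evol_sub_le (h : IsStateCoef γ K a b) (hγ : 0 < γ) (hK : 0 ≤ K) {m m' : ℝ → L2 d}
    (hm : AEStronglyMeasurable m volume) (hm' : AEStronglyMeasurable m' volume) (hts : t < s)
    (hsT : s - t ≤ T) (hi : IntervalIntegrable (fun r => ‖m r - m' r‖) volume t s) {φ : L2 d}
    (hφ : MemW12 φ) :
    ‖evol (fun r => a (m r)) (fun r => b (m r)) t s φ
        - evol (fun r => a (m' r)) (fun r => b (m' r)) t s φ‖
      ≤ diffConst d γ T * K * (enormW12 φ).toReal / √(s - t) * ∫ r in t..s, ‖m r - m' r‖ := by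
  have c := h.isCoef hm
  have c' := h.isCoef hm'
  have hI : 0 ≤ ∫ r in t..s, ‖m r - m' r‖ :=
    intervalIntegral.integral_nonneg hts.le fun _ _ => norm_nonneg _
  -- `δ` is the Lipschitz constant times the L¹ distance in time of the curves, which dominates the
  -- differences of the integrated coefficients.
  have key := c.enorm_evol_sub_le c' hγ hts hsT (δ := K * ∫ r in t..s, ‖m r - m' r‖)
    (fun i j => by
      rw [intA, intA, ← intervalIntegral.integral_sub (c.integrable_α i j t s)
        (c'.integrable_α i j t s), ← intervalIntegral.integral_const_mul, ← Real.norm_eq_abs]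
      exact intervalIntegral.norm_integral_le_of_norm_le hts.le
        (.of_forall fun r _ => h.lip_a _ _ i j) (hi.const_mul _))
    (fun i => by
      rw [intB, intB, ← intervalIntegral.integral_sub (c.integrable_β i t s)
        (c'.integrable_β i t s), ← intervalIntegral.integral_const_mul, ← Real.norm_eq_abs]
      exact intervalIntegral.norm_integral_le_of_norm_le hts.le
        (.of_forall fun r _ => h.lip_b _ _ i) (hi.const_mul _))
    (by positivity) φ
  have hd := diffConst_nonneg d γ T
  rw [← ENNReal.ofReal_toReal (enormW12_lt_top hφ).ne, ← ENNReal.ofReal_mul (by positivity),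
    ← ofReal_norm, ENNReal.ofReal_le_ofReal_iff (by positivity)] at key
  refine key.trans_eq ?_
  ring

end IsStateCoef

end

/-! ### The nonlinear equation: fixed point, stability, well-posedness. -/

section

open Filter Topology
open scoped NNReal

variable {d : ℕ}

namespace IsStateCoef

variable {γ K : ℝ} {a : L2 d → Fin d → Fin d → ℝ} {b : L2 d → Fin d → ℝ} {t s T : ℝ}

/-- The curve with exponential weight attached to a continuous curve on `[t,T]`. -/
def weightedCurve (htT : t ≤ T) (l : ℝ) (n : C(Icc t T, L2 d)) (r : ℝ) : L2 d :=
  Real.exp (l * (r - t)) • IccExtend htT n r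

lemma continuous_weightedCurve (htT : t ≤ T) (l : ℝ) (n : C(Icc t T, L2 d)) :
    Continuous (weightedCurve htT l n) := by
  have : Continuous (IccExtend htT n) := n.continuous.Icc_extend'
  unfold weightedCurve
  fun_prop

lemma norm_weightedCurve_sub_le (htT : t ≤ T) (l : ℝ) (n n' : C(Icc t T, L2 d)) (r : ℝ) :
    ‖weightedCurve htT l n r - weightedCurve htT l n' r‖ ≤ dist n n' * Real.exp (l * (r - t)) := by
  rw [weightedCurve, weightedCurve, ← smul_sub, norm_smul, Real.norm_of_nonneg (Real.exp_pos _).le,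
    mul_comm, ← dist_eq_norm]
  gcongr
  exact ContinuousMap.dist_apply_le_dist _

/-- The conjugated Picard map. -/
def picard (h : IsStateCoef γ K a b) (hγ : 0 < γ) (htT : t ≤ T) (l : ℝ) (μ : L2 d)
    (n : C(Icc t T, L2 d)) : C(Icc t T, L2 d) where
  toFun s := Real.exp (-(l * (s - t))) •
    evol (fun r => a (weightedCurve htT l n r)) (fun r => b (weightedCurve htT l n r)) t s μ
  continuous_toFun := by
    have h1 := (h.isCoef (continuous_weightedCurve htT l n).aestronglyMeasurable).continuousOn_evol
      hγ.le t μ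
    have h2 : Continuous fun s : Icc t T => evol (fun r => a (weightedCurve htT l n r))
        (fun r => b (weightedCurve htT l n r)) t s μ :=
      h1.comp_continuous continuous_subtype_val fun s => s.2.1
    fun_prop

lemma picard_apply (h : IsStateCoef γ K a b) (hγ : 0 < γ) (htT : t ≤ T) (l : ℝ) (μ : L2 d)
    (n : C(Icc t T, L2 d)) (s : Icc t T) : h.picard hγ htT l μ n s = Real.exp (-(l * (s - t))) •
      evol (fun r => a (weightedCurve htT l n r)) (fun r => b (weightedCurve htT l n r)) t s μ :=
  rfl

lemma contracting_picard (h : IsStateCoef γ K a b) (hγ : 0 < γ) (hK : 0 ≤ K) (ht : 0 ≤ t)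
    (htT : t ≤ T) {μ : L2 d} (hμ : MemW12 μ) :
    ContractingWith (1 / 2) (h.picard hγ htT
      ((2 * (diffConst d γ T * K * (enormW12 μ).toReal) + 1) ^ 2) μ) := by
  have hd := diffConst_nonneg d γ T
  set κ := diffConst d γ T * K * (enormW12 μ).toReal with hκ
  have hκ0 : 0 ≤ κ := by positivity
  -- The weight depends on `μ` through its W^{1,2} norm. It is large enough that κ/√l ≤ 1/2, so the
  -- map contracts on the whole interval at once.
  set l := (2 * κ + 1) ^ 2 with hl
  have hl0 : 0 < l := by positivity
  have hsl : √l = 2 * κ + 1 := Real.sqrt_sq (by positivity)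
  refine ⟨by rw [← NNReal.coe_lt_coe]; norm_num, LipschitzWith.of_dist_le_mul fun n n' => ?_⟩
  rw [ContinuousMap.dist_le (by positivity)]
  rintro ⟨s, hs⟩
  have hR : ((1 / 2 : ℝ≥0) : ℝ) * dist n n' = 1 / 2 * dist n n' := by norm_num
  rw [hR, dist_eq_norm]
  rw [picard_apply, picard_apply, ← smul_sub, norm_smul, Real.norm_of_nonneg (Real.exp_pos _).le]
  rcases eq_or_lt_of_le hs.1 with rfl | hts
  -- At s = t both curves start from `μ`; the singular estimate is available only for s > t.
  · rw [evol_self, evol_self, sub_self μ, norm_zero, mul_zero]; positivity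
  have c1 := continuous_weightedCurve htT l n
  have c2 := continuous_weightedCurve htT l n'
  have h1 := h.norm_evol_sub_le hγ hK c1.aestronglyMeasurable c2.aestronglyMeasurable hts
    (by linarith [hs.2] : s - t ≤ T) ((c1.sub c2).norm.intervalIntegrable _ _) hμ
  have h2 : ∫ r in t..s, ‖weightedCurve htT l n r - weightedCurve htT l n' r‖
      ≤ dist n n' * ∫ r in t..s, Real.exp (l * (r - t)) := by
    rw [← intervalIntegral.integral_const_mul]
    exact intervalIntegral.integral_mono_on hts.le ((c1.sub c2).norm.intervalIntegrable _ _)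
      (Continuous.intervalIntegrable (by fun_prop) _ _) fun r _ =>
        norm_weightedCurve_sub_le htT l n n' r
  have h3 := integral_exp_weight_le hl0 hts
  have h5 : κ / √l ≤ 1 / 2 := by
    rw [hsl, div_le_div_iff₀ (by positivity) two_pos]; linarith
  calc _ ≤ Real.exp (-(l * (s - t))) * (κ / √(s - t) *
        (dist n n' * ∫ r in t..s, Real.exp (l * (r - t)))) := by
        gcongr
        exact h1.trans (by gcongr)
    _ = Real.exp (-(l * (s - t))) * (κ * dist n n') *
        (1 / √(s - t) * ∫ r in t..s, Real.exp (l * (r - t))) := by ring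
    _ ≤ Real.exp (-(l * (s - t))) * (κ * dist n n') * (Real.exp (l * (s - t)) / √l) := by gcongr
    _ = κ / √l * dist n n' * (Real.exp (-(l * (s - t))) * Real.exp (l * (s - t))) := by ring
    _ = κ / √l * dist n n' := by rw [← Real.exp_add, neg_add_cancel, Real.exp_zero, mul_one]
    _ ≤ _ := by gcongr

/-- Mild solutions of the nonlinear equation exist. -/
lemma exists_mild (h : IsStateCoef γ K a b) (hγ : 0 < γ) (hK : 0 ≤ K) (ht : 0 ≤ t)
    (htT : t ≤ T) {μ : L2 d} (hμ : MemW12 μ) :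
    ∃ m : ℝ → L2 d, Continuous m ∧ ∀ s ∈ Icc t T,
      m s = evol (fun r => a (m r)) (fun r => b (m r)) t s μ := by
  have hc := h.contracting_picard hγ hK ht htT hμ
  set l := (2 * (diffConst d γ T * K * (enormW12 μ).toReal) + 1) ^ 2
  have : Nonempty (C(Icc t T, L2 d)) := ⟨0⟩
  set n := hc.fixedPoint
  have hn : h.picard hγ htT l μ n = n := hc.fixedPoint_isFixedPt
  refine ⟨weightedCurve htT l n, continuous_weightedCurve htT l n, fun s hs => ?_⟩
  -- The weight in the curve and the inverse weight in the conjugated map cancel.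
  conv_lhs => rw [weightedCurve, IccExtend_of_mem _ _ hs, ← hn]
  rw [picard_apply, smul_smul, ← Real.exp_add, add_neg_cancel, Real.exp_zero, one_smul]

/-- Two mild solutions, one of which starts from a state in `W^{1,2}`. -/
lemma norm_mild_sub_le (h : IsStateCoef γ K a b) (hγ : 0 < γ) (hK : 0 ≤ K) (ht : 0 ≤ t)
    (htT : t ≤ T) {μ μ' : L2 d} (hμ : MemW12 μ) {m m' : ℝ → L2 d}
    (hm : AEStronglyMeasurable m volume) (hm' : AEStronglyMeasurable m' volume)
    (he : ∀ s ∈ Icc t T, m s = evol (fun r => a (m r)) (fun r => b (m r)) t s μ)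
    (he' : ∀ s ∈ Icc t T, m' s = evol (fun r => a (m' r)) (fun r => b (m' r)) t s μ') :
    ∀ s ∈ Icc t T, ‖m' s - m s‖ ≤ 2 * ‖μ' - μ‖ *
      Real.exp ((2 * (diffConst d γ T * K * (enormW12 μ).toReal) + 1) ^ 2 * (s - t)) := by
  have c := h.isCoef hm
  have c' := h.isCoef hm'
  have hd := diffConst_nonneg d γ T
  have hb : ∀ s ∈ Icc t T, ‖m' s - m s‖ ≤ ‖μ'‖ + ‖μ‖ := by
    intro s hs
    rw [he s hs, he' s hs]
    exact (norm_sub_le _ _).trans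
      (add_le_add (c'.norm_evol_le hγ.le hs.1 μ') (c.norm_evol_le hγ.le hs.1 μ))
  have hi : IntervalIntegrable (fun r => ‖m' r - m r‖) volume t T := by
    rw [intervalIntegrable_iff_integrableOn_Icc_of_le htT]
    refine Integrable.mono' (integrable_const (‖μ'‖ + ‖μ‖)) (hm'.sub hm).norm.restrict ?_
    filter_upwards [ae_restrict_mem measurableSet_Icc] with s hs
    rw [norm_norm]; exact hb s hs
  refine gronwall_sqrt htT (by positivity) (norm_nonneg _) (fun _ _ => norm_nonneg _) hb hi ?_
    fun s hs => ?_
  · rw [he t (left_mem_Icc.2 htT), he' t (left_mem_Icc.2 htT), evol_self, evol_self]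
  · have hs' : s ∈ Icc t T := ⟨hs.1.le, hs.2⟩
    have his : IntervalIntegrable (fun r => ‖m' r - m r‖) volume t s :=
      hi.mono_set (by rw [uIcc_of_le hs.1.le, uIcc_of_le htT]; exact Icc_subset_Icc_right hs.2)
    -- The difference of initial states is moved by a contraction, and the difference of
    -- coefficients acts on `μ` alone. So `μ'` need not be in W^{1,2} and its norm does not enter
    -- the constant.
    have e : m' s - m s = evol (fun r => a (m' r)) (fun r => b (m' r)) t s (μ' - μ)
        + (evol (fun r => a (m' r)) (fun r => b (m' r)) t s μ
          - evol (fun r => a (m r)) (fun r => b (m r)) t s μ) := by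
      rw [c'.evol_sub hγ.le hs.1.le, he s hs', he' s hs']; abel
    have h1 := h.norm_evol_sub_le hγ hK hm' hm hs.1 (by linarith [hs.2] : s - t ≤ T) his hμ
    rw [e]
    exact (norm_add_le _ _).trans (add_le_add (c'.norm_evol_le hγ.le hs.1.le _) h1)

end IsStateCoef

/-- The nonlinear equation is well posed; its solution is continuous and given by the evolution. -/
lemma exists_fpSolution {γ L t T : ℝ} (hγ : 0 < γ) (hL : 0 ≤ L) (ht : t ∈ Icc 0 T)
    {b : E d → L2 d → E d} {σ : E d → L2 d → Matrix (Fin d) (Fin d) ℝ}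
    (he : UniformlyElliptic γ σ) (hr : RegularCoefficients L b σ)
    (hx : ∀ (x x' : E d) (m : L2 d), b x m = b x' m ∧ σ x m = σ x' m) {μ : L2 d}
    (hμ : MemW12 μ) :
    ∃ m : ℝ → L2 d, Continuous m ∧
      (∀ s ∈ Icc t T, m s = evol (fun r => diffusion σ 0 (m r)) (fun r i => b 0 (m r) i) t s μ) ∧
      IsFPSolution b σ t T μ m ∧
        ∀ m', IsFPSolution b σ t T μ m' → EqOn m' m (Icc t T) := by
  have h := isStateCoef_of_regular hL he hr
  have hK : 0 ≤ L + d * L ^ 2 := by positivity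
  obtain ⟨m, hmc, hm⟩ := h.exists_mild hγ hK ht.1 ht.2 hμ
  have c := h.isCoef hmc.aestronglyMeasurable
  refine ⟨m, hmc, hm, ?_, fun m' hm' => ?_⟩
  · refine ⟨(c.memL2W12_evol hγ ht.2 μ).congr fun s hs => (hm s hs).symm,
      (c.memLp_evol_top hγ μ).ae_eq
        ((ae_restrict_mem measurableSet_Icc).mono fun s hs => (hm s hs).symm),
      by rw [hm t (left_mem_Icc.2 ht.2), evol_self], fun ψ hψ s hs => ?_⟩
    rw [hm s hs, c.evol_weak hγ.le hs.1 μ hψ]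
    congr 1
    refine intervalIntegral.integral_congr fun r hr => ?_
    rw [uIcc_of_le hs.1] at hr
    simp only [dualOp_eq_ellOp hx]
    rw [← hm r ⟨hr.1, hr.2.trans hs.2⟩]
  -- `m'` is known to be measurable only on [t,T]; the extension by zero gives coefficients
  -- measurable on the whole line.
  · set n := (Icc t T).indicator m' with hn
    have hnm : ∀ s ∈ Icc t T, n s = m' s := fun s hs => indicator_of_mem hs _
    have hnmeas : AEStronglyMeasurable n volume :=
      (aestronglyMeasurable_indicator_iff measurableSet_Icc).2 hm'.memLinfty.1
    have c' := h.isCoef hnmeas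
    -- With its own coefficients frozen, `m'` is a bounded solution of a linear equation, hence is
    -- given by the evolution.
    have e := c'.eq_evol_of_weak hγ ht.2 (m := m') (μ := μ) hm'.memLinfty fun ψ hψ s hs => by
      rw [hm'.weak ψ hψ s hs]
      congr 1
      refine intervalIntegral.integral_congr fun r hr => ?_
      rw [uIcc_of_le hs.1] at hr
      simp only [dualOp_eq_ellOp hx, hnm r ⟨hr.1, hr.2.trans hs.2⟩]
    intro s hs
    have key := h.norm_mild_sub_le hγ hK ht.1 ht.2 hμ hmc.aestronglyMeasurable hnmeas hm
      (fun s hs => (hnm s hs).trans (e s hs)) s hs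
    rw [sub_self, norm_zero, mul_zero, zero_mul] at key
    rw [← hnm s hs]
    exact sub_eq_zero.1 (norm_le_zero_iff.1 key)

end

/-! ### The kernel is a Gaussian. -/

section

open FourierTransform Filter Topology
open scoped SchwartzMap RealInnerProductSpace

variable {d : ℕ}

/-- Fubini, in the form of the general Fourier integral for the bilinear form -⟨·,·⟩, which equals
its own flip. -/
lemma integral_fourierInv_mul {f g : E d → ℂ} (hf : Integrable f) (hg : Integrable g) :
    ∫ x, 𝓕⁻ f x * g x = ∫ ξ, f ξ * 𝓕⁻ g ξ := by
  have hL : Continuous fun p : E d × E d => (-innerₗ (E d)) p.1 p.2 := by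
    simp only [LinearMap.neg_apply, innerₗ_apply_apply]; fun_prop
  have h := VectorFourier.integral_fourierIntegral_smul_eq_flip (μ := (volume : Measure (E d)))
    (ν := (volume : Measure (E d))) (L := -innerₗ (E d)) Real.continuous_fourierChar hL hf hg
  have e : (-innerₗ (E d)).flip = -innerₗ (E d) := by
    ext x y; simp [real_inner_comm]
  rw [e] at h
  simp only [smul_eq_mul] at h
  exact h

lemma continuous_fourierInv {f : E d → ℂ} (hf : Integrable f) : Continuous (𝓕⁻ f) := by
  have hL : Continuous fun p : E d × E d => (-innerₗ (E d)) p.1 p.2 := by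
    simp only [LinearMap.neg_apply, innerₗ_apply_apply]; fun_prop
  exact VectorFourier.fourierIntegral_continuous Real.continuous_fourierChar hL hf

lemma chk_coe {ψ : E d → ℝ} (h : IsTest ψ) : ⇑(chk ψ h) = 𝓕⁻ (fun x => (ψ x : ℂ)) := by
  rw [chk, SchwartzMap.fourierInv_coe]; rfl

/-- On `L¹ ∩ L²` the inverse Fourier transform of `L²` is given by the inverse Fourier integral. -/
lemma coeFn_fourierInv {w : CL2 d} (hw : Integrable w) :
    ⇑(𝓕⁻ w : CL2 d) =ᵐ[volume] 𝓕⁻ (⇑w : E d → ℂ) := by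
  refine ae_eq_of_integral_contDiff_smul_eq (locallyIntegrable_CL2 _)
    (continuous_fourierInv hw).locallyIntegrable fun g hg hc => ?_
  have ht : IsTest g := ⟨hg, hc⟩
  have h1 := integral_mul_fourier (𝓕⁻ w : CL2 d) (chk g ht)
  rw [fourier_chk, FourierTransform.fourier_fourierInv_eq] at h1
  have h2 := integral_fourierInv_mul hw (testSchwartz g ht).integrable
  simp only [testSchwartz_apply] at h1 h2
  simp only [Complex.real_smul, mul_comm (g _ : ℂ)]
  rw [h1, h2, chk_coe]
  rfl

/-- A real symmetric bilinear form is diagonal in some orthonormal basis. -/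
lemma exists_diagonalization {A : Fin d → Fin d → ℝ} (hA : ∀ i j, A i j = A j i) :
    ∃ (e : E d ≃ₗᵢ[ℝ] E d) (l : Fin d → ℝ),
      ∀ ξ, ∑ i, ∑ j, A i j * ξ i * ξ j = ∑ k, l k * e ξ k ^ 2 := by
  let B : Matrix (Fin d) (Fin d) ℝ := Matrix.of A
  have hB : B.IsHermitian := by
    ext i j; simp [B, hA j i]
  have hT := Matrix.isSymmetric_toEuclideanLin_iff.2 hB
  have hn : Module.finrank ℝ (E d) = d := finrank_euclideanSpace_fin
  refine ⟨(hT.eigenvectorBasis hn).repr, hT.eigenvalues hn, fun ξ => ?_⟩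
  have h1 : ∑ i, ∑ j, A i j * ξ i * ξ j = ⟪ξ, Matrix.toEuclideanLin B ξ⟫ := by
    simp only [PiLp.inner_apply, Matrix.toLpLin_apply, Matrix.mulVec, dotProduct, B,
      Matrix.of_apply, RCLike.inner_apply, conj_trivial]
    refine Finset.sum_congr rfl fun i _ => ?_
    rw [Finset.sum_mul]
    exact Finset.sum_congr rfl fun j _ => by ring
  rw [h1, ← (hT.eigenvectorBasis hn).repr.inner_map_map]
  simp only [PiLp.inner_apply, hT.eigenvectorBasis_apply_self_apply hn, RCLike.inner_apply,
    conj_trivial]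
  exact Finset.sum_congr rfl fun k _ => by simp; ring

namespace IsCoef

variable {γ M : ℝ} {α α' : ℝ → Fin d → Fin d → ℝ} {β β' : ℝ → Fin d → ℝ} {t s T : ℝ}

/-- The kernel of the evolution is a Gaussian. -/
lemma exists_fourierInv_mult_eq (h : IsCoef γ M α β) (hγ : 0 < γ) (hts : t < s) :
    ∃ (e : E d ≃ₗᵢ[ℝ] E d) (l : Fin d → ℝ) (C : ℝ) (v : E d), (∀ k, 0 < l k) ∧ 0 ≤ C ∧
      ∀ z, 𝓕⁻ (mult α β t s) z = ((C * Real.exp (-∑ k, l k * e (z - v) k ^ 2) : ℝ) : ℂ) := by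
  have hsymm : ∀ i j, intA α t s i j = intA α t s j i := fun i j => by
    simp only [intA, h.symm _ i j]
  obtain ⟨e, l, hl⟩ := exists_diagonalization hsymm
  -- The integrated ellipticity, evaluated at the k-th eigenvector.
  have hlpos : ∀ k, 0 < l k := by
    intro k
    have h1 := h.quad_ge hts.le (e.symm (EuclideanSpace.single k 1))
    rw [hl] at h1
    simp only [LinearIsometryEquiv.norm_map, LinearIsometryEquiv.apply_symm_apply,
      PiLp.norm_single, PiLp.single_apply] at h1
    have h2 : ∑ x, l x * (if x = k then (1 : ℝ) else 0) ^ 2 = l k := by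
      simp [ite_pow]
    rw [h2] at h1
    have : 0 < γ * (s - t) := mul_pos hγ (sub_pos.2 hts)
    simp at h1
    linarith
  have hc : ∀ k, 0 < 4 * Real.pi ^ 2 * l k := fun k => by have := hlpos k; positivity
  -- In each eigendirection the integral of exp(-4π² l y² + 2πi w y) is √(π/(4π² l)) exp(-w²/(4l)).
  -- The integrated drift translates the centre.
  refine ⟨e, fun k => 1 / (4 * l k), ∏ k, √(Real.pi / (4 * Real.pi ^ 2 * l k)),
    WithLp.toLp 2 (intB β t s), fun k => by have := hlpos k; positivity,
    Finset.prod_nonneg fun k _ => Real.sqrt_nonneg _, fun z => ?_⟩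
  set w := e (z - WithLp.toLp 2 (intB β t s)) with hw
  have e1 : ∀ ξ : E d, Complex.exp ((2 * Real.pi * ⟪ξ, z⟫ : ℝ) * Complex.I) • mult α β t s ξ
      = (fun v : Fin d → ℝ => Complex.exp (-∑ k, ((4 * Real.pi ^ 2 * l k : ℝ) : ℂ) * (v k : ℂ) ^ 2
          + ∑ k, (2 * Real.pi * Complex.I * w k) * v k)) (e ξ) := by
    intro ξ
    have h1 : ⟪ξ, z⟫ - ∑ i, intB β t s i * ξ i = ∑ k, w k * e ξ k := by
      have h2 : ∑ i, intB β t s i * ξ i = ⟪ξ, WithLp.toLp 2 (intB β t s)⟫ := by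
        simp [PiLp.inner_apply]
      rw [h2, ← inner_sub_right, ← e.inner_map_map, ← hw]
      simp [PiLp.inner_apply]
    have h1' : ((⟪ξ, z⟫ : ℝ) : ℂ)
        = ((∑ k, w k * e ξ k : ℝ) : ℂ) + ((∑ i, intB β t s i * ξ i : ℝ) : ℂ) := by
      rw [← h1]; push_cast; ring
    rw [smul_eq_mul, mult, ← Complex.exp_add]
    congr 1
    rw [sym, hl ξ]
    push_cast
    rw [h1']
    push_cast
    simp only [Finset.mul_sum, Finset.sum_mul, ← Finset.sum_neg_distrib, neg_add, mul_add, add_mul]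
    have h3 : ∀ f g : Fin d → ℂ, (∀ k, f k = g k) → ∑ k, f k = ∑ k, g k :=
      fun f g hfg => Finset.sum_congr rfl fun k _ => hfg k
    rw [add_comm, add_assoc]
    congr 1
    · exact h3 _ _ fun k => by ring
    · rw [add_comm, add_assoc, ← Finset.sum_add_distrib]
      rw [h3 (fun k => _ + _) (fun _ => 0) fun k => by ring]
      simp only [Finset.sum_const_zero, add_zero]
      exact h3 _ _ fun k => by ring
  rw [Real.fourierInv_eq']
  simp only [e1]
  -- Rotating to the eigenbasis and passing from the Euclidean space to the product space both
  -- preserve volume, so the integral factors into one-dimensional Gaussians.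
  rw [e.measurePreserving.integral_comp e.toHomeomorph.measurableEmbedding
    (fun x : E d => (fun v : Fin d → ℝ => Complex.exp (-∑ k, ((4 * Real.pi ^ 2 * l k : ℝ) : ℂ) * (v k : ℂ) ^ 2
          + ∑ k, (2 * Real.pi * Complex.I * w k) * v k)) x),
    ← (PiLp.volume_preserving_toLp (Fin d)).integral_comp
      (MeasurableEquiv.toLp 2 _).measurableEmbedding]
  simp only
  rw [GaussianFourier.integral_cexp_neg_sum_mul_add (fun k => by
    rw [Complex.ofReal_re]; exact hc k)]
  rw [Finset.prod_mul_distrib, ← Complex.exp_sum]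
  push_cast
  congr 1
  · refine Finset.prod_congr rfl fun k _ => ?_
    rw [Real.sqrt_eq_rpow, Complex.ofReal_cpow (by have := hc k; positivity)]
    push_cast
    rfl
  · rw [← Finset.sum_neg_distrib]
    congr 1
    refine Finset.sum_congr rfl fun k _ => ?_
    have := (hlpos k).ne'
    have h5 : (l k : ℂ) ≠ 0 := by exact_mod_cast this
    have h6 : (Real.pi : ℂ) ≠ 0 := by exact_mod_cast Real.pi_ne_zero
    field_simp
    rw [Complex.I_sq]
    ring

end IsCoef

end

/-! ### The kernel: positivity, mass and the Dirac initial value. -/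

section

open FourierTransform Filter Topology
open scoped SchwartzMap RealInnerProductSpace

variable {d : ℕ}

/-- The fundamental solution, as a function of time and of the space increment. -/
def kern (α : ℝ → Fin d → Fin d → ℝ) (β : ℝ → Fin d → ℝ) (t s : ℝ) (z : E d) : ℝ :=
  (𝓕⁻ (mult α β t s) z).re

lemma memLp_two_of_integrable {F : Type*} [NormedAddCommGroup F] {f : E d → F} (hf : Integrable f)
    {C : ℝ} (hC : ∀ x, ‖f x‖ ≤ C) : MemLp f 2 (volume : Measure (E d)) := by
  rw [memLp_two_iff_integrable_sq_norm hf.1]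
  refine (hf.norm.const_mul C).mono' (hf.1.norm.pow 2) (.of_forall fun x => ?_)
  rw [Real.norm_of_nonneg (by positivity), sq]
  exact mul_le_mul_of_nonneg_right (hC x) (norm_nonneg _)

lemma fourierInv_shift (f : E d → ℂ) (x y : E d) :
    𝓕⁻ (fun ξ => Real.fourierChar (-⟪ξ, y⟫) • f ξ) x = 𝓕⁻ f (x - y) := by
  rw [Real.fourierInv_eq, Real.fourierInv_eq]
  congr 1; ext ξ
  rw [smul_smul, ← AddChar.map_add_eq_mul, inner_sub_right, sub_eq_add_neg]

lemma integrable_shift {f : E d → ℂ} (hf : Integrable f) (y : E d) :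
    Integrable (fun ξ => Real.fourierChar (-⟪ξ, y⟫) • f ξ) :=
  (Real.fourierIntegral_convergent_iff y).2 hf

lemma norm_shift (f : E d → ℂ) (y ξ : E d) : ‖Real.fourierChar (-⟪ξ, y⟫) • f ξ‖ = ‖f ξ‖ := by
  rw [Circle.norm_smul]

lemma integrable_symBound_mul (Ψ : 𝓢(E d, ℂ)) : Integrable fun ξ => symBound ξ * ‖Ψ ξ‖ := by
  refine (((Ψ.integrable_pow_mul volume 2).const_mul (4 * Real.pi ^ 2 * d ^ 2)).add
    ((Ψ.integrable_pow_mul volume 1).const_mul (2 * Real.pi * d))).congr (.of_forall fun ξ => ?_)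
  simp only [Pi.add_apply, symBound, pow_one]; ring

namespace IsCoef

variable {γ M : ℝ} {α α' : ℝ → Fin d → Fin d → ℝ} {β β' : ℝ → Fin d → ℝ} {t s T : ℝ}

lemma integrable_mult (h : IsCoef γ M α β) (hγ : 0 < γ) (hts : t < s) :
    Integrable (mult α β t s : E d → ℂ) := by
  have hc : 0 < 4 * Real.pi ^ 2 * γ * (s - t) := by
    have := sub_pos.2 hts
    positivity
  have h1 := (GaussianFourier.integrable_cexp_neg_mul_sq_norm_add (V := E d)
    (b := ((4 * Real.pi ^ 2 * γ * (s - t) : ℝ) : ℂ)) (by rwa [Complex.ofReal_re]) 0 0).norm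
  refine h1.mono' (h.continuous_mult_right t s).aestronglyMeasurable (.of_forall fun ξ => ?_)
  refine (h.norm_mult_le hts.le ξ).trans_eq ?_
  rw [Complex.norm_exp]
  congr 1
  rw [zero_mul, add_zero, ← Complex.ofReal_neg, ← Complex.ofReal_pow, ← Complex.ofReal_mul,
    Complex.ofReal_re]
  ring

lemma memLp_mult_two (h : IsCoef γ M α β) (hγ : 0 < γ) (hts : t < s) :
    MemLp (mult α β t s) 2 (volume : Measure (E d)) :=
  memLp_two_of_integrable (h.integrable_mult hγ hts) (h.norm_mult_le_one hγ.le hts.le)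

/-- The Gaussian formula shows that the inverse transform is real, so taking the real part in `kern`
loses nothing. -/
lemma ofReal_kern (h : IsCoef γ M α β) (hγ : 0 < γ) (hts : t < s) (z : E d) :
    (kern α β t s z : ℂ) = 𝓕⁻ (mult α β t s) z := by
  obtain ⟨e, l, C, v, -, -, hz⟩ := h.exists_fourierInv_mult_eq hγ hts
  rw [kern, hz, Complex.ofReal_re]

lemma kern_nonneg (h : IsCoef γ M α β) (hγ : 0 < γ) (hts : t < s) (z : E d) :
    0 ≤ kern α β t s z := by
  obtain ⟨e, l, C, v, -, hC, hz⟩ := h.exists_fourierInv_mult_eq hγ hts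
  rw [kern, hz, Complex.ofReal_re]
  positivity

lemma exists_kern_le (h : IsCoef γ M α β) (hγ : 0 < γ) (hts : t < s) :
    ∃ C, ∀ z : E d, ‖kern α β t s z‖ ≤ C := by
  obtain ⟨e, l, C, v, hl, hC, hz⟩ := h.exists_fourierInv_mult_eq hγ hts
  refine ⟨C, fun z => ?_⟩
  rw [Real.norm_of_nonneg (h.kern_nonneg hγ hts z), kern, hz, Complex.ofReal_re]
  refine mul_le_of_le_one_right hC (Real.exp_le_one_iff.2 (neg_nonpos.2 ?_))
  exact Finset.sum_nonneg fun k _ => mul_nonneg (hl k).le (sq_nonneg _)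

lemma integrable_kern (h : IsCoef γ M α β) (hγ : 0 < γ) (hts : t < s) :
    Integrable (kern α β t s : E d → ℝ) := by
  obtain ⟨e, l, C, v, hl, hC, hz⟩ := h.exists_fourierInv_mult_eq hγ hts
  have h1 := GaussianFourier.integrable_cexp_neg_sum_mul_add (b := fun k => (l k : ℂ))
    (fun k => by rw [Complex.ofReal_re]; exact hl k) (fun _ => 0)
  have h2 : Integrable fun y : Fin d → ℝ => Real.exp (-∑ k, l k * y k ^ 2) := by
    refine h1.norm.congr (.of_forall fun y => ?_)
    simp only [zero_mul, Finset.sum_const_zero, add_zero, Complex.norm_exp]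
    congr 1
    rw [← Complex.ofReal_re (-∑ k, l k * y k ^ 2)]
    congr 1
    push_cast; rfl
  have h3 : Integrable fun y : E d => Real.exp (-∑ k, l k * y k ^ 2) :=
    ((PiLp.volume_preserving_toLp (Fin d)).integrable_comp_emb
      (MeasurableEquiv.toLp 2 _).measurableEmbedding).1 h2
  have h4 : Integrable fun y : E d => Real.exp (-∑ k, l k * e y k ^ 2) :=
    (e.measurePreserving.integrable_comp_emb e.toHomeomorph.measurableEmbedding).2 h3
  refine ((h4.comp_sub_right v).const_mul C).congr (.of_forall fun z => ?_)
  simp only [kern, hz, Complex.ofReal_re]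

/-- Fourier inversion at frequency zero, where the multiplier is 1. Inversion needs the kernel to be
integrable, which the Gaussian formula provides. -/
lemma integral_kern (h : IsCoef γ M α β) (hγ : 0 < γ) (hts : t < s) :
    ∫ z : E d, kern α β t s z = 1 := by
  have hk : Integrable (𝓕⁻ (mult α β t s) : E d → ℂ) :=
    (h.integrable_kern hγ hts).ofReal.congr (.of_forall fun z => h.ofReal_kern hγ hts z)
  have hi := Continuous.fourier_fourierInv_eq (h.continuous_mult_right t s)
    (h.integrable_mult hγ hts) (by
      have := hk.comp_neg
      refine this.congr (.of_forall fun z => ?_)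
      simp only [Real.fourierInv_eq_fourier_neg, neg_neg])
  have h0 := congrFun hi 0
  rw [Real.fourier_eq] at h0
  simp only [inner_zero_right, neg_zero, AddChar.map_zero_eq_one, one_smul] at h0
  have h1 : mult α β t s (0 : E d) = 1 := by simp [mult, sym]
  rw [h1] at h0
  simp only [← h.ofReal_kern hγ hts] at h0
  rw [integral_complex_ofReal] at h0
  exact_mod_cast h0

lemma lintegral_kern (h : IsCoef γ M α β) (hγ : 0 < γ) (hts : t < s) :
    ∫⁻ z : E d, ‖kern α β t s z‖ₑ = 1 := by
  have h1 := ofReal_integral_eq_lintegral_ofReal (h.integrable_kern hγ hts)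
    (.of_forall (h.kern_nonneg hγ hts))
  rw [h.integral_kern hγ hts, ENNReal.ofReal_one] at h1
  rw [h1]
  exact lintegral_congr fun z => Real.enorm_of_nonneg (h.kern_nonneg hγ hts z)

lemma memLp_kern_shift (h : IsCoef γ M α β) (hγ : 0 < γ) (hts : t < s) (y : E d) :
    MemLp (fun x => kern α β t s (x - y)) 2 volume := by
  obtain ⟨C, hC⟩ := h.exists_kern_le hγ hts
  exact memLp_two_of_integrable ((h.integrable_kern hγ hts).comp_sub_right y) fun x => hC _

/-- Translating the kernel by y modulates its transform by a character; the pairing is then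
transposed to the Fourier side. -/
lemma integral_kern_mul (h : IsCoef γ M α β) (hγ : 0 < γ) (hts : t < s) (y : E d) {ψ : E d → ℝ}
    (hψ : IsTest ψ) : ∫ x, kern α β t s (x - y) * ψ x
      = (∫ ξ, mult α β t s ξ * (Real.fourierChar (-⟪ξ, y⟫) • chk ψ hψ ξ)).re := by
  have h1 := integral_fourierInv_mul (integrable_shift (h.integrable_mult hγ hts) y)
    (testSchwartz ψ hψ).integrable
  have h2 : ((∫ x, kern α β t s (x - y) * ψ x : ℝ) : ℂ)
      = ∫ ξ, mult α β t s ξ * (Real.fourierChar (-⟪ξ, y⟫) • chk ψ hψ ξ) := by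
    rw [← integral_complex_ofReal]
    simp only [Complex.ofReal_mul, h.ofReal_kern hγ hts, ← fourierInv_shift]
    refine h1.trans (integral_congr_ae (.of_forall fun ξ => ?_))
    simp only [chk_coe]
    rw [smul_mul_assoc, mul_smul_comm]
    rfl
  rw [← h2, Complex.ofReal_re]

/-- The kernel solves the linear equation with a Dirac mass as initial value. -/
lemma kern_weak (h : IsCoef γ M α β) (hγ : 0 < γ) (hs : t < s) (y : E d) {ψ : E d → ℝ}
    (hψ : IsTest ψ) : ∫ x, kern α β t s (x - y) * ψ x
      = ψ y + ∫ r in t..s, ∫ x, kern α β t r (x - y) * ellOp (α r) (β r) ψ x := by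
  have hc : Continuous fun ξ => Real.fourierChar (-⟪ξ, y⟫) • chk ψ hψ ξ := by
    have : Continuous (chk ψ hψ) := (chk ψ hψ).continuous
    fun_prop
  have hG := integrable_shift (chk ψ hψ).integrable y
  have hG' : Integrable fun ξ => symBound ξ * ‖Real.fourierChar (-⟪ξ, y⟫) • chk ψ hψ ξ‖ := by
    refine (integrable_symBound_mul (chk ψ hψ)).congr (.of_forall fun ξ => ?_)
    simp only [norm_shift]
  rw [h.integral_kern_mul hγ hs y hψ, h.re_integral_mult_mul hγ.le hs.le hG hG']
  congr 1
  -- The initial term is the forward transform at y of the inverse transform of ψ, that is ψ y: the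
  -- Dirac mass.
  · have e : ∫ ξ, Real.fourierChar (-⟪ξ, y⟫) • chk ψ hψ ξ = 𝓕 (chk ψ hψ) y := rfl
    rw [e, fourier_chk]
    rfl
  -- Working on the half-open interval avoids r = t, where the kernel is not a function.
  · rw [intervalIntegral.integral_of_le hs.le, intervalIntegral.integral_of_le hs.le]
    refine setIntegral_congr_fun measurableSet_Ioc fun r hr => ?_
    rw [h.integral_kern_mul hγ hr.1 y (hψ.ellOp (α r) (β r))]
    congr 1
    refine integral_congr_ae (.of_forall fun ξ => ?_)
    simp only [chk_ellOp hψ, Circle.smul_def, smul_eq_mul]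
    ring

end IsCoef

end

/-! ### Joint measurability of the kernel and its pairing with L² functions. -/

section

open FourierTransform Filter Topology
open scoped RealInnerProductSpace

variable {d : ℕ}

lemma conj_mult (α : ℝ → Fin d → Fin d → ℝ) (β : ℝ → Fin d → ℝ) (t s : ℝ) (ξ : E d) :
    (starRingEnd ℂ) (mult α β t s ξ) = mult α (fun s i => -β s i) t s ξ := by
  rw [mult, mult, ← Complex.exp_conj, map_neg, conj_sym]
  congr 3
  ext i
  simp only [intB, intervalIntegral.integral_neg]

section increments

variable {k : ℝ → E d → ℝ} {t T : ℝ}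

lemma measurable_sub_of_measurable (hk : Measurable fun p : ℝ × E d => k p.1 p.2) :
    Measurable fun p : ℝ × E d × E d => k p.1 (p.2.1 - p.2.2) :=
  hk.comp (f := fun p : ℝ × E d × E d => (p.1, p.2.1 - p.2.2)) (by fun_prop)

lemma lintegral_shift_of_lintegral (h1 : ∀ s ∈ Ioc t T, ∫⁻ z, ‖k s z‖ₑ = 1) {s : ℝ}
    (hs : s ∈ Ioc t T) (y : E d) : ∫⁻ x, ‖k s (x - y)‖ₑ = 1 :=
  (lintegral_sub_right_eq_self (fun x => ‖k s x‖ₑ) y).trans (h1 s hs)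

lemma integrableOn_shift_of_lintegral (hk : Measurable fun p : ℝ × E d => k p.1 p.2)
    (h1 : ∀ s ∈ Ioc t T, ∫⁻ z, ‖k s z‖ₑ = 1) (y : E d) (K : Set (E d)) :
    IntegrableOn (fun p : ℝ × E d => k p.1 (p.2 - y)) (Ioc t T ×ˢ K) := by
  have hm : Measurable fun p : ℝ × E d => k p.1 (p.2 - y) :=
    hk.comp (f := fun p : ℝ × E d => (p.1, p.2 - y)) (by fun_prop)
  refine IntegrableOn.mono_set (t := Ioc t T ×ˢ univ) ⟨hm.aestronglyMeasurable, ?_⟩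
    (prod_mono_right (subset_univ K))
  rw [HasFiniteIntegral, Measure.volume_eq_prod, ← Measure.prod_restrict, Measure.restrict_univ,
    lintegral_prod _ hm.enorm.aemeasurable]
  -- Unit mass at every time makes the integral over the strip equal to its length, despite the
  -- singularity at s = t.
  calc _ = ∫⁻ _ in Ioc t T, 1 := setLIntegral_congr_fun measurableSet_Ioc fun s hs =>
        lintegral_shift_of_lintegral h1 hs y
    _ < ⊤ := by simp

lemma integrableOn_sub_of_lintegral (hk : Measurable fun p : ℝ × E d => k p.1 p.2)
    (h1 : ∀ s ∈ Ioc t T, ∫⁻ z, ‖k s z‖ₑ = 1) {K : Set (E d)} (hK : IsCompact K) :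
    IntegrableOn (fun p : ℝ × E d × E d => k p.1 (p.2.1 - p.2.2)) (Ioc t T ×ˢ K ×ˢ K) := by
  have hm := measurable_sub_of_measurable hk
  refine IntegrableOn.mono_set (t := Ioc t T ×ˢ univ ×ˢ K) ⟨hm.aestronglyMeasurable, ?_⟩
    (prod_mono_right (prod_mono_left (subset_univ K)))
  rw [HasFiniteIntegral, Measure.volume_eq_prod, ← Measure.prod_restrict, Measure.volume_eq_prod,
    ← Measure.prod_restrict, Measure.restrict_univ, lintegral_prod _ hm.enorm.aemeasurable]
  calc _ = ∫⁻ _ in Ioc t T, volume K := setLIntegral_congr_fun measurableSet_Ioc fun s hs => by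
          have hms : Measurable fun q : E d × E d => k s (q.1 - q.2) :=
            hm.comp (f := fun q : E d × E d => (s, q)) (by fun_prop)
          -- x is integrated first over the whole space, giving mass one; only y needs to stay in
          -- the compact set.
          rw [lintegral_prod_symm _ hms.enorm.aemeasurable]
          simp only [lintegral_shift_of_lintegral h1 hs]
          simp
    _ < ⊤ := by
      rw [setLIntegral_const]
      exact ENNReal.mul_lt_top hK.measure_lt_top (by simp)

end increments

namespace IsCoef

variable {γ M : ℝ} {α α' : ℝ → Fin d → Fin d → ℝ} {β β' : ℝ → Fin d → ℝ} {t s T : ℝ}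

/-- The kernel is the real part of a parameter integral with jointly continuous integrand. -/
lemma stronglyMeasurable_kern (h : IsCoef γ M α β) (t : ℝ) :
    StronglyMeasurable fun p : ℝ × E d => kern α β t p.1 p.2 := by
  have h0 : Continuous fun q : (ℝ × E d) × E d => mult α β t q.1.1 q.2 :=
    Continuous.comp (h.continuous_mult t)
      (f := fun q : (ℝ × E d) × E d => (q.1.1, q.2)) (by fun_prop)
  have h1 : Continuous (Function.uncurry fun (p : ℝ × E d) (ξ : E d) =>
      Complex.exp ((2 * Real.pi * ⟪ξ, p.2⟫ : ℝ) * Complex.I) • mult α β t p.1 ξ) := by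
    have h3 : Continuous fun q : (ℝ × E d) × E d =>
        Complex.exp ((2 * Real.pi * ⟪q.2, q.1.2⟫ : ℝ) * Complex.I) := by fun_prop
    exact h3.smul h0
  have h2 := h1.stronglyMeasurable.integral_prod_right (ν := (volume : Measure (E d)))
  simp only [kern, Real.fourierInv_eq']
  exact Complex.continuous_re.comp_stronglyMeasurable h2

lemma integrableOn_kern_shift (h : IsCoef γ M α β) (hγ : 0 < γ) (t T : ℝ) (y : E d)
    (K : Set (E d)) :
    IntegrableOn (fun p : ℝ × E d => kern α β t p.1 (p.2 - y)) (Ioc t T ×ˢ K) :=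
  integrableOn_shift_of_lintegral (k := kern α β t) (h.stronglyMeasurable_kern t).measurable
    (fun _ hs => h.lintegral_kern hγ hs.1) y K

lemma integrableOn_kern_sub (h : IsCoef γ M α β) (hγ : 0 < γ) (t T : ℝ) {K : Set (E d)}
    (hK : IsCompact K) :
    IntegrableOn (fun p : ℝ × E d × E d => kern α β t p.1 (p.2.1 - p.2.2)) (Ioc t T ×ˢ K ×ˢ K) :=
  integrableOn_sub_of_lintegral (k := kern α β t) (h.stronglyMeasurable_kern t).measurable
    (fun _ hs => h.lintegral_kern hγ hs.1) hK

/-- Pairing the kernel with a state gives the evolution with the opposite drift. -/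
lemma integral_kern_mul_ae (h : IsCoef γ M α β) (hγ : 0 < γ) (hts : t < s) (φ : L2 d) :
    (fun y => ∫ x, kern α β t s (x - y) * φ x)
      =ᵐ[volume] evol α (fun r i => -β r i) t s φ := by
  have hmem := h.neg.memLp_mult hγ.le hts.le (ft φ)
  set g := symb (mult α (fun r i => -β r i) t s) (ft φ) with hg
  have hgc : ⇑g =ᵐ[volume] fun ξ => mult α (fun r i => -β r i) t s ξ * ft φ ξ := coeFn_symb hmem
  have hgi : Integrable g :=
    ((h.neg.memLp_mult_two hγ hts).integrable_mul (Lp.memLp (ft φ))).congr hgc.symm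
  have key : ∀ y, ((∫ x, kern α β t s (x - y) * φ x : ℝ) : ℂ) = 𝓕⁻ (⇑g : E d → ℂ) y := by
    intro y
    have hG : MemLp (fun ξ => Real.fourierChar (-⟪ξ, y⟫) • mult α β t s ξ) 2
        (volume : Measure (E d)) :=
      memLp_two_of_integrable (integrable_shift (h.integrable_mult hγ hts) y) (C := 1) fun ξ => by
        rw [norm_shift]; exact h.norm_mult_le_one hγ.le hts.le ξ
    have hGi : Integrable hG.toLp :=
      (integrable_shift (h.integrable_mult hγ hts) y).congr hG.coeFn_toLp.symm
    -- For fixed y the translated kernel is the inverse transform of a modulated multiplier.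
    -- Plancherel turns the pairing with φ into an inverse Fourier integral at y of the conjugate
    -- multiplier times `ft φ`, which is integrable as a product of two L² functions.
    have hH : ⇑(𝓕⁻ hG.toLp : CL2 d) =ᵐ[volume] fun x => (kern α β t s (x - y) : ℂ) := by
      filter_upwards [coeFn_fourierInv hGi] with x hx
      rw [hx, Real.fourierInv_congr_ae hG.coeFn_toLp, fourierInv_shift, h.ofReal_kern hγ hts]
    have h1 := Lp.inner_fourier_eq (𝓕⁻ hG.toLp : CL2 d) (cplx d φ)
    rw [FourierTransform.fourier_fourierInv_eq, ← ft_eq, L2.inner_def, L2.inner_def] at h1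
    have h2 : ((∫ x, kern α β t s (x - y) * φ x : ℝ) : ℂ)
        = ∫ x, inner ℂ ((𝓕⁻ hG.toLp : CL2 d) x) (cplx d φ x) := by
      rw [← integral_complex_ofReal]
      refine integral_congr_ae ?_
      filter_upwards [hH, coeFn_cplx φ] with x h3 h4
      rw [h3, h4, RCLike.inner_apply, Complex.conj_ofReal]
      push_cast; ring
    rw [h2, ← h1, Real.fourierInv_congr_ae hgc, Real.fourierInv_eq]
    refine integral_congr_ae ?_
    filter_upwards [hG.coeFn_toLp] with ξ h3
    rw [h3, RCLike.inner_apply, ← conj_mult, Circle.smul_def, Circle.smul_def, smul_eq_mul,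
      smul_eq_mul, map_mul, ← Circle.coe_inv_eq_conj, ← AddChar.map_neg_eq_inv, neg_neg]
    ring
  have e : evol α (fun r i => -β r i) t s φ = rePart d (𝓕⁻ g) := rfl
  rw [e]
  filter_upwards [coeFn_rePart (𝓕⁻ g : CL2 d), coeFn_fourierInv hgi] with y h1 h2
  rw [h1, h2, ← key y, Complex.ofReal_re]

end IsCoef

end

/-! ### The estimates for the kernels along solutions. -/

section

open Filter Topology

variable {d : ℕ}

lemma dotConst_mono {γ M T T' : ℝ} (h : T ≤ T') :
    dotConst d γ M T ≤ dotConst d γ M T' := by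
  unfold dotConst
  gcongr

lemma IsTimeDeriv.congr {t T : ℝ} (htT : t ≤ T) {u u' v : ℝ → L2 d} (h : IsTimeDeriv t T u v)
    (huu : EqOn u u' (Icc t T)) : IsTimeDeriv t T u' v :=
  ⟨h.1, fun s hs => by rw [← huu hs, ← huu (left_mem_Icc.2 htT)]; exact h.2 s hs⟩

lemma enormL2W12_congr {t T : ℝ} {u v : ℝ → L2 d} (h : EqOn u v (Icc t T)) :
    enormL2W12 t T u = enormL2W12 t T v := by
  unfold enormL2W12
  rw [setLIntegral_congr_fun measurableSet_Icc fun s hs => by rw [h hs]]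

namespace IsCoef

variable {γ M : ℝ} {α : ℝ → Fin d → Fin d → ℝ} {β : ℝ → Fin d → ℝ} {t s T : ℝ}

lemma pairing_kern (h : IsCoef γ M α β) (hγ : 0 < γ) (hts : t ≤ s) (φ : L2 d) :
    pairing t (fun s x y => kern α β t s (x - y)) φ s
      =ᵐ[volume] evol α (fun r i => -β r i) t s φ := by
  rcases eq_or_lt_of_le hts with rfl | hts
  · rw [evol_self]
    exact .of_forall fun y => by simp [pairing]
  · refine EventuallyEq.trans (.of_forall fun y => ?_) (h.integral_kern_mul_ae hγ hts φ)
    simp [pairing, hts.ne']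

lemma memLp_pairing_kern (h : IsCoef γ M α β) (hγ : 0 < γ) (hts : t ≤ s) (φ : L2 d) :
    MemLp (pairing t (fun s x y => kern α β t s (x - y)) φ s) 2 volume :=
  (Lp.memLp _).ae_eq (h.pairing_kern hγ hts φ).symm

/-- Reduces the estimates on φ^{t,μ} to those on the evolution with drift -β. The time s = t is
included, where both sides are `φ`. -/
lemma pairingL2_kern (h : IsCoef γ M α β) (hγ : 0 < γ) (hts : t ≤ s) (φ : L2 d) :
    pairingL2 t (fun s x y => kern α β t s (x - y)) φ s = evol α (fun r i => -β r i) t s φ := by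
  rw [pairingL2, dif_pos (h.memLp_pairing_kern hγ hts φ)]
  apply Lp.ext
  exact (MemLp.coeFn_toLp _).trans (h.pairing_kern hγ hts φ)

lemma isDiracSolution_kern (h : IsCoef γ M α β) (hγ : 0 < γ) (t T : ℝ)
    {b : E d → L2 d → E d} {σ : E d → L2 d → Matrix (Fin d) (Fin d) ℝ} {m : ℝ → L2 d}
    (hm : ∀ s ψ, dualOp b σ (m s) ψ = ellOp (α s) (β s) ψ) (y : E d) :
    IsDiracSolution b σ t T m y fun s x => kern α β t s (x - y) where
  locallyIntegrable s hs := ((h.integrable_kern hγ hs.1).comp_sub_right y).locallyIntegrable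
  integrableOn K _ := h.integrableOn_kern_shift hγ t T y K
  weak ψ hψ s hs := by
    simp only [hm]
    exact h.kern_weak hγ hs.1 y hψ

end IsCoef

/-- The constant in the stability estimate. -/
def stabConst (d : ℕ) (γ K T r : ℝ) : ℝ :=
  diffConst d γ T * K * √T * (2 * Real.exp ((2 * (diffConst d γ T * K * r) + 1) ^ 2 * T))

lemma esupL2_le {t T : ℝ} {u : ℝ → L2 d} {C : ℝ≥0∞} (h : ∀ s ∈ Icc t T, ‖u s‖ₑ ≤ C) :
    esupL2 t T u ≤ C := iSup₂_le h

/-- Dependence of the evolution on the initial state of the curve of coefficients. -/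
lemma IsStateCoef.norm_evol_sub_le_of_mild {γ K t T : ℝ} {a : L2 d → Fin d → Fin d → ℝ}
    {b : L2 d → Fin d → ℝ} (h : IsStateCoef γ K a b) (hγ : 0 < γ) (hK : 0 ≤ K)
    (ht : t ∈ Icc 0 T) {μ μ' : L2 d} (hμ : MemW12 μ) {m m' : ℝ → L2 d}
    (hm : Continuous m) (hm' : Continuous m')
    (he : ∀ s ∈ Icc t T, m s = evol (fun r => a (m r)) (fun r => b (m r)) t s μ)
    (he' : ∀ s ∈ Icc t T, m' s = evol (fun r => a (m' r)) (fun r => b (m' r)) t s μ')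
    {φ : L2 d} (hφ : MemW12 φ) : ∀ s ∈ Icc t T,
    ‖evol (fun r => a (m' r)) (fun r i => -b (m' r) i) t s φ
        - evol (fun r => a (m r)) (fun r i => -b (m r) i) t s φ‖
      ≤ stabConst d γ K T (enormW12 μ).toReal * (enormW12 φ).toReal * ‖μ' - μ‖ := by
  intro s hs
  have hd := diffConst_nonneg d γ T
  unfold stabConst
  rcases eq_or_lt_of_le hs.1 with rfl | hts
  · rw [evol_self, evol_self, sub_self φ, norm_zero]; positivity
  set κ := (2 * (diffConst d γ T * K * (enormW12 μ).toReal) + 1) ^ 2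
  have hκ : 0 ≤ κ := by positivity
  have hi : IntervalIntegrable (fun r => ‖m' r - m r‖) volume t s :=
    (hm'.sub hm).norm.intervalIntegrable _ _
  -- The evolution of φ has the reversed drift, while the curves themselves evolve with the original
  -- one; hence two different estimates are combined.
  have h1 := h.neg.norm_evol_sub_le hγ hK hm'.aestronglyMeasurable hm.aestronglyMeasurable hts
    (by linarith [hs.2, ht.1] : s - t ≤ T) hi hφ
  have h2 := h.norm_mild_sub_le hγ hK ht.1 ht.2 hμ hm.aestronglyMeasurable
    hm'.aestronglyMeasurable he he'
  have h3 : ∫ r in t..s, ‖m' r - m r‖ ≤ ∫ r in t..s, 2 * ‖μ' - μ‖ * Real.exp (κ * T) := by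
    refine intervalIntegral.integral_mono_on hts.le hi intervalIntegrable_const fun r hr => ?_
    refine (h2 r ⟨hr.1, hr.2.trans hs.2⟩).trans ?_
    gcongr
    linarith [hr.2, hs.2, ht.1]
  rw [intervalIntegral.integral_const, smul_eq_mul] at h3
  have hst : 0 < √(s - t) := Real.sqrt_pos.2 (sub_pos.2 hts)
  have hsq : √(s - t) * √(s - t) = s - t := Real.mul_self_sqrt (sub_pos.2 hts).le
  have hsT : √(s - t) ≤ √T := Real.sqrt_le_sqrt (by linarith [hs.2, ht.1])
  calc _ ≤ diffConst d γ T * K * (enormW12 φ).toReal / √(s - t)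
        * ((s - t) * (2 * ‖μ' - μ‖ * Real.exp (κ * T))) := h1.trans (by gcongr)
    -- The length s - t of the interval beats the singularity 1/√(s-t) and leaves √(s-t) ≤ √T.
    _ = diffConst d γ T * K * (enormW12 φ).toReal / √(s - t)
        * ((√(s - t) * √(s - t)) * (2 * ‖μ' - μ‖ * Real.exp (κ * T))) := by rw [hsq]
    _ = diffConst d γ T * K * √(s - t) * (2 * Real.exp (κ * T)) * (enormW12 φ).toReal
          * ‖μ' - μ‖ := by field_simp
    _ ≤ _ := by gcongr

/-- The kernels along the curves `m t μ` satisfy all the estimates. -/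
lemma fundamentalSolutionEstimates_kern {γ K T : ℝ} (hγ : 0 < γ) (hK : 0 ≤ K)
    {b : E d → L2 d → E d} {σ : E d → L2 d → Matrix (Fin d) (Fin d) ℝ}
    (h : IsStateCoef γ K (diffusion σ 0) fun ν i => b 0 ν i)
    (hx : ∀ (x x' : E d) (m : L2 d), b x m = b x' m ∧ σ x m = σ x' m)
    {m : ℝ → L2 d → ℝ → L2 d}
    (hm : ∀ t ∈ Icc 0 T, ∀ μ, MemW12 μ → Continuous (m t μ) ∧ ∀ s ∈ Icc t T, m t μ s
      = evol (fun r => diffusion σ 0 (m t μ r)) (fun r i => b 0 (m t μ r) i) t s μ) :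
    FundamentalSolutionEstimates b σ T (1 + √(T + 1 / (2 * γ))) √(dotConst d γ K T)
      (stabConst d γ K T) m
      (fun t μ s x y => kern (fun r => diffusion σ 0 (m t μ r)) (fun r i => b 0 (m t μ r) i)
        t s (x - y)) := by
  have hc : ∀ t ∈ Icc 0 T, ∀ μ, MemW12 μ → IsCoef γ K (fun r => diffusion σ 0 (m t μ r))
      (fun r i => b 0 (m t μ r) i) := fun t ht μ hμ => h.isCoef (hm t ht μ hμ).1.aestronglyMeasurable
  have hp : ∀ t (ht : t ∈ Icc 0 T) μ (hμ : MemW12 μ) (φ : L2 d), EqOn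
      (fun s => evol (fun r => diffusion σ 0 (m t μ r)) (fun r i => -b 0 (m t μ r) i) t s φ)
      (pairingL2 t (fun s x y => kern (fun r => diffusion σ 0 (m t μ r))
        (fun r i => b 0 (m t μ r) i) t s (x - y)) φ) (Icc t T) :=
    fun t ht μ hμ φ s hs => ((hc t ht μ hμ).pairingL2_kern hγ hs.1 φ).symm
  refine ⟨fun t ht μ hμ => ⟨fun A hA => (hc t ht μ hμ).integrableOn_kern_sub hγ t T hA,
    fun y => (hc t ht μ hμ).isDiracSolution_kern hγ t T (fun s ψ => dualOp_eq_ellOp hx _ ψ) y⟩,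
    fun t ht μ hμ φ s hs => .of_forall fun y => ?_, fun t ht μ hμ φ s hs => ?_,
    fun t ht μ hμ φ => ?_, fun t ht μ hμ φ => ?_, fun t ht μ hμ φ hφ => ?_,
    fun t ht μ μ' hμ hμ' φ hφ => ?_⟩
  · exact ((hc t ht μ hμ).memLp_kern_shift hγ hs.1 y).integrable_mul (Lp.memLp φ)
  · exact (hc t ht μ hμ).memLp_pairing_kern hγ hs.1 φ
  · exact ((hc t ht μ hμ).neg.memL2W12_evol hγ ht.2 φ).congr (hp t ht μ hμ φ)
  · have c := (hc t ht μ hμ).neg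
    rw [← enormL2W12_congr (hp t ht μ hμ φ), ENNReal.ofReal_add zero_le_one (Real.sqrt_nonneg _),
      add_mul, ENNReal.ofReal_one, one_mul]
    refine add_le_add (esupL2_le fun s hs => ?_) ((c.enormL2W12_evol_le hγ ht.2 φ).trans ?_)
    · rw [← hp t ht μ hμ φ hs]
      exact c.enorm_evol_le hγ.le hs.1 φ
    · gcongr
      linarith [ht.1]
  · have c := (hc t ht μ hμ).neg
    refine ⟨_, (c.isTimeDeriv_evol hγ ht.2 hφ).congr ht.2 (hp t ht μ hμ φ),
      (c.eLpNorm_evolDot_le hγ ht.2 φ).trans ?_⟩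
    gcongr
    exact dotConst_mono (by linarith [ht.1])
  · refine esupL2_le fun s hs => ?_
    rw [← hp t ht μ hμ φ hs, ← hp t ht μ' hμ' φ hs]
    have key := h.norm_evol_sub_le_of_mild hγ hK ht hμ (hm t ht μ hμ).1 (hm t ht μ' hμ').1
      (hm t ht μ hμ).2 (hm t ht μ' hμ').2 hφ s hs
    have hd := diffConst_nonneg d γ T
    have hS : 0 ≤ stabConst d γ K T (enormW12 μ).toReal := by unfold stabConst; positivity
    rw [← ofReal_norm, ← ofReal_norm (μ' - μ), ← ENNReal.ofReal_toReal (enormW12_lt_top hφ).ne,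
      ← ENNReal.ofReal_mul (by positivity), ← ENNReal.ofReal_mul (by positivity)]
    exact ENNReal.ofReal_le_ofReal key

end

end FokkerPlanck

end

theorem lemma6p1 (d : ℕ) (γ L T : ℝ) (hγ : 0 < γ) (hL : 0 < L) (hT : 0 < T) :
    ∃ (C₁ C₂ : ℝ) (C₃ : ℝ → ℝ),
      ∀ (b : E d → L2 d → E d) (σ : E d → L2 d → Matrix (Fin d) (Fin d) ℝ),
        UniformlyElliptic γ σ →
        RegularCoefficients L b σ →
        (∀ (x x' : E d) (m : L2 d), b x m = b x' m ∧ σ x m = σ x' m) →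
        ∃ (m : ℝ → L2 d → ℝ → L2 d) (f : ℝ → L2 d → ℝ → E d → E d → ℝ),
          -- `m t μ` is the unique solution of the Fokker-Planck equation started from `(t, μ)`
          (∀ t ∈ Icc 0 T, ∀ μ, MemW12 μ →
            IsFPSolution b σ t T μ (m t μ) ∧
              ∀ m', IsFPSolution b σ t T μ m' → EqOn m' (m t μ) (Icc t T)) ∧
          -- `f t μ` is a translate of a solution started from the Dirac mass at the origin
          (∀ t ∈ Icc 0 T, ∀ μ, MemW12 μ →
            ∃ h : ℝ → E d → ℝ, IsDiracSolution b σ t T (m t μ) 0 h ∧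
              ∀ s ∈ Ioc t T, ∀ x y, f t μ s x y = h s (x - y)) ∧
          FundamentalSolutionEstimates b σ T C₁ C₂ C₃ m f := by
  refine ⟨1 + √(T + 1 / (2 * γ)), √(dotConst d γ (L + d * L ^ 2) T),
    stabConst d γ (L + d * L ^ 2) T, fun b σ he hr hx => ?_⟩
  have hK : 0 ≤ L + d * L ^ 2 := by positivity
  have hs := isStateCoef_of_regular hL.le he hr
  -- The existence statement is made unconditional so that a solution can be chosen as a function of
  -- all (t, μ); outside the admissible range the zero curve is taken.
  have hex : ∀ t μ, ∃ m : ℝ → L2 d, t ∈ Icc 0 T → MemW12 μ → Continuous m ∧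
      (∀ s ∈ Icc t T, m s = evol (fun r => diffusion σ 0 (m r)) (fun r i => b 0 (m r) i) t s μ) ∧
      IsFPSolution b σ t T μ m ∧ ∀ m', IsFPSolution b σ t T μ m' → EqOn m' m (Icc t T) := by
    intro t μ
    by_cases h : t ∈ Icc 0 T ∧ MemW12 μ
    · obtain ⟨m, hm⟩ := exists_fpSolution hγ hL.le h.1 he hr hx h.2
      exact ⟨m, fun _ _ => hm⟩
    · exact ⟨0, fun h1 h2 => (h ⟨h1, h2⟩).elim⟩
  choose m hm using hex
  -- `f` is fixed by unification with the last component: the kernel along `m t μ`, evaluated at x -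
  -- y. The Dirac solution at the origin is the same kernel with y = 0.
  refine ⟨m, _, fun t ht μ hμ => (hm t μ ht hμ).2.2, fun t ht μ hμ => ⟨_, ?_, fun s _ x y => rfl⟩,
    fundamentalSolutionEstimates_kern hγ hK hs hx fun t ht μ hμ =>
      ⟨(hm t μ ht hμ).1, (hm t μ ht hμ).2.1⟩⟩
  have := (hs.isCoef (hm t μ ht hμ).1.aestronglyMeasurable).isDiracSolution_kern hγ t T
    (fun s ψ => dualOp_eq_ellOp hx _ ψ) 0
  simpa only [sub_zero] using this
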